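/- Let $k\ge 2$ and $m_1,\dots,m_k\ge 2$ be integers with $N:=\prod_{i=1}^k m_i\ge 6$, and let $G=(V,E)$ be the $m_1\times\dots\times m_k$ grid graph: $V=\prod_i\{0,\dots,m_i-1\}$, and two vertices are adjacent iff they differ by exactly $1$ in one coordinate and agree in all others. A configuration is an injective map $X:\{1,\dots,N\}\to V$ (robot $i$ is at $X(i)$; since $|V|=N$, all vertices are occupied). A pair $(X,Y)$ of configurations is a valid move if for every $i$ either $Y(i)=X(i)$ or $Y(i)$ is adjacent to $X(i)$, and there are no $i\ne j$ with $X(i)=Y(j)$ and $X(j)=Y(i)$. A solution with makespan $T$ of an instance $(G,X_I,X_G)$, where $X_I,X_G$ are configurations, is a sequence of configurations $X_I=X_0,X_1,\dots,X_T=X_G$ such that every $(X_t,X_{t+1})$, $0\le t<T$, is a valid move. Theorem. There are a single algorithm and an absolute constant $C$ (independent of $k$, of the $m_i$ and of the instance) such that, for all $k$ and $m_1,\dots,m_k$ as above and all configurations $X_I,X_G$, the algorithm, given $k$, $m_1,\dots,m_k$, $X_I$, $X_G$, computes a solution $(X_0,\dots,X_T)$ of $(G,X_I,X_G)$ with makespan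 $$T\le C\,k\sum_{i=1}^k m_i ,$$ in time at most $$C\,k\Bigl(\prod_{i=1}^k m_i\Bigr)\Bigl(\sum_{i=1}^k m_i\Bigr).$$ Here an algorithm is a fixed program for the unit-cost word RAM (assignments to registers and array entries, sequencing, conditionals and while loops; addition, truncated subtraction, multiplication, integer division, remainder, comparisons, register and array accesses cost one time unit each). It has to meet the bounds for every word length $w\ge c\lceil\log_2 N\rceil$, where $c\ge 1$ is a constant that depends only on the program. A vertex $v$ is given as the single word $\sum_i v_i\prod_{j<i}m_j$, a configuration is given as the list of the $N$ vertices that its robots occupy, and the output is the number $T$ together with the full list of the configurations $X_0,\dots,X_T$. -/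

import Mathlib

namespace MPP

/-! ### Multi-robot path planning on graphs -/

/-- A configuration of `n` labeled robots: an injective map from robots to vertices. -/
abbrev Config (n : ℕ) (V : Type*) := Fin n ↪ V

/-- A valid synchronous move from `X` to `Y`: every robot stays or moves along an edge, and no two
distinct robots swap locations.  (Injectivity of `Y` is part of `Config`.) -/
def ValidMove {n : ℕ} {V : Type*} (G : SimpleGraph V) (X Y : Config n V) : Prop :=
  (∀ i, Y i = X i ∨ G.Adj (X i) (Y i)) ∧
    ∀ i j, i ≠ j → X i = Y j → X j ≠ Y i

/-- `X 0, X 1, …, X T` is a solution, of makespan `T`, of the instance `(G, XI, XG)`.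
(Only the values of `X` at `0, …, T` matter.) -/
structure IsSolution {n : ℕ} {V : Type*} (G : SimpleGraph V) (XI XG : Config n V)
    (T : ℕ) (X : ℕ → Config n V) : Prop where
  start : X 0 = XI
  goal : X T = XG
  move : ∀ t < T, ValidMove G (X t) (X (t + 1))

/-- The vertices of the `m 0 × ⋯ × m (k-1)` grid. -/
abbrev GridVertex {k : ℕ} (m : Fin k → ℕ) := ∀ i : Fin k, Fin (m i)

/-- The `m 0 × ⋯ × m (k-1)` grid: two vertices are adjacent iff they differ by exactly one in one
coordinate and agree in all the others. -/
def gridGraph {k : ℕ} (m : Fin k → ℕ) : SimpleGraph (GridVertex m) where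
  Adj u v := ∃ i, ((u i : ℕ) + 1 = v i ∨ (v i : ℕ) + 1 = u i) ∧ ∀ j, j ≠ i → u j = v j
  symm := ⟨fun _ _ ⟨i, h, h'⟩ => ⟨i, h.symm, fun j hj => (h' j hj).symm⟩⟩
  loopless := ⟨fun _ ⟨_, h, _⟩ => by omega⟩

/-- The number of a grid vertex `v`, the mixed-radix value `∑ i, v i * ∏ j < i, m j`;
it is one machine word. -/
def vertexCode {k : ℕ} {m : Fin k → ℕ} (v : GridVertex m) : ℕ :=
  (finPiFinEquiv v : ℕ)

/-! ### Word random access machine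

A program is a fixed piece of imperative code, over finitely many scalar registers and finitely many
arrays of words, which are named by natural numbers.  Words have `w` bits, and every arithmetic
operation, comparison, register access and array access is charged one time unit. -/

/-- Binary word operations. -/
inductive BinOp
  | add | sub | mul | div | mod | lt | eq

/-- The result of an operation on `w`-bit words: `sub` is truncated at `0`, division by `0` gives
`0`, comparisons return `0` or `1`, and results are reduced modulo `2 ^ w`. -/
def BinOp.eval (w : ℕ) (o : BinOp) (a b : ℕ) : ℕ :=
  (match o with
    | .add => a + b
    | .sub => a - b
    | .mul => a * b
    | .div => a / b
    | .mod => a % b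
    | .lt => if a < b then 1 else 0
    | .eq => if a = b then 1 else 0) % 2 ^ w

/-- Expressions: constants, scalar registers, array entries, and operations. -/
inductive Expr
  | const (c : ℕ)
  | var (x : ℕ)
  | get (a : ℕ) (i : Expr)
  | bin (o : BinOp) (e₁ e₂ : Expr)

/-- Machine states: the contents of the scalar registers and of the arrays. -/
structure State where
  var : ℕ → ℕ
  arr : ℕ → ℕ → ℕ

/-- Value of an expression on a machine with `w`-bit words. -/
def Expr.eval (w : ℕ) (s : State) : Expr → ℕ
  | .const c => c % 2 ^ w
  | .var x => s.var x
  | .get a i => s.arr a (i.eval w s)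
  | .bin o e₁ e₂ => o.eval w (e₁.eval w s) (e₂.eval w s)

/-- Time to evaluate an expression: one unit for each constant, register access, array access and
operation in it. -/
def Expr.cost : Expr → ℕ
  | .const _ => 1
  | .var _ => 1
  | .get _ i => i.cost + 1
  | .bin _ e₁ e₂ => e₁.cost + e₂.cost + 1

/-- Programs. -/
inductive Prog
  | skip
  | assign (x : ℕ) (e : Expr)
  | put (a : ℕ) (i e : Expr)
  | seq (p q : Prog)
  | ite (b : Expr) (p q : Prog)
  | loop (b : Expr) (p : Prog)

/-- Write the word `u` to the scalar register `x`. -/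
def State.setVar (s : State) (x u : ℕ) : State :=
  { s with var := Function.update s.var x u }

/-- Write the word `u` to the entry `i` of the array `a`. -/
def State.setArr (s : State) (a i u : ℕ) : State :=
  { s with arr := Function.update s.arr a (Function.update (s.arr a) i u) }

/-- `Exec w p s s' t`: with `w`-bit words, the program `p` started in state `s` halts in state `s'`
after exactly `t` time units.  (`loop b p` is `while b ≠ 0 do p`.) -/
inductive Exec (w : ℕ) : Prog → State → State → ℕ → Prop
  | skip (s : State) : Exec w .skip s s 1
  | assign (s : State) (x : ℕ) (e : Expr) :
      Exec w (.assign x e) s (s.setVar x (e.eval w s)) (e.cost + 1)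
  | put (s : State) (a : ℕ) (i e : Expr) :
      Exec w (.put a i e) s (s.setArr a (i.eval w s) (e.eval w s)) (i.cost + e.cost + 1)
  | seq {p q : Prog} {s s₁ s₂ : State} {t₁ t₂ : ℕ} :
      Exec w p s s₁ t₁ → Exec w q s₁ s₂ t₂ → Exec w (.seq p q) s s₂ (t₁ + t₂)
  | ite_true {b : Expr} {p q : Prog} {s s₁ : State} {t : ℕ} :
      b.eval w s ≠ 0 → Exec w p s s₁ t → Exec w (.ite b p q) s s₁ (b.cost + 1 + t)
  | ite_false {b : Expr} {p q : Prog} {s s₁ : State} {t : ℕ} :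
      b.eval w s = 0 → Exec w q s s₁ t → Exec w (.ite b p q) s s₁ (b.cost + 1 + t)
  | loop_true {b : Expr} {p : Prog} {s s₁ s₂ : State} {t₁ t₂ : ℕ} :
      b.eval w s ≠ 0 → Exec w p s s₁ t₁ → Exec w (.loop b p) s₁ s₂ t₂ →
        Exec w (.loop b p) s s₂ (b.cost + 1 + t₁ + t₂)
  | loop_false {b : Expr} {p : Prog} {s : State} :
      b.eval w s = 0 → Exec w (.loop b p) s s (b.cost + 1)

/-! ### Input and output -/

/-- The list `f 0, …, f (n-1)` stored in an array, followed by zeros. -/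
def toArray {n : ℕ} (f : Fin n → ℕ) (i : ℕ) : ℕ :=
  if h : i < n then f ⟨i, h⟩ else 0

/-- The initial state for an instance on the grid with side lengths `m`: register `0` holds `k`,
array `0` holds the side lengths, and arrays `1` and `2` list the vertex numbers of the initial and
the goal locations of the robots.  Everything else is `0`. -/
def inputState {k : ℕ} {m : Fin k → ℕ} {n : ℕ} (XI XG : Config n (GridVertex m)) : State where
  var x := if x = 0 then k else 0
  arr a :=
    if a = 0 then toArray m
    else if a = 1 then toArray fun r => vertexCode (XI r)
    else if a = 2 then toArray fun r => vertexCode (XG r)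
    else fun _ => 0

/-- The final state `s` displays the sequence `X 0, …, X T`: register `0` holds `T`, and array `3`
lists the configurations one after the other, each as the list of the vertex numbers of the
locations of the `n` robots. -/
def Outputs {k : ℕ} {m : Fin k → ℕ} {n : ℕ} (s : State) (T : ℕ)
    (X : ℕ → Config n (GridVertex m)) : Prop :=
  s.var 0 = T ∧ ∀ t ≤ T, ∀ r : Fin n, s.arr 3 (t * n + r) = vertexCode (X t r)

end MPP

namespace MPP

/-! ### Exact semantics of loop-free code -/

/-! The algorithm is divide and conquer over boxes whose sides are powers of two, under the
invariant that every robot lies in the box of its goal. One level of the recursion passes from side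
`2h` to side `h`, cutting one direction `i` after the other. For a cut in direction `i`, a robot is
marked if its goal lies in the left half of its box. Each box holds exactly the robots with goals in
it, so it has as many marked robots as left vertices, and the cut has to bring the marked robots to
the left.

A cut consists of `k` stages that permute robots along the lines of the boxes, in the directions
`i+1, …, i+k-1, i` modulo `k`. A slab is the part of a box with prescribed coordinates in the
directions treated so far; the invariant `Dims.Balanced` says that every slab has as many marked
robots as left vertices. Let the lines of a slab in direction `j` have length `L`. Line by line, the
marked robots get the targets `0, 1, 2, …` modulo `L`, and the unmarked ones `L-1, L-2, …` modulo
`L`. Whole lines use up a multiple of `L` robots, so the two sequences do not collide within a line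
(`Lines.tgt_ne`). If `j ≠ i`, translation along `j` shows that the number of left vertices is a
multiple of `L`, and the marked robots are spread evenly. In the last stage `j = i`, a slab is a
line, and the marked robots fill its left end (`Dims.card_left`, `Dims.balanced_stage`). Finally
slabs are single vertices, and balance says that marked robots are exactly on left vertices
(`Dims.balanced_last`).

All lines are sorted in parallel by odd-even transposition, in `4h` rounds (`OddEven.sorted`,
`Dims.routed`). Two neighbours cannot swap directly, but in a 2×3 ladder five moves exchange them
and restore the other robots; such a ladder exists around every edge (`Dims.ladder_block`). A ladder
leaves its base vertex by at most 2, in at most three directions, so the residues modulo 5 give 125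
classes of pairwise disjoint ladders. A round thus takes `125 · 5 = 625` moves, a stage `2500 h`, a
cut `2500 k h`. Direction `l` is cut only for `h < m_l`, and the powers of two below `m_l` add up to
at most `2 m_l` (`cutSum_le`), hence the makespan is at most `5000 k ∑ m_l`. The work per move is
linear in `N`, which gives the running time.

Programs are analysed in exact arithmetic: expressions of size at most 64 over numbers at most `B`
have values at most `B ^ 64 < 2 ^ w`, so nothing overflows (`Expr.eval_eq_nval`). Loop-free code is
handled by weakest preconditions, counted loops by invariants (`Runs.for`). -/

instance : Add Expr := ⟨Expr.bin .add⟩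
instance : Sub Expr := ⟨Expr.bin .sub⟩
instance : Mul Expr := ⟨Expr.bin .mul⟩
instance : Div Expr := ⟨Expr.bin .div⟩
instance : Mod Expr := ⟨Expr.bin .mod⟩

/-- The expression `a < b`. -/
def Expr.ltE (a b : Expr) : Expr := Expr.bin .lt a b
/-- The expression `a = b`. -/
def Expr.eqE (a b : Expr) : Expr := Expr.bin .eq a b

/-- The exact result of an operation on natural numbers. -/
def BinOp.nval (o : BinOp) (a b : ℕ) : ℕ :=
  match o with
  | .add => a + b
  | .sub => a - b
  | .mul => a * b
  | .div => a / b
  | .mod => a % b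
  | .lt => if a < b then 1 else 0
  | .eq => if a = b then 1 else 0

/-- The exact value of an expression, without reduction modulo the word size. -/
def Expr.nval (s : State) : Expr → ℕ
  | .const c => c
  | .var x => s.var x
  | .get a i => s.arr a (i.nval s)
  | .bin o e₁ e₂ => o.nval (e₁.nval s) (e₂.nval s)

/-- The number of nodes of an expression. -/
def Expr.size : Expr → ℕ
  | .const _ => 1
  | .var _ => 1
  | .get _ i => i.size + 1
  | .bin _ e₁ e₂ => e₁.size + e₂.size

/-- Every constant, register and array entry read by the expression is at most `B`. -/
def Expr.Bdd (B : ℕ) (s : State) : Expr → Prop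
  | .const c => c ≤ B
  | .var x => s.var x ≤ B
  | .get a i => i.Bdd B s ∧ s.arr a (i.nval s) ≤ B
  | .bin _ e₁ e₂ => e₁.Bdd B s ∧ e₂.Bdd B s

section simpLemmas
variable (B c x a : ℕ) (s : State) (e f : Expr)
@[simp] theorem Expr.nval_const : (Expr.const c).nval s = c := rfl
@[simp] theorem Expr.nval_var : (Expr.var x).nval s = s.var x := rfl
@[simp] theorem Expr.nval_get : (Expr.get a e).nval s = s.arr a (e.nval s) := rfl
@[simp] theorem Expr.nval_add : (e + f).nval s = e.nval s + f.nval s := rfl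
@[simp] theorem Expr.nval_sub : (e - f).nval s = e.nval s - f.nval s := rfl
@[simp] theorem Expr.nval_mul : (e * f).nval s = e.nval s * f.nval s := rfl
@[simp] theorem Expr.nval_div : (e / f).nval s = e.nval s / f.nval s := rfl
@[simp] theorem Expr.nval_mod : (e % f).nval s = e.nval s % f.nval s := rfl
@[simp] theorem Expr.nval_lt : (e.ltE f).nval s = if e.nval s < f.nval s then 1 else 0 := rfl
@[simp] theorem Expr.nval_eq : (e.eqE f).nval s = if e.nval s = f.nval s then 1 else 0 := rfl
@[simp] theorem Expr.bdd_const : (Expr.const c).Bdd B s ↔ c ≤ B := Iff.rfl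
@[simp] theorem Expr.bdd_var : (Expr.var x).Bdd B s ↔ s.var x ≤ B := Iff.rfl
@[simp] theorem Expr.bdd_get : (Expr.get a e).Bdd B s ↔ e.Bdd B s ∧ s.arr a (e.nval s) ≤ B := Iff.rfl
@[simp] theorem Expr.bdd_add : (e + f).Bdd B s ↔ e.Bdd B s ∧ f.Bdd B s := Iff.rfl
@[simp] theorem Expr.bdd_sub : (e - f).Bdd B s ↔ e.Bdd B s ∧ f.Bdd B s := Iff.rfl
@[simp] theorem Expr.bdd_mul : (e * f).Bdd B s ↔ e.Bdd B s ∧ f.Bdd B s := Iff.rfl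
@[simp] theorem Expr.bdd_div : (e / f).Bdd B s ↔ e.Bdd B s ∧ f.Bdd B s := Iff.rfl
@[simp] theorem Expr.bdd_mod : (e % f).Bdd B s ↔ e.Bdd B s ∧ f.Bdd B s := Iff.rfl
@[simp] theorem Expr.bdd_lt : (e.ltE f).Bdd B s ↔ e.Bdd B s ∧ f.Bdd B s := Iff.rfl
@[simp] theorem Expr.bdd_eq : (e.eqE f).Bdd B s ↔ e.Bdd B s ∧ f.Bdd B s := Iff.rfl
variable (y u i : ℕ)
@[simp] theorem State.setVar_var : (s.setVar x u).var y = if y = x then u else s.var y := by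
  simp [State.setVar, Function.update_apply]
@[simp] theorem State.setVar_arr : (s.setVar x u).arr = s.arr := rfl
@[simp] theorem State.setArr_var : (s.setArr a i u).var = s.var := rfl
@[simp] theorem State.setArr_arr : (s.setArr a i u).arr y =
    if y = a then Function.update (s.arr a) i u else s.arr y := by
  simp [State.setArr, Function.update_apply]
end simpLemmas

theorem Expr.size_pos (e : Expr) : 1 ≤ e.size := by
  induction e <;> simp [Expr.size] <;> omega

/-- As both powers are at least 2, their sum is at most their product; therefore sizes simply add up
under every operation. -/
theorem BinOp.nval_le {B m n a b : ℕ} (hB : 2 ≤ B) (hm : 1 ≤ m) (hn : 1 ≤ n)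
    (ha : a ≤ B ^ m) (hb : b ≤ B ^ n) (o : BinOp) : o.nval a b ≤ B ^ (m + n) := by
  have h1 : 2 ≤ B ^ m := hB.trans (Nat.le_self_pow (by omega) B)
  have h2 : 2 ≤ B ^ n := hB.trans (Nat.le_self_pow (by omega) B)
  have h3 : B ^ m * 2 ≤ B ^ m * B ^ n := Nat.mul_le_mul_left _ h2
  have h4 : 2 * B ^ n ≤ B ^ m * B ^ n := Nat.mul_le_mul_right _ h1
  rw [pow_add]
  cases o <;> simp only [BinOp.nval]
  · omega
  · omega
  · exact Nat.mul_le_mul ha hb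
  · have := Nat.div_le_self a b; omega
  · have := Nat.mod_le a b; omega
  · split_ifs <;> omega
  · split_ifs <;> omega

theorem Expr.nval_le {B : ℕ} (hB : 2 ≤ B) {s : State} :
    ∀ {e : Expr}, e.Bdd B s → e.nval s ≤ B ^ e.size
  | .const c, h => by simpa [Expr.size] using h
  | .var x, h => by simpa [Expr.size] using h
  | .get a i, h => h.2.trans (Nat.le_self_pow (by simp [Expr.size]) B)
  | .bin o e₁ e₂, h =>
    BinOp.nval_le hB e₁.size_pos e₂.size_pos (Expr.nval_le hB h.1) (Expr.nval_le hB h.2) o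

/-- A word length which leaves room for every expression of size at most `64` over numbers that are
at most `B`. -/
structure Room (w B : ℕ) : Prop where
  two_le : 2 ≤ B
  lt : B ^ 64 < 2 ^ w

theorem Room.pow_lt {w B n : ℕ} (h : Room w B) (hn : n ≤ 64) : B ^ n < 2 ^ w :=
  (Nat.pow_le_pow_right (by have := h.two_le; omega) hn).trans_lt h.lt

/-- Subexpressions are no larger than the whole expression, so each intermediate value is at most `B
^ 64 < 2 ^ w` and each reduction modulo `2 ^ w` is void. -/
theorem Expr.eval_eq_nval {w B : ℕ} (hw : Room w B) {s : State} :
    ∀ {e : Expr}, e.Bdd B s → e.size ≤ 64 → e.eval w s = e.nval s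
  | .const c, h, _ => Nat.mod_eq_of_lt ((show c ≤ B ^ 1 by simpa using h).trans_lt
      (hw.pow_lt (by norm_num)))
  | .var x, _, _ => rfl
  | .get a i, h, hs => by
    have := Expr.eval_eq_nval hw h.1 (by simp only [Expr.size] at hs; omega)
    simp [Expr.eval, this]
  | .bin o e₁ e₂, h, hs => by
    have hs' := hs
    simp only [Expr.size] at hs
    have h1 := Expr.eval_eq_nval hw h.1 (by omega)
    have h2 := Expr.eval_eq_nval hw h.2 (by omega)
    have h3 := (Expr.nval_le hw.two_le (e := .bin o e₁ e₂) h).trans_lt (hw.pow_lt hs')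
    rw [Expr.eval, h1, h2]
    cases o <;> exact Nat.mod_eq_of_lt h3

/-! ### Execution with time bounds: frames, weakest preconditions, counted loops -/

/-- `Runs w p s t Q`: started in `s`, the program halts within `t` time units in a state that
satisfies `Q`. -/
def Runs (w : ℕ) (p : Prog) (s : State) (t : ℕ) (Q : State → Prop) : Prop :=
  ∃ s' t', Exec w p s s' t' ∧ t' ≤ t ∧ Q s'

/-- The registers written by a program. -/
def Prog.wvar : Prog → List ℕ
  | .skip => []
  | .assign x _ => [x]
  | .put _ _ _ => []
  | .seq p q => p.wvar ++ q.wvar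
  | .ite _ p q => p.wvar ++ q.wvar
  | .loop _ p => p.wvar

/-- The arrays written by a program. -/
def Prog.warr : Prog → List ℕ
  | .skip => []
  | .assign _ _ => []
  | .put a _ _ => [a]
  | .seq p q => p.warr ++ q.warr
  | .ite _ p q => p.warr ++ q.warr
  | .loop _ p => p.warr

/-- The states agree outside the registers and arrays that the program writes. -/
structure Frame (p : Prog) (s s' : State) : Prop where
  var : ∀ x, x ∉ p.wvar → s'.var x = s.var x
  arr : ∀ a, a ∉ p.warr → s'.arr a = s.arr a

/-- The write lists are computed from the text of the program, so for concrete programs the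
preservation of untouched memory is settled by `decide`. -/
theorem Exec.frame {w : ℕ} {p : Prog} {s s' : State} {t : ℕ} (h : Exec w p s s' t) :
    Frame p s s' := by
  induction h with
  | skip => exact ⟨fun _ _ => rfl, fun _ _ => rfl⟩
  | assign s x e =>
    refine ⟨fun y hy => ?_, fun _ _ => rfl⟩
    simp only [Prog.wvar, List.mem_singleton] at hy
    simp [hy]
  | put s a i e =>
    refine ⟨fun _ _ => rfl, fun y hy => ?_⟩
    simp only [Prog.warr, List.mem_singleton] at hy
    simp [hy]
  | seq _ _ h1 h2 =>
    refine ⟨fun y hy => ?_, fun y hy => ?_⟩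
    · simp only [Prog.wvar, List.mem_append, not_or] at hy
      rw [h2.var y hy.2, h1.var y hy.1]
    · simp only [Prog.warr, List.mem_append, not_or] at hy
      rw [h2.arr y hy.2, h1.arr y hy.1]
  | ite_true _ _ h =>
    refine ⟨fun y hy => h.var y ?_, fun y hy => h.arr y ?_⟩
    · simp only [Prog.wvar, List.mem_append, not_or] at hy; exact hy.1
    · simp only [Prog.warr, List.mem_append, not_or] at hy; exact hy.1
  | ite_false _ _ h =>
    refine ⟨fun y hy => h.var y ?_, fun y hy => h.arr y ?_⟩
    · simp only [Prog.wvar, List.mem_append, not_or] at hy; exact hy.2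
    · simp only [Prog.warr, List.mem_append, not_or] at hy; exact hy.2
  | loop_true _ _ _ h1 h2 =>
    exact ⟨fun y hy => (h2.var y hy).trans (h1.var y hy),
      fun y hy => (h2.arr y hy).trans (h1.arr y hy)⟩
  | loop_false _ => exact ⟨fun _ _ => rfl, fun _ _ => rfl⟩

theorem Runs.mono {w : ℕ} {p : Prog} {s : State} {t t' : ℕ} {Q Q' : State → Prop}
    (h : Runs w p s t Q) (ht : t ≤ t') (hQ : ∀ s', Frame p s s' → Q s' → Q' s') :
    Runs w p s t' Q' := by
  obtain ⟨s', u, he, hu, hq⟩ := h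
  exact ⟨s', u, he, hu.trans ht, hQ s' he.frame hq⟩

theorem Runs.seq {w : ℕ} {p q : Prog} {s : State} {t₁ t₂ : ℕ} {Q R : State → Prop}
    (hp : Runs w p s t₁ R) (hq : ∀ s', Frame p s s' → R s' → Runs w q s' t₂ Q) :
    Runs w (.seq p q) s (t₁ + t₂) Q := by
  obtain ⟨s', u, he, hu, hr⟩ := hp
  obtain ⟨s'', u', he', hu', hq⟩ := hq s' he.frame hr
  exact ⟨s'', _, .seq he he', by omega, hq⟩

/-- Running time of loop-free code. -/
def Prog.cost : Prog → ℕ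
  | .skip => 1
  | .assign _ e => e.cost + 1
  | .put _ i e => i.cost + e.cost + 1
  | .seq p q => p.cost + q.cost
  | .ite b p q => b.cost + 1 + max p.cost q.cost
  -- A junk value: the weakest precondition of a loop is `False`.
  | .loop _ _ => 0

/-- All expressions have size at most `64`. -/
def Prog.small : Prog → Bool
  | .skip => true
  | .assign _ e => e.size ≤ 64
  | .put _ i e => i.size ≤ 64 && e.size ≤ 64
  | .seq p q => p.small && q.small
  | .ite b p q => b.size ≤ 64 && p.small && q.small
  | .loop b p => b.size ≤ 64 && p.small

/-- Weakest precondition of loop-free code, in exact arithmetic. -/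
def Prog.wp (B : ℕ) : Prog → (State → Prop) → State → Prop
  | .skip, Q, s => Q s
  | .assign x e, Q, s => e.Bdd B s ∧ Q (s.setVar x (e.nval s))
  | .put a i e, Q, s => i.Bdd B s ∧ e.Bdd B s ∧ Q (s.setArr a (i.nval s) (e.nval s))
  | .seq p q, Q, s => p.wp B (q.wp B Q) s
  | .ite b p q, Q, s => b.Bdd B s ∧ (b.nval s ≠ 0 → p.wp B Q s) ∧ (b.nval s = 0 → q.wp B Q s)
  | .loop _ _, _, _ => False

theorem Prog.runs_of_wp {w B : ℕ} (hw : Room w B) : ∀ {p : Prog} {s : State} {Q : State → Prop},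
    p.small = true → p.wp B Q s → Runs w p s p.cost Q
  | .skip, s, Q, _, h => ⟨s, 1, .skip s, le_rfl, h⟩
  | .assign x e, s, Q, hs, h => by
    refine ⟨_, _, .assign s x e, le_rfl, ?_⟩
    rw [Expr.eval_eq_nval hw h.1 (by simpa [Prog.small] using hs)]; exact h.2
  | .put a i e, s, Q, hs, h => by
    simp only [Prog.small, Bool.and_eq_true, decide_eq_true_eq] at hs
    refine ⟨_, _, .put s a i e, le_rfl, ?_⟩
    rw [Expr.eval_eq_nval hw h.1 hs.1, Expr.eval_eq_nval hw h.2.1 hs.2]; exact h.2.2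
  | .seq p q, s, Q, hs, h => by
    simp only [Prog.small, Bool.and_eq_true] at hs
    exact Runs.seq (Prog.runs_of_wp hw hs.1 h) fun s' _ h' => Prog.runs_of_wp hw hs.2 h'
  | .ite b p q, s, Q, hs, h => by
    simp only [Prog.small, Bool.and_eq_true, decide_eq_true_eq] at hs
    have hb := Expr.eval_eq_nval hw h.1 hs.1.1
    by_cases h0 : b.nval s = 0
    · obtain ⟨s', t, he, ht, hq⟩ := Prog.runs_of_wp hw hs.2 (h.2.2 h0)
      exact ⟨s', _, .ite_false (hb.trans h0) he, by
        have := le_max_right p.cost q.cost; simp only [Prog.cost]; omega, hq⟩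
    · obtain ⟨s', t, he, ht, hq⟩ := Prog.runs_of_wp hw hs.1.2 (h.2.1 h0)
      exact ⟨s', _, .ite_true (hb.trans_ne h0) he, by
        have := le_max_left p.cost q.cost; simp only [Prog.cost]; omega, hq⟩

theorem Runs.ite {w B : ℕ} (hw : Room w B) {b : Expr} {p q : Prog} {s : State} {t : ℕ}
    {Q : State → Prop} (hs : b.size ≤ 64) (hb : b.Bdd B s)
    (hp : b.nval s ≠ 0 → Runs w p s t Q) (hq : b.nval s = 0 → Runs w q s t Q) :
    Runs w (.ite b p q) s (b.cost + 1 + t) Q := by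
  have hb := Expr.eval_eq_nval hw hb hs
  by_cases h0 : b.nval s = 0
  · obtain ⟨s', t, he, ht, h⟩ := hq h0
    exact ⟨s', _, .ite_false (hb.trans h0) he, by omega, h⟩
  · obtain ⟨s', t, he, ht, h⟩ := hp h0
    exact ⟨s', _, .ite_true (hb.trans_ne h0) he, by omega, h⟩

/-- `for x = 0, …, n - 1 do p`. -/
def Prog.for (x : ℕ) (n : Expr) (p : Prog) : Prog :=
  .seq (.assign x (.const 0))
    (.loop (Expr.ltE (.var x) n) (.seq p (.assign x (.var x + .const 1))))

/-- Rule for counted loops. -/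
theorem Runs.for {w B : ℕ} (hw : Room w B) {x : ℕ} {e : Expr} {p : Prog} {s : State} {n : ℕ}
    (I : ℕ → State → Prop) (c : ℕ → ℕ) {Q : State → Prop} (hx : x ∉ p.wvar)
    (hsz : e.size ≤ 63) (hn : n < B)
    (he : ∀ s', Frame (.for x e p) s s' → e.Bdd B s' ∧ e.nval s' = n)
    (h0 : I 0 (s.setVar x 0))
    (hstep : ∀ i < n, ∀ s', Frame (.for x e p) s s' → I i s' → s'.var x = i →
      Runs w p s' (c i) fun s'' => I (i + 1) (s''.setVar x (i + 1)))
    (hQ : ∀ s', Frame (.for x e p) s s' → I n s' → Q s') :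
    Runs w (.for x e p) s ((∑ i ∈ Finset.range n, c i) + (n + 1) * (e.cost + 7)) Q := by
  have hB := hw.two_le
  -- Induction on the number `d` of remaining iterations. Each one costs `e.cost + 3` for the test
  -- and `4` for the increment besides the body, and the failing test costs `e.cost + 3`.
  have key : ∀ d i, i + d = n → ∀ s', Frame (.for x e p) s s' → I i s' → s'.var x = i →
      Runs w (.loop (Expr.ltE (.var x) e) (.seq p (.assign x (.var x + .const 1)))) s'
        ((∑ l ∈ Finset.Ico i n, c l) + (d * (e.cost + 7) + (e.cost + 3)))
        (fun s' => Frame (.for x e p) s s' ∧ I n s') := by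
    intro d
    induction d with
    | zero =>
      intro i hi s' hf hI hv
      obtain ⟨hb, hv'⟩ := he s' hf
      refine ⟨s', _, .loop_false ?_, ?_, hf, by rwa [← hi]⟩
      · rw [Expr.eval_eq_nval hw (B := B)]
        · simp [hv, hv']; omega
        · simp [hb, hv]; omega
        · simp [Expr.ltE, Expr.size]; omega
      · simp [Expr.ltE, Expr.cost]; omega
    | succ d ih =>
      intro i hi s' hf hI hv
      obtain ⟨hb, hv'⟩ := he s' hf
      obtain ⟨s₁, t₁, he₁, ht₁, hI₁⟩ := hstep i (by omega) s' hf hI hv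
      have hv₁ : s₁.var x = i := (he₁.frame.var x hx).trans hv
      have hev : (Expr.var x + .const 1).eval w s₁ = i + 1 := by
        rw [Expr.eval_eq_nval hw (B := B)]
        · simp [hv₁]
        · simp [hv₁]; omega
        · exact (by norm_num : (1 + 1 : ℕ) ≤ 64)
      have hx' := Exec.assign (w := w) s₁ x (.var x + .const 1)
      rw [hev] at hx'
      have hf₁ : Frame (.for x e p) s (s₁.setVar x (i + 1)) := by
        have hs := (Exec.seq he₁ hx').frame
        constructor
        · intro y hy
          rw [hs.var y, hf.var y hy]
          simp only [Prog.for, Prog.wvar, List.mem_append, not_or] at hy ⊢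
          exact hy.2
        · intro y hy
          rw [hs.arr y, hf.arr y hy]
          simp only [Prog.for, Prog.warr, List.mem_append, not_or] at hy ⊢
          exact hy.2
      obtain ⟨s₂, t₂, he₂, ht₂, hI₂⟩ := ih (i + 1) (by omega) _ hf₁ hI₁ (by simp)
      refine ⟨s₂, _, .loop_true ?_ (.seq he₁ hx') he₂, ?_, hI₂⟩
      · rw [Expr.eval_eq_nval hw (B := B)]
        · simp [hv, hv']; omega
        · simp [hb, hv]; omega
        · simp [Expr.ltE, Expr.size]; omega
      · rw [Finset.sum_eq_sum_Ico_succ_bot (by omega)]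
        have e1 : (Expr.ltE (.var x) e).cost = e.cost + 2 := by simp [Expr.ltE, Expr.cost]; omega
        have e2 : (Expr.var x + .const 1).cost = 3 := rfl
        rw [e1, e2, add_mul]; omega
  have hs0 : Exec w (.assign x (.const 0)) s (s.setVar x 0) 2 := by
    have := Exec.assign (w := w) s x (.const 0)
    simpa [Expr.eval, Expr.cost] using this
  have hf0 : Frame (.for x e p) s (s.setVar x 0) := by
    constructor
    · intro y hy
      simp only [Prog.for, Prog.wvar, List.mem_append, List.mem_singleton, not_or] at hy
      simp [hy.1]
    · intro y _; rfl
  obtain ⟨s', t', he', ht', hf', hI'⟩ := key n 0 (by omega) _ hf0 h0 (by simp)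
  refine ⟨s', _, .seq hs0 he', ?_, hQ s' hf' hI'⟩
  rw [Finset.range_eq_Ico, add_mul]; omega

theorem Runs.for_const {w B : ℕ} (hw : Room w B) {x : ℕ} {e : Expr} {p : Prog} {s : State} {n : ℕ}
    (I : ℕ → State → Prop) (c : ℕ) {Q : State → Prop} (hx : x ∉ p.wvar)
    (hsz : e.size ≤ 63) (hn : n < B)
    (he : ∀ s', Frame (.for x e p) s s' → e.Bdd B s' ∧ e.nval s' = n)
    (h0 : I 0 (s.setVar x 0))
    (hstep : ∀ i < n, ∀ s', Frame (.for x e p) s s' → I i s' → s'.var x = i →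
      Runs w p s' c fun s'' => I (i + 1) (s''.setVar x (i + 1)))
    (hQ : ∀ s', Frame (.for x e p) s s' → I n s' → Q s') :
    Runs w (.for x e p) s ((n + 1) * (c + e.cost + 7)) Q :=
  (Runs.for hw I (fun _ => c) hx hsz hn he h0 hstep hQ).mono (by simp; nlinarith) fun _ _ h => h


/-! ### Coordinates of vertex numbers -/

/-- Side lengths of a grid, as a function on `ℕ`. -/
structure Dims where
  k : ℕ
  m : ℕ → ℕ
  two_le_k : 2 ≤ k
  two_le : ∀ j < k, 2 ≤ m j
  six_le : 6 ≤ ∏ j ∈ Finset.range k, m j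

namespace Dims
variable (d : Dims)

/-- The stride of coordinate `j`. -/
def P (j : ℕ) : ℕ := ∏ l ∈ Finset.range j, d.m l

/-- The number of vertices. -/
def N : ℕ := d.P d.k

/-- Coordinate `j` of the vertex with number `v`. -/
def x (j v : ℕ) : ℕ := v / d.P j % d.m j

/-- The number of the vertex which is obtained from `v` by setting coordinate `j` to `y`. -/
def setc (j v y : ℕ) : ℕ := v + y * d.P j - d.x j v * d.P j

variable {d}

theorem six_le_N : 6 ≤ d.N := d.six_le

theorem P_zero : d.P 0 = 1 := rfl

theorem P_succ (j : ℕ) : d.P (j + 1) = d.P j * d.m j := Finset.prod_range_succ _ _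

theorem m_pos {j : ℕ} (hj : j < d.k) : 0 < d.m j := by have := d.two_le j hj; omega

theorem P_pos {j : ℕ} (hj : j ≤ d.k) : 0 < d.P j :=
  Finset.prod_pos fun l hl => m_pos (by have := Finset.mem_range.1 hl; omega)

theorem P_dvd {i j : ℕ} (h : i ≤ j) : d.P i ∣ d.P j :=
  Finset.prod_dvd_prod_of_subset _ _ _ (by simpa using h)

theorem P_le_N {j : ℕ} (hj : j ≤ d.k) : d.P j ≤ d.N :=
  Nat.le_of_dvd (P_pos le_rfl) (P_dvd hj)

theorem m_le_N {j : ℕ} (hj : j < d.k) : d.m j ≤ d.N :=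
  Nat.le_of_dvd (P_pos le_rfl) ((Dvd.intro_left _ (P_succ j).symm).trans (P_dvd hj))

theorem two_pow_le_P {j : ℕ} (hj : j ≤ d.k) : 2 ^ j ≤ d.P j := by
  induction j with
  | zero => simp [P_zero]
  | succ j ih =>
    rw [pow_succ, P_succ]
    exact Nat.mul_le_mul (ih (by omega)) (d.two_le j (by omega))

theorem k_lt_N : d.k < d.N := Nat.lt_two_pow_self.trans_le (two_pow_le_P le_rfl)

theorem x_lt {j : ℕ} (hj : j < d.k) (v : ℕ) : d.x j v < d.m j := Nat.mod_lt _ (m_pos hj)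

theorem mod_P_succ (j v : ℕ) : v % d.P (j + 1) = v % d.P j + d.P j * d.x j v := by
  rw [P_succ, Nat.mod_mul]; rfl

theorem x_eq_div {j : ℕ} (v : ℕ) : d.x j v = v % d.P (j + 1) / d.P j := by
  rw [P_succ, Nat.mod_mul_right_div_self]; rfl

/-- Vertices are determined by their coordinates. -/
theorem ext {u v : ℕ} (hu : u < d.N) (hv : v < d.N) (h : ∀ j < d.k, d.x j u = d.x j v) : u = v := by
  have : ∀ j ≤ d.k, u % d.P j = v % d.P j := by
    intro j
    induction j with
    | zero => simp [P_zero, Nat.mod_one]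
    | succ j ih => intro hj; rw [mod_P_succ, mod_P_succ, ih (by omega), h j (by omega)]
  have := this d.k le_rfl
  exact (Nat.mod_eq_of_lt hu).symm.trans (this.trans (Nat.mod_eq_of_lt hv))

theorem decomp {j : ℕ} (v : ℕ) :
    v = v % d.P j + d.x j v * d.P j + v / d.P (j + 1) * d.P (j + 1) := by
  have h1 := Nat.mod_add_div v (d.P (j + 1))
  have h2 := mod_P_succ (d := d) j v
  rw [mul_comm (d.P j)] at h2
  rw [mul_comm (d.P (j + 1))] at h1
  omega

theorem setc_eq {j : ℕ} (v y : ℕ) :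
    d.setc j v y = v % d.P j + y * d.P j + v / d.P (j + 1) * d.P (j + 1) := by
  have := decomp (d := d) (j := j) v
  unfold setc; omega

/-- Uniqueness of mixed-radix digits. All formulas for the coordinates of `setc`, `enum` and digit
sums come from here. -/
theorem digits_of_form {j lo y hi : ℕ} (hj : j < d.k) (hlo : lo < d.P j) (hy : y < d.m j) :
    let u := lo + y * d.P j + hi * d.P (j + 1)
    u % d.P j = lo ∧ d.x j u = y ∧ u / d.P (j + 1) = hi := by
  intro u
  have hP := P_pos (d := d) hj.le
  have hP' := P_pos (d := d) hj
  have hlt : lo + y * d.P j < d.P (j + 1) := by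
    rw [P_succ]
    have : (y + 1) * d.P j ≤ d.m j * d.P j := Nat.mul_le_mul_right _ hy
    rw [add_mul] at this; rw [mul_comm (d.P j)]; omega
  have hmod : u % d.P (j + 1) = lo + y * d.P j := by
    simp only [u, Nat.add_mul_mod_self_right]; exact Nat.mod_eq_of_lt hlt
  refine ⟨?_, ?_, ?_⟩
  · rw [← Nat.mod_mod_of_dvd u (P_dvd (d := d) (Nat.le_succ j)), hmod, Nat.add_mul_mod_self_right,
      Nat.mod_eq_of_lt hlo]
  · rw [x_eq_div, hmod, Nat.add_mul_div_right _ _ hP, Nat.div_eq_of_lt hlo, zero_add]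
  · simp only [u]; rw [Nat.add_mul_div_right _ _ hP', Nat.div_eq_of_lt hlt, zero_add]

theorem x_eq_of_mod {l j u v : ℕ} (hl : l < j) (h : u % d.P j = v % d.P j) :
    d.x l u = d.x l v := by
  rw [x_eq_div, x_eq_div, ← Nat.mod_mod_of_dvd u (P_dvd (d := d) (show l + 1 ≤ j from hl)), h,
    Nat.mod_mod_of_dvd _ (P_dvd (d := d) (show l + 1 ≤ j from hl))]

theorem x_eq_of_div {l j u v : ℕ} (hl : j < l) (h : u / d.P (j + 1) = v / d.P (j + 1)) :
    d.x l u = d.x l v := by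
  obtain ⟨c, hc⟩ := P_dvd (d := d) (show j + 1 ≤ l from hl)
  rw [x, x, hc, ← Nat.div_div_eq_div_mul, h, Nat.div_div_eq_div_mul]

/-- `P (j + 1)` divides `N`, so whether a number is below `N` depends only on its quotient by `P (j
+ 1)`. -/
theorem lt_N_of_div {j u v : ℕ} (hj : j < d.k) (hv : v < d.N)
    (h : u / d.P (j + 1) = v / d.P (j + 1)) : u < d.N := by
  obtain ⟨c, hc⟩ := P_dvd (d := d) (show j + 1 ≤ d.k from hj)
  rw [N, hc] at hv ⊢
  have := (Nat.div_lt_iff_lt_mul (P_pos (d := d) hj)).2 ((mul_comm _ c) ▸ hv)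
  rw [← h, Nat.div_lt_iff_lt_mul (P_pos hj)] at this
  rwa [mul_comm]

theorem setc_lt {j v y : ℕ} (hj : j < d.k) (hv : v < d.N) (hy : y < d.m j) : d.setc j v y < d.N := by
  rw [setc_eq]
  exact lt_N_of_div hj hv (digits_of_form hj (Nat.mod_lt _ (P_pos hj.le)) hy).2.2

theorem x_setc {j v y : ℕ} (hj : j < d.k) (hy : y < d.m j) (l : ℕ) :
    d.x l (d.setc j v y) = if l = j then y else d.x l v := by
  rw [setc_eq]
  obtain ⟨h1, h2, h3⟩ := digits_of_form (hi := v / d.P (j + 1)) hj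
    (Nat.mod_lt v (P_pos (d := d) hj.le)) hy
  split_ifs with h
  · rw [h, h2]
  · rcases Nat.lt_or_gt_of_ne h with h | h
    · exact x_eq_of_mod h h1
    · exact x_eq_of_div h h3

theorem x_setc_self {j v y : ℕ} (hj : j < d.k) (hy : y < d.m j) : d.x j (d.setc j v y) = y := by
  rw [x_setc hj hy, if_pos rfl]

theorem x_setc_ne {j v y l : ℕ} (hj : j < d.k) (hy : y < d.m j) (h : l ≠ j) :
    d.x l (d.setc j v y) = d.x l v := by
  rw [x_setc hj hy, if_neg h]

theorem eq_setc {j u v : ℕ} (hj : j < d.k) (hu : u < d.N) (hv : v < d.N)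
    (h : ∀ l < d.k, l ≠ j → d.x l u = d.x l v) : u = d.setc j v (d.x j u) := by
  refine ext hu (setc_lt hj hv (x_lt hj u)) fun l hl => ?_
  rw [x_setc hj (x_lt hj u)]
  split_ifs with e
  · rw [e]
  · exact h l hl e

theorem setc_add {j v a : ℕ} : d.setc j v (d.x j v + a) = v + a * d.P j := by
  rw [setc, add_mul]; omega

theorem mul_P_le {j v a : ℕ} (h : a ≤ d.x j v) : a * d.P j ≤ v := by
  have := decomp (d := d) (j := j) v
  have := Nat.mul_le_mul_right (d.P j) h
  omega

theorem setc_sub {j v a : ℕ} (h : a ≤ d.x j v) : d.setc j v (d.x j v - a) = v - a * d.P j := by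
  rw [setc, Nat.sub_mul]
  have := mul_P_le h
  have := Nat.mul_le_mul_right (d.P j) h
  omega

/-- Adjacency of vertex numbers. -/
def Adj (d : Dims) (u v : ℕ) : Prop :=
  ∃ j < d.k, (d.x j u + 1 = d.x j v ∨ d.x j v + 1 = d.x j u) ∧
    ∀ l < d.k, l ≠ j → d.x l u = d.x l v

theorem Adj.symm {u v : ℕ} (h : d.Adj u v) : d.Adj v u := by
  obtain ⟨j, hj, h1, h2⟩ := h
  exact ⟨j, hj, h1.symm, fun l hl hlj => (h2 l hl hlj).symm⟩

/-! Enumeration of the vertices along the lines in direction `j`. -/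

/-- The `u`-th vertex, if vertices are listed one line in direction `j` after the other. -/
def enum (d : Dims) (j u : ℕ) : ℕ :=
  u / d.m j / d.P j * (d.P j * d.m j) + u / d.m j % d.P j + u % d.m j * d.P j

theorem enum_eq (j u : ℕ) : d.enum j u =
    u / d.m j % d.P j + u % d.m j * d.P j + u / d.m j / d.P j * d.P (j + 1) := by
  rw [enum, P_succ]; ring

theorem enum_spec {j : ℕ} (hj : j < d.k) (u : ℕ) :
    d.enum j u % d.P j = u / d.m j % d.P j ∧ d.x j (d.enum j u) = u % d.m j ∧
      d.enum j u / d.P (j + 1) = u / d.m j / d.P j := by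
  rw [enum_eq]
  exact digits_of_form hj (Nat.mod_lt _ (P_pos hj.le)) (Nat.mod_lt _ (m_pos hj))

theorem x_enum {j : ℕ} (hj : j < d.k) (u : ℕ) : d.x j (d.enum j u) = u % d.m j :=
  (enum_spec hj u).2.1

theorem enum_lt {j u : ℕ} (hj : j < d.k) (hu : u < d.N) : d.enum j u < d.N := by
  obtain ⟨c, hc⟩ := P_dvd (d := d) (show j + 1 ≤ d.k from hj)
  have hP' := P_pos (d := d) hj
  have h1 : d.enum j u / d.P (j + 1) < c := by
    rw [(enum_spec hj u).2.2, Nat.div_div_eq_div_mul, mul_comm (d.m j), ← P_succ,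
      Nat.div_lt_iff_lt_mul hP', mul_comm, ← hc]; exact hu
  rw [Nat.div_lt_iff_lt_mul hP', mul_comm, ← hc] at h1
  exact h1

theorem enum_inj {j u v : ℕ} (hj : j < d.k) (h : d.enum j u = d.enum j v) : u = v := by
  obtain ⟨a1, a2, a3⟩ := enum_spec hj u
  obtain ⟨b1, b2, b3⟩ := enum_spec hj v
  rw [h] at a1 a2 a3
  have hq : u / d.m j = v / d.m j := by
    rw [← Nat.div_add_mod (u / d.m j) (d.P j), ← Nat.div_add_mod (v / d.m j) (d.P j)]
    rw [← a1, ← a3, ← b1, ← b3]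
  rw [← Nat.div_add_mod u (d.m j), ← Nat.div_add_mod v (d.m j), hq, ← a2, ← b2]

theorem x_enum_eq_of_div {j u v l : ℕ} (hj : j < d.k) (h : u / d.m j = v / d.m j) (hl : l ≠ j) :
    d.x l (d.enum j u) = d.x l (d.enum j v) := by
  obtain ⟨a1, a2, a3⟩ := enum_spec hj u
  obtain ⟨b1, b2, b3⟩ := enum_spec hj v
  rcases Nat.lt_or_gt_of_ne hl with hl | hl
  · exact x_eq_of_mod hl (by rw [a1, b1, h])
  · exact x_eq_of_div hl (by rw [a3, b3, h])

/-- The item on the line of `u` with the offset of `v` has all the coordinates of item `v`, so by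
injectivity of the enumeration it is `v`. -/
theorem div_eq_of_x_enum {j u v : ℕ} (hj : j < d.k) (hu : u < d.N) (hv : v < d.N)
    (h : ∀ l < d.k, l ≠ j → d.x l (d.enum j u) = d.x l (d.enum j v)) : u / d.m j = v / d.m j := by
  have hm := m_pos hj
  have hw : (u / d.m j * d.m j + v % d.m j) / d.m j = u / d.m j := by
    rw [mul_comm, Nat.mul_add_div hm, Nat.div_eq_of_lt (Nat.mod_lt _ hm), add_zero]
  have hx : d.x j (d.enum j (u / d.m j * d.m j + v % d.m j)) = v % d.m j := by
    rw [x_enum hj, mul_comm, Nat.mul_add_mod, Nat.mod_mod]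
  have hlt : d.enum j (u / d.m j * d.m j + v % d.m j) < d.N := by
    refine lt_N_of_div hj (enum_lt hj hu) ?_
    rw [(enum_spec hj _).2.2, (enum_spec hj _).2.2, hw]
  have := ext hlt (enum_lt hj hv) fun l hl => ?_
  · have := enum_inj hj this
    rw [← hw, this]
  · by_cases e : l = j
    · rw [e, hx, x_enum hj]
    · rw [x_enum_eq_of_div hj hw e, h l hl e]

end Dims

/-! ### Bijections of an initial segment -/

/-- `f` restricts to a bijection of the numbers below `N`. -/
def BijLt (N : ℕ) (f : ℕ → ℕ) : Prop :=
  (∀ v < N, f v < N) ∧ ∀ u < N, ∀ v < N, f u = f v → u = v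

namespace BijLt
variable {N : ℕ} {f g : ℕ → ℕ}

theorem surj (h : BijLt N f) {r : ℕ} (hr : r < N) : ∃ v < N, f v = r := by
  have := Finset.surj_on_of_inj_on_of_card_le (s := Finset.range N) (t := Finset.range N)
    (fun v _ => f v) (fun v hv => by simpa using h.1 v (by simpa using hv))
    (fun u v hu hv e => h.2 u (by simpa using hu) v (by simpa using hv) e) le_rfl r (by simpa using hr)
  obtain ⟨v, hv, e⟩ := this
  exact ⟨v, by simpa using hv, e.symm⟩

theorem comp (hf : BijLt N f) (hg : BijLt N g) : BijLt N (fun v => f (g v)) :=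
  ⟨fun v hv => hf.1 _ (hg.1 v hv), fun u hu v hv e =>
    hg.2 u hu v hv (hf.2 _ (hg.1 u hu) _ (hg.1 v hv) e)⟩

theorem congr (hf : BijLt N f) (h : ∀ v < N, g v = f v) : BijLt N g :=
  ⟨fun v hv => by rw [h v hv]; exact hf.1 v hv, fun u hu v hv e => by
    rw [h u hu, h v hv] at e; exact hf.2 u hu v hv e⟩

/-- Counting is invariant under a bijection. -/
theorem card_filter (hf : BijLt N f) (p : ℕ → Prop) [DecidablePred p] :
    ((Finset.range N).filter fun v => p (f v)).card = ((Finset.range N).filter p).card := by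
  refine Finset.card_bij (fun v _ => f v) (fun v hv => ?_) (fun u hu v hv e => ?_) fun r hr => ?_
  · simp only [Finset.mem_filter, Finset.mem_range] at hv ⊢
    exact ⟨hf.1 v hv.1, hv.2⟩
  · simp only [Finset.mem_filter, Finset.mem_range] at hu hv
    exact hf.2 u hu.1 v hv.1 e
  · simp only [Finset.mem_filter, Finset.mem_range] at hr
    obtain ⟨v, hv, e⟩ := hf.surj hr.1
    exact ⟨v, by simp [hv, e, hr.2], e⟩

end BijLt

theorem Dims.bijLt_enum {d : Dims} {j : ℕ} (hj : j < d.k) : BijLt d.N (d.enum j) :=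
  ⟨fun _ => enum_lt hj, fun _ _ _ _ => enum_inj hj⟩


/-! ### Odd-even transposition sort -/

namespace OddEven

/-- The pair `(y, y + 1)` is out of order and compared in round `t`. -/
def Sw (n t : ℕ) (a : ℕ → ℕ) (y : ℕ) : Prop := y % 2 = t % 2 ∧ y + 1 < n ∧ a (y + 1) < a y

instance (n t : ℕ) (a : ℕ → ℕ) (y : ℕ) : Decidable (Sw n t a y) := by unfold Sw; infer_instance

/-- One round. -/
def step (n t : ℕ) (a : ℕ → ℕ) (y : ℕ) : ℕ :=
  if Sw n t a y then a (y + 1) else if 1 ≤ y ∧ Sw n t a (y - 1) then a (y - 1) else a y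

/-- The number of entries `≥ c` among the first `q`. -/
abbrev ones (c : ℕ) (a : ℕ → ℕ) (q : ℕ) : ℕ := Nat.count (fun y => c ≤ a y) q

variable {n t c : ℕ} {a : ℕ → ℕ}

/-- A prefix count changes only if the end of the prefix separates an exchanged pair. Both cases are
needed together for the induction, and the first one is written additively to avoid truncated
subtraction. -/
theorem ones_step (q : ℕ) : (Sw n t a q → ones c (step n t a) (q + 1) + (if c ≤ a q then 1 else 0)
      = ones c a (q + 1) + if c ≤ a (q + 1) then 1 else 0) ∧
    (¬ Sw n t a q → ones c (step n t a) (q + 1) = ones c a (q + 1)) := by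
  induction q with
  | zero => constructor <;> intro h <;> simp [ones, Nat.count_succ, step, h]; omega
  | succ q ih =>
    simp only [ones] at ih ⊢
    rw [Nat.count_succ, Nat.count_succ _ (q + 1)]
    have e : step n t a (q + 1) = if Sw n t a (q + 1) then a (q + 1 + 1) else
      if Sw n t a q then a q else a (q + 1) := by simp [step]
    rw [e]
    constructor
    · intro h
      have hq : ¬ Sw n t a q := fun h' => by have := h.1; have := h'.1; omega
      have := ih.2 hq
      rw [this, if_pos h]; omega
    · intro h
      rw [if_neg h]
      by_cases hq : Sw n t a q
      · have := ih.1 hq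
        rw [if_pos hq]; omega
      · rw [ih.2 hq, if_neg hq]

/-- An exchange brings the smaller entry to the left, so a prefix can only lose large entries. -/
theorem ones_step_le (q : ℕ) : ones c (step n t a) q ≤ ones c a q := by
  cases q with
  | zero => simp [ones]
  | succ q =>
    by_cases h : Sw n t a q
    · have h1 := (ones_step (c := c) q).1 h
      have := h.2.2
      by_cases h3 : c ≤ a (q + 1)
      · rw [if_pos h3, if_pos (by omega)] at h1; omega
      · rw [if_neg h3] at h1; omega
    · exact ((ones_step q).2 h).le

theorem ones_step_n : ones c (step n t a) n = ones c a n := by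
  cases n with
  | zero => simp [ones]
  | succ n => exact (ones_step n).2 fun h => by have := h.2.1; omega

/-- After `t` rounds, the `i`-th large entry from the right is at `min (n - 1 - i) (t - 2 i)` or
further to the right. -/
theorem ones_bound {a : ℕ → ℕ → ℕ} {T : ℕ}
    (h : ∀ t < T, ∀ y < n, a (t + 1) y = step n t (a t) y) {t : ℕ} (hT : t ≤ T) :
    ones c (a t) n = ones c (a 0) n ∧ ∀ i q, i < ones c (a 0) n → q + i + 1 ≤ n → q + 2 * i ≤ t →
      ones c (a t) q + i + 1 ≤ ones c (a 0) n := by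
  induction t with
  | zero =>
    refine ⟨rfl, fun i q hi hq ht => ?_⟩
    have : q = 0 := by omega
    subst this
    simp only [ones, Nat.count_zero]; simp only [ones] at hi; omega
  | succ t ih =>
    obtain ⟨ih1, ih2⟩ := ih (by omega)
    have hcongr : ∀ q ≤ n, ones c (a (t + 1)) q = ones c (step n t (a t)) q := by
      intro q hq
      induction q with
      | zero => rfl
      | succ q ihq =>
        rw [ones, Nat.count_succ, ones, Nat.count_succ, h t hT q (by omega)]
        have := ihq (by omega)
        simp only [ones] at this
        rw [this]
    refine ⟨by rw [hcongr n le_rfl, ones_step_n, ih1], fun i q hi hq ht => ?_⟩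
    rw [hcongr q (by omega)]
    have hmono := ones_step_le (n := n) (t := t) (c := c) (a := a t) q
    by_cases h1 : q + 2 * i ≤ t
    · have := ih2 i q hi hq h1; omega
    cases q with
    | zero => simp only [ones, Nat.count_zero]; simp only [ones] at hi; omega
    | succ q =>
      -- The new case is `q + 1 + 2 i = t + 1`. If the bound fails at time `t`, the bounds for `(q,
      -- i)` and `(q + 2, i - 1)` (for `i = 0`, the total count) force a large entry at `q` and a
      -- small one at `q + 1`. Since `q` has the parity of `t`, this pair is exchanged in round `t`.
      -- The delay of two rounds per index is what keeps the parities aligned.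
      by_cases h2 : ones c (a t) (q + 1) + i + 1 ≤ ones c (a 0) n
      · omega
      have h3 := ih2 i q hi (by omega) (by omega)
      have hsucc : ones c (a t) (q + 1) = ones c (a t) q + if c ≤ a t q then 1 else 0 :=
        Nat.count_succ _ _
      have hsucc' : ones c (a t) (q + 1 + 1) =
        ones c (a t) (q + 1) + if c ≤ a t (q + 1) then 1 else 0 := Nat.count_succ _ _
      have h4 : ones c (a t) (q + 1 + 1) + i ≤ ones c (a 0) n := by
        cases i with
        | zero =>
          have : ones c (a t) (q + 1 + 1) ≤ ones c (a t) n := Nat.count_monotone _ (by omega)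
          omega
        | succ i => have := ih2 i (q + 1 + 1) (by omega) (by omega) (by omega); omega
      have h5 : c ≤ a t q := by
        by_contra h; rw [if_neg h] at hsucc; omega
      have h6 : ¬ c ≤ a t (q + 1) := by
        intro h; rw [if_pos h] at hsucc'; omega
      rw [if_pos h5] at hsucc
      rw [if_neg h6] at hsucc'
      by_cases hn : q + 1 < n
      · have hsw : Sw n t (a t) q := ⟨by omega, hn, by omega⟩
        have := (ones_step (c := c) q).1 hsw
        rw [if_pos h5, if_neg h6] at this
        omega
      · omega

/-- Odd-even transposition sorts `n` numbers in `2 n` rounds. -/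
theorem sorted {a : ℕ → ℕ → ℕ} {t : ℕ} (h : ∀ s < t, ∀ y < n, a (s + 1) y = step n s (a s) y)
    (h0 : BijLt n (a 0)) (ht : 2 * n ≤ t) {y : ℕ} (hy : y < n) : y ≤ a t y := by
  -- The zero-one principle: entries are only distinguished as below or not below the threshold `y`.
  have hK : ones y (a 0) n = n - y := by
    rw [ones, Nat.count_eq_card_filter_range, h0.card_filter (fun z => y ≤ z)]
    have : (Finset.range n).filter (fun z => y ≤ z) = Finset.Ico y n := by
      ext z; simp; omega
    rw [this, Nat.card_Ico]
  obtain ⟨h1, h2⟩ := ones_bound (c := y) h le_rfl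
  -- The leftmost of the `n - y` large entries has index `n - y - 1` from the right. It has reached
  -- position `y`, so the large entries occupy exactly the positions from `y` on.
  have h3 := h2 (n - y - 1) y (by omega) (by omega) (by omega)
  have h4 : ones y (a t) y = 0 := by omega
  have h5 : ones y (a t) n = n - y := by omega
  have h6 := Nat.count_add (fun z => y ≤ a t z) y (n - y)
  rw [show y + (n - y) = n by omega] at h6
  simp only [ones] at h4 h5
  rw [h4, h5, zero_add] at h6
  by_contra hlt
  have h7 : Nat.count (fun z => y ≤ a t (y + z)) (n - y) ≤ n - y - 1 := by
    rw [show n - y = (n - y - 1) + 1 by omega, Nat.count_succ']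
    simp only [add_zero, hlt, if_false]
    exact (Nat.count_le _).trans (by omega)
  omega

end OddEven

/-- A bijection of the numbers below `n` that decreases nowhere is the identity. -/
theorem BijLt.eq_of_le {n : ℕ} {a : ℕ → ℕ} (h : BijLt n a) (hle : ∀ y < n, y ≤ a y) :
    ∀ y < n, a y = y := by
  intro y hy
  induction hd : n - y using Nat.strong_induction_on generalizing y with
  | _ d ih =>
    by_contra hne
    have h1 := hle y hy
    have h2 := h.1 y hy
    have h3 := ih (n - a y) (by omega) (a y) h2 rfl
    exact hne (h.2 _ h2 _ hy h3)


/-! ### Spreading labels evenly -/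

/-- A list of `n` items is cut into consecutive lines; item `u` is at offset `y u` of its line,
which has length `len u`, and `S u` is the name of the slab of its line.  All lines of a slab have
the same length.  Some of the items are marked by `z`. -/
structure Lines (n : ℕ) (S y len : ℕ → ℕ) : Prop where
  y_lt : ∀ u < n, y u < len u
  len_eq : ∀ u < n, ∀ v < n, S u = S v → len u = len v
  zero : y 0 = 0
  next : ∀ u, u + 1 < n → y u + 1 < len u → S (u + 1) = S u ∧ y (u + 1) = y u + 1
  last : ∀ u, u + 1 < n → y u + 1 = len u → y (u + 1) = 0

namespace Lines
variable {n : ℕ} {S y len : ℕ → ℕ} {z : ℕ → Prop} [DecidablePred z]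

/-- The number of marked items of the slab `a` before item `u`. -/
abbrev cnt (S : ℕ → ℕ) (z : ℕ → Prop) [DecidablePred z] (a u : ℕ) : ℕ :=
  Nat.count (fun v => S v = a ∧ z v) u

/-- Marked items fill the offsets cyclically from the left, and unmarked items from the right. -/
def tgt (S len : ℕ → ℕ) (z : ℕ → Prop) [DecidablePred z] (u : ℕ) : ℕ :=
  if z u then cnt S z (S u) u % len u
  else len u - 1 - cnt S (fun v => ¬ z v) (S u) u % len u

theorem cnt_add (a u : ℕ) : cnt S z a u + cnt S (fun v => ¬ z v) a u =
    Nat.count (fun v => S v = a) u := by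
  induction u with
  | zero => simp [cnt]
  | succ u ih =>
    simp only [cnt] at ih ⊢
    rw [Nat.count_succ, Nat.count_succ, Nat.count_succ, ← ih]
    by_cases h1 : S u = a <;> by_cases h2 : z u <;> simp [h1, h2] <;> omega

/-- Lines before that of `u` are complete, and those of the slab all have length `l`; only the
current line can contribute a remainder. -/
theorem count_mod (h : Lines n S y len) {a l : ℕ} (ha : ∀ u < n, S u = a → len u = l) {u : ℕ}
    (hu : u < n) : Nat.count (fun v => S v = a) u % l = if S u = a then y u else 0 := by
  induction u with
  | zero => simp [h.zero]
  | succ u ih =>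
    have ih := ih (by omega)
    rw [Nat.count_succ, Nat.add_mod, ih]
    have hy := h.y_lt u (by omega)
    by_cases hl : y u + 1 < len u
    · obtain ⟨h1, h2⟩ := h.next u hu hl
      rw [h1, h2]
      by_cases hs : S u = a
      · have := ha u (by omega) hs
        simp only [hs, if_true]
        rw [Nat.add_mod_mod]; exact Nat.mod_eq_of_lt (by omega)
      · simp [hs]
    · rw [h.last u hu (by omega)]
      by_cases hs : S u = a
      · have := ha u (by omega) hs
        simp only [hs, if_true, Nat.add_mod_mod]
        rw [show y u + 1 = l by omega]; simp
      · simp [hs]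

theorem mod_ne_of_lt {a b l : ℕ} (h1 : a < b) (h2 : b < a + l) : a % l ≠ b % l := by
  intro h
  have hd := (Nat.modEq_iff_dvd' h1.le).1 h
  have := Nat.le_of_dvd (by omega) hd
  omega

/-- A collision means that the residues add up to `l - 1`, which would then be the residue of `a +
b`; but that residue is smaller. This separates the filling from the left from the filling from the
right. -/
theorem mod_add_mod_succ_ne {a b c l : ℕ} (hy : (a + b) % l = c) (hc : c + 1 < l) :
    a % l ≠ l - 1 - b % l := by
  intro h
  have hb := Nat.mod_lt b (show 0 < l by omega)
  have h1 : a % l + b % l = l - 1 := by omega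
  rw [Nat.add_mod, h1, Nat.mod_eq_of_lt (by omega)] at hy
  omega

/-- Different items of a line get different targets. -/
theorem tgt_ne (h : Lines n S y len) {u v : ℕ} (hv : v < n) (huv : u < v) (hS : S u = S v)
    (hy : y v = y u + (v - u)) : tgt S len z u ≠ tgt S len z v := by
  unfold tgt
  have hl := h.len_eq u (by omega) v hv hS
  rw [hS, hl]
  have hyv := h.y_lt v hv
  set l := len v with hl'
  have hmod := h.count_mod (a := S v) (l := l) (fun w hw e => h.len_eq w hw v hv e)
    (u := u) (by omega)
  rw [if_pos hS, ← cnt_add (z := z)] at hmod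
  have hA := cnt_add (S := S) (z := z) (S v) v
  have hA' := cnt_add (S := S) (z := z) (S v) u
  have hd : Nat.count (fun w => S w = S v) v ≤ Nat.count (fun w => S w = S v) u + (v - u) := by
    have h6 := Nat.count_add (fun w => S w = S v) u (v - u)
    rw [show u + (v - u) = v by omega] at h6
    rw [h6]
    exact Nat.add_le_add_left (Nat.count_le _) _
  have hz : cnt S z (S v) u ≤ cnt S z (S v) v := Nat.count_monotone _ huv.le
  have ho : cnt S (fun v => ¬ z v) (S v) u ≤ cnt S (fun v => ¬ z v) (S v) v :=
    Nat.count_monotone _ huv.le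
  have hz1 : z u → cnt S z (S v) u + 1 ≤ cnt S z (S v) v := fun hzu => by
    have h1 : cnt S z (S v) (u + 1) ≤ cnt S z (S v) v := Nat.count_monotone _ huv
    have h2 : cnt S z (S v) (u + 1) = cnt S z (S v) u + 1 := by
      rw [cnt, Nat.count_succ, if_pos ⟨hS, hzu⟩]
    omega
  have ho1 : ¬ z u → cnt S (fun v => ¬ z v) (S v) u + 1 ≤ cnt S (fun v => ¬ z v) (S v) v :=
    fun hzu => by
    have h1 : cnt S (fun v => ¬ z v) (S v) (u + 1) ≤ cnt S (fun v => ¬ z v) (S v) v :=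
      Nat.count_monotone _ huv
    have h2 : cnt S (fun v => ¬ z v) (S v) (u + 1) = cnt S (fun v => ¬ z v) (S v) u + 1 := by
      rw [cnt, Nat.count_succ, if_pos ⟨hS, hzu⟩]
    omega
  set z1 := cnt S z (S v) u
  set z2 := cnt S z (S v) v
  set o1 := cnt S (fun v => ¬ z v) (S v) u
  set o2 := cnt S (fun v => ¬ z v) (S v) v
  have hl0 : 0 < l := by omega
  by_cases h1 : z u <;> by_cases h2 : z v <;> simp only [h1, h2, if_true, if_false]
  · exact mod_ne_of_lt (by have := hz1 h1; omega) (by omega)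
  · have := hz1 h1
    -- Here `z1 + o1` has residue `y u`. As `u` itself is marked, at most `v - u - 1` unmarked items
    -- lie between, so `y u + (o2 - o1)` stays below `y v ≤ l - 1`.
    refine mod_add_mod_succ_ne (a := z1) (b := o2) (c := y u + (o2 - o1)) ?_ (by omega)
    rw [show z1 + o2 = (z1 + o1) + (o2 - o1) by omega, Nat.add_mod, hmod, Nat.add_mod_mod]
    exact Nat.mod_eq_of_lt (by omega)
  · have := ho1 h1
    refine (mod_add_mod_succ_ne (a := z2) (b := o1) (c := y u + (z2 - z1)) ?_ (by omega)).symm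
    rw [show z2 + o1 = (z1 + o1) + (z2 - z1) by omega, Nat.add_mod, hmod, Nat.add_mod_mod]
    exact Nat.mod_eq_of_lt (by omega)
  · have e1 := Nat.mod_lt o1 hl0
    have e2 := Nat.mod_lt o2 hl0
    have := mod_ne_of_lt (a := o1) (b := o2) (l := l) (by have := ho1 h1; omega) (by omega)
    omega

theorem tgt_lt (h : Lines n S y len) {u : ℕ} (hu : u < n) : tgt S len z u < len u := by
  have := h.y_lt u hu
  unfold tgt
  split_ifs
  · exact Nat.mod_lt _ (by omega)
  · omega

/-- The number of marked items of a slab with target `b`. -/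
theorem count_tgt {a l b : ℕ} (ha : ∀ u < n, S u = a → len u = l) :
    Nat.count (fun u => S u = a ∧ z u ∧ tgt S len z u = b) n =
      Nat.count (fun q => q % l = b) (cnt S z a n) := by
  -- The marked items of the slab get the targets `0, 1, 2, …` modulo `l` in the order of their
  -- occurrence.
  suffices ∀ u ≤ n, Nat.count (fun u => S u = a ∧ z u ∧ tgt S len z u = b) u =
      Nat.count (fun q => q % l = b) (cnt S z a u) from this n le_rfl
  intro u
  induction u with
  | zero => intro _; simp [cnt]
  | succ u ih =>
    intro hu
    rw [cnt, Nat.count_succ, Nat.count_succ, ih (by omega)]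
    by_cases h1 : S u = a
    · by_cases h2 : z u
      · have h3 := ha u (by omega) h1
        rw [if_pos (show S u = a ∧ z u from ⟨h1, h2⟩), Nat.count_succ]
        simp only [tgt, h1, h2, h3, if_true, true_and]
      · simp [h2]
    · simp [h1]

theorem count_mod_le {l b c : ℕ} (hc : c ≤ l) :
    Nat.count (fun q => q % l = b) c = if b < c then 1 else 0 := by
  induction c with
  | zero => simp
  | succ c ih =>
    rw [Nat.count_succ, ih (by omega), Nat.mod_eq_of_lt (by omega)]
    split_ifs <;> omega

theorem count_mod_mul {l b : ℕ} (hb : b < l) (r : ℕ) :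
    Nat.count (fun q => q % l = b) (l * r) = r := by
  induction r with
  | zero => simp
  | succ r ih =>
    rw [mul_add, mul_one, Nat.count_add, ih]
    simp only [Nat.mul_add_mod]
    rw [count_mod_le le_rfl, if_pos hb]

end Lines

/-! ### Routing along the lines of a box -/

/-- Exchange `v` and `v + A` whenever `F v`. -/
def swp (A : ℕ) (F : ℕ → Prop) [DecidablePred F] (v : ℕ) : ℕ :=
  if F v then v + A else if A ≤ v ∧ F (v - A) then v - A else v

namespace Dims
variable {d : Dims} {j g : ℕ}

/-- The length of the line of `v` in direction `j`, cut into pieces of length `g`. -/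
def len (d : Dims) (j g v : ℕ) : ℕ := min g (d.m j - (d.x j v - d.x j v % g))

/-- The vertex at offset `y` of the line of `v`. -/
def vtx (d : Dims) (j g v y : ℕ) : ℕ := d.setc j v (d.x j v - d.x j v % g + y)

/-- The vertices are on the same line in direction `j`, cut into pieces of length `g`. -/
def SameLine (d : Dims) (j g u v : ℕ) : Prop :=
  (∀ l < d.k, l ≠ j → d.x l u = d.x l v) ∧ d.x j u / g = d.x j v / g

theorem SameLine.refl (v : ℕ) : d.SameLine j g v v := ⟨fun _ _ _ => rfl, rfl⟩

theorem SameLine.symm {u v : ℕ} (h : d.SameLine j g u v) : d.SameLine j g v u :=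
  ⟨fun l hl hj => (h.1 l hl hj).symm, h.2.symm⟩

theorem SameLine.trans {u v w : ℕ} (h : d.SameLine j g u v) (h' : d.SameLine j g v w) :
    d.SameLine j g u w :=
  ⟨fun l hl hj => (h.1 l hl hj).trans (h'.1 l hl hj), h.2.trans h'.2⟩

theorem sub_mod_add_div {g a y : ℕ} (hy : y < g) : (a - a % g + y) / g = a / g := by
  have := Nat.div_add_mod a g
  rw [show a - a % g = g * (a / g) by omega, Nat.mul_add_div (by omega), Nat.div_eq_of_lt hy,
    add_zero]

theorem sub_mod_add_mod {g a y : ℕ} (hy : y < g) : (a - a % g + y) % g = y := by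
  have := Nat.div_add_mod a g
  rw [show a - a % g = g * (a / g) by omega, Nat.mul_add_mod, Nat.mod_eq_of_lt hy]

theorem sub_mod_eq_of_div_eq {g a b : ℕ} (h : a / g = b / g) : a - a % g = b - b % g := by
  have h1 := Nat.div_add_mod a g
  have h2 := Nat.div_add_mod b g
  rw [h] at h1; omega

theorem off_lt_len (hj : j < d.k) (hg : 0 < g) (v : ℕ) : d.x j v % g < d.len j g v := by
  have := Nat.mod_lt (d.x j v) hg
  have := x_lt hj v
  have := Nat.mod_le (d.x j v) g
  rw [len, lt_min_iff]; omega

theorem lt_of_lt_len {v y : ℕ} (hy : y < d.len j g v) :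
    y < g ∧ d.x j v - d.x j v % g + y < d.m j := by
  rw [len, lt_min_iff] at hy; omega

theorem SameLine.len_eq {u v : ℕ} (h : d.SameLine j g u v) : d.len j g u = d.len j g v := by
  rw [len, len, sub_mod_eq_of_div_eq h.2]

theorem vtx_lt {v y : ℕ} (hj : j < d.k) (hv : v < d.N) (hy : y < d.len j g v) :
    d.vtx j g v y < d.N := setc_lt hj hv (lt_of_lt_len hy).2

theorem sameLine_vtx {v y : ℕ} (hj : j < d.k) (hy : y < d.len j g v) :
    d.SameLine j g (d.vtx j g v y) v := by
  obtain ⟨h1, h2⟩ := lt_of_lt_len hy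
  refine ⟨fun l hl hlj => x_setc_ne hj h2 hlj, ?_⟩
  rw [vtx, x_setc_self hj h2, sub_mod_add_div h1]

theorem x_vtx {v y : ℕ} (hj : j < d.k) (hy : y < d.len j g v) :
    d.x j (d.vtx j g v y) = d.x j v - d.x j v % g + y := x_setc_self hj (lt_of_lt_len hy).2

theorem off_vtx {v y : ℕ} (hj : j < d.k) (hy : y < d.len j g v) :
    d.x j (d.vtx j g v y) % g = y := by
  rw [x_vtx hj hy, sub_mod_add_mod (lt_of_lt_len hy).1]

theorem eq_of_sameLine {u v : ℕ} (hu : u < d.N) (hv : v < d.N) (h : d.SameLine j g u v)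
    (ho : d.x j u % g = d.x j v % g) : u = v := by
  refine ext hu hv fun l hl => ?_
  by_cases e : l = j
  · subst e; rw [← Nat.div_add_mod (d.x l u) g, h.2, ho, Nat.div_add_mod]
  · exact h.1 l hl e

theorem SameLine.eq_vtx {u v : ℕ} (hj : j < d.k) (hg : 0 < g) (hu : u < d.N) (hv : v < d.N)
    (h : d.SameLine j g u v) : u = d.vtx j g v (d.x j u % g) := by
  have hl : d.x j u % g < d.len j g v := h.len_eq ▸ off_lt_len hj hg u
  exact eq_of_sameLine hu (vtx_lt hj hv hl) (h.trans (sameLine_vtx hj hl).symm) (off_vtx hj hl).symm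

theorem vtx_succ {v y : ℕ} : d.vtx j g v (y + 1) = d.vtx j g v y + d.P j := by
  have h := decomp (d := d) (j := j) v
  rw [vtx, vtx, setc_eq, setc_eq]; ring

/-- The pairs to be exchanged in round `t`: neighbours in a line with targets in the wrong order. -/
def Flag (d : Dims) (j g t : ℕ) (tgt O : ℕ → ℕ) (v : ℕ) : Prop :=
  d.x j v % g % 2 = t % 2 ∧ d.x j v % g + 1 < g ∧ d.x j v + 1 < d.m j ∧
    tgt (O (v + d.P j)) < tgt (O v)

instance (t : ℕ) (tgt O : ℕ → ℕ) : DecidablePred (d.Flag j g t tgt O) := fun v => by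
  unfold Flag; infer_instance

theorem add_P_of_flag {v : ℕ} (hj : j < d.k) (hv : v < d.N) (h1 : d.x j v % g + 1 < g)
    (h2 : d.x j v + 1 < d.m j) :
    v + d.P j < d.N ∧ d.SameLine j g (v + d.P j) v ∧ d.x j (v + d.P j) % g = d.x j v % g + 1 ∧
      d.x j (v + d.P j) = d.x j v + 1 := by
  have hg : 0 < g := by omega
  have e : v = d.vtx j g v (d.x j v % g) := (SameLine.refl v).eq_vtx hj hg hv hv
  have hl : d.x j v % g + 1 < d.len j g v := by
    have := Nat.mod_le (d.x j v) g
    rw [len, lt_min_iff]; omega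
  have e' : v + d.P j = d.vtx j g v (d.x j v % g + 1) := by rw [vtx_succ, ← e]
  rw [e']
  refine ⟨vtx_lt hj hv hl, sameLine_vtx hj hl, off_vtx hj hl, ?_⟩
  rw [x_vtx hj hl]; have := Nat.mod_le (d.x j v) g; omega

theorem vtx_off {v : ℕ} (hj : j < d.k) (hg : 0 < g) (hv : v < d.N) :
    d.vtx j g v (d.x j v % g) = v := ((SameLine.refl v).eq_vtx hj hg hv hv).symm

section round
variable {t : ℕ} {tgt O : ℕ → ℕ}

theorem flag_vtx (hj : j < d.k) {v y : ℕ} (hy : y < d.len j g v) :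
    d.Flag j g t tgt O (d.vtx j g v y) ↔
      OddEven.Sw (d.len j g v) t (fun y => tgt (O (d.vtx j g v y))) y := by
  rw [Flag, OddEven.Sw, off_vtx hj hy, x_vtx hj hy, ← vtx_succ]
  have : y + 1 < d.len j g v ↔ y + 1 < g ∧ d.x j v - d.x j v % g + y + 1 < d.m j := by
    rw [len, lt_min_iff]; omega
  rw [this]; tauto

/-- Exchanging the flagged pairs is a round of odd-even transposition on each line. -/
theorem swp_vtx (hj : j < d.k) {v y : ℕ} (hv : v < d.N) (hy : y < d.len j g v) :
    ∃ y' < d.len j g v, swp (d.P j) (d.Flag j g t tgt O) (d.vtx j g v y) = d.vtx j g v y' ∧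
    tgt (O (d.vtx j g v y')) =
      OddEven.step (d.len j g v) t (fun y => tgt (O (d.vtx j g v y))) y := by
  unfold swp OddEven.step
  simp only [flag_vtx hj hy]
  by_cases h1 : OddEven.Sw (d.len j g v) t (fun y => tgt (O (d.vtx j g v y))) y
  · rw [if_pos h1, if_pos h1]
    exact ⟨y + 1, h1.2.1, vtx_succ.symm, rfl⟩
  · rw [if_neg h1, if_neg h1]
    by_cases h2 : 1 ≤ y ∧ OddEven.Sw (d.len j g v) t (fun y => tgt (O (d.vtx j g v y))) (y - 1)
    · rw [if_pos h2]
      obtain ⟨y, rfl⟩ : ∃ z, y = z + 1 := ⟨y - 1, by omega⟩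
      simp only [Nat.add_sub_cancel] at h2
      have := (flag_vtx (tgt := tgt) (O := O) (t := t) hj (show y < d.len j g v by omega)).2 h2.2
      rw [vtx_succ, Nat.add_sub_cancel, if_pos ⟨by omega, this⟩]
      exact ⟨y, by omega, rfl, rfl⟩
    · rw [if_neg h2]
      refine ⟨y, hy, ?_, rfl⟩
      rw [if_neg]
      rintro ⟨h3, h4⟩
      apply h2
      -- A flagged pair never straddles two lines, so the flagged vertex one stride below is at
      -- offset `y - 1` of the same line.
      set u := d.vtx j g v y - d.P j with hu
      have hlt := vtx_lt hj hv hy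
      obtain ⟨h5, h6, h7, -⟩ := add_P_of_flag (v := u) hj (by omega) h4.2.1 h4.2.2.1
      rw [hu, Nat.sub_add_cancel h3, ← hu] at h6 h7
      rw [off_vtx hj hy] at h7
      have h8 : d.SameLine j g u v := h6.symm.trans (sameLine_vtx hj hy)
      have h9 := h8.eq_vtx hj (by have := h4.2.1; omega) (by omega) hv
      rw [show d.x j u % g = y - 1 by omega] at h9
      rw [h9, flag_vtx hj (show y - 1 < d.len j g v by omega)] at h4
      exact ⟨by omega, h4⟩

/-- The lower end of a flagged pair has an offset of the parity of `t` and the upper end does not,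
so the pairs are disjoint. -/
theorem swp_swp (hj : j < d.k) {v : ℕ} (hv : v < d.N) :
    swp (d.P j) (d.Flag j g t tgt O) (swp (d.P j) (d.Flag j g t tgt O) v) = v := by
  have hup : ∀ v < d.N, d.Flag j g t tgt O v → ¬ d.Flag j g t tgt O (v + d.P j) ∧
      swp (d.P j) (d.Flag j g t tgt O) (v + d.P j) = v := by
    intro v hv h
    obtain ⟨h5, h6, h7, -⟩ := add_P_of_flag hj hv h.2.1 h.2.2.1
    have h8 : ¬ d.Flag j g t tgt O (v + d.P j) := by
      intro h'; have := h'.1; have := h.1; omega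
    refine ⟨h8, ?_⟩
    rw [swp, if_neg h8, if_pos ⟨by omega, by rwa [Nat.add_sub_cancel]⟩, Nat.add_sub_cancel]
  by_cases h1 : d.Flag j g t tgt O v
  · rw [show swp (d.P j) (d.Flag j g t tgt O) v = v + d.P j from if_pos h1, (hup v hv h1).2]
  · by_cases h2 : d.P j ≤ v ∧ d.Flag j g t tgt O (v - d.P j)
    · have h3 : swp (d.P j) (d.Flag j g t tgt O) v = v - d.P j := by
        rw [swp, if_neg h1, if_pos h2]
      rw [h3, swp, if_pos h2.2, Nat.sub_add_cancel h2.1]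
    · have h3 : swp (d.P j) (d.Flag j g t tgt O) v = v := by
        rw [swp, if_neg h1, if_neg h2]
      rw [h3, h3]

theorem sameLine_swp (hj : j < d.k) (hg : 0 < g) {v : ℕ} (hv : v < d.N) :
    swp (d.P j) (d.Flag j g t tgt O) v < d.N ∧
      d.SameLine j g (swp (d.P j) (d.Flag j g t tgt O) v) v := by
  obtain ⟨y, hy, h, -⟩ := swp_vtx (t := t) (tgt := tgt) (O := O) hj hv (off_lt_len hj hg v)
  rw [vtx_off hj hg hv] at h
  rw [h]
  exact ⟨vtx_lt hj hv hy, sameLine_vtx hj hy⟩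

theorem bijLt_swp (hj : j < d.k) (hg : 0 < g) :
    BijLt d.N (swp (d.P j) (d.Flag j g t tgt O)) :=
  ⟨fun _ hv => (sameLine_swp hj hg hv).1, fun u hu v hv e => by
    rw [← swp_swp (g := g) (t := t) (tgt := tgt) (O := O) hj hu, e, swp_swp hj hv]⟩

end round

/-- After enough rounds, every robot is at its target offset in its line. -/
theorem routed (hj : j < d.k) (hg : 0 < g) {tgt : ℕ → ℕ} {O : ℕ → ℕ → ℕ} {n : ℕ} (hO : BijLt d.N (O 0))
    (hstep : ∀ t < n, ∀ v < d.N, O (t + 1) v = O t (swp (d.P j) (d.Flag j g t tgt (O t)) v))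
    (hlt : ∀ v < d.N, tgt (O 0 v) < d.len j g v)
    (hinj : ∀ u < d.N, ∀ v < d.N, d.SameLine j g u v → tgt (O 0 u) = tgt (O 0 v) → u = v)
    (hn : 2 * g ≤ n) :
    BijLt d.N (O n) ∧ ∀ v < d.N, tgt (O n v) = d.x j v % g ∧
      ∃ u < d.N, O n v = O 0 u ∧ d.SameLine j g u v := by
  have main : ∀ t ≤ n, BijLt d.N (O t) ∧ ∀ v < d.N, ∃ u < d.N, O t v = O 0 u ∧ d.SameLine j g u v := by
    intro t
    induction t with
    | zero => exact fun _ => ⟨hO, fun v hv => ⟨v, hv, rfl, SameLine.refl v⟩⟩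
    | succ t ih =>
      intro ht
      obtain ⟨h1, h2⟩ := ih (by omega)
      refine ⟨(h1.comp (bijLt_swp hj hg)).congr (hstep t (by omega)), fun v hv => ?_⟩
      obtain ⟨h3, h4⟩ := sameLine_swp (t := t) (tgt := tgt) (O := O t) hj hg hv
      obtain ⟨u, hu, h5, h6⟩ := h2 _ h3
      exact ⟨u, hu, by rw [hstep t (by omega) v hv, h5], h6.trans h4⟩
  refine ⟨(main n le_rfl).1, fun v hv => ⟨?_, (main n le_rfl).2 v hv⟩⟩
  set l := d.len j g v with hl
  let a : ℕ → ℕ → ℕ := fun t y => tgt (O t (d.vtx j g v y))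
  have hrec : ∀ t < n, ∀ y < l, a (t + 1) y = OddEven.step l t (a t) y := by
    intro t ht y hy
    obtain ⟨y', hy', h1, h2⟩ := swp_vtx (t := t) (tgt := tgt) (O := O t) hj hv hy
    simp only [a]
    rw [hstep t ht _ (vtx_lt hj hv hy), h1, h2]
  -- Robots never leave their line, so the targets found on it remain a permutation of its offsets;
  -- once sorted, this permutation is the identity.
  have hbij : ∀ t ≤ n, BijLt l (a t) := by
    intro t ht
    have key : ∀ y < l, ∃ u < d.N, O t (d.vtx j g v y) = O 0 u ∧ d.SameLine j g u v := by
      intro y hy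
      obtain ⟨u, hu, h1, h2⟩ := (main t ht).2 _ (vtx_lt hj hv hy)
      exact ⟨u, hu, h1, h2.trans (sameLine_vtx hj hy)⟩
    constructor
    · intro y hy
      obtain ⟨u, hu, h1, h2⟩ := key y hy
      simp only [a, h1]
      rw [hl, ← h2.len_eq]; exact hlt u hu
    · intro y hy z hz e
      obtain ⟨u, hu, h1, h2⟩ := key y hy
      obtain ⟨u', hu', h1', h2'⟩ := key z hz
      simp only [a, h1, h1'] at e
      have := hinj u hu u' hu' (h2.trans h2'.symm) e
      rw [this, ← h1'] at h1
      have h3 := (main t ht).1.2 _ (vtx_lt hj hv hy) _ (vtx_lt hj hv hz) h1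
      rw [← off_vtx hj hy, h3, off_vtx hj hz]
  have hll : 2 * l ≤ n := by
    have : l ≤ g := min_le_left _ _
    omega
  have hs := (hbij n le_rfl).eq_of_le (fun y hy => OddEven.sorted hrec (hbij 0 (by omega)) hll hy)
    (d.x j v % g) (off_lt_len hj hg v)
  simpa only [a, vtx_off hj hg hv] using hs

end Dims
namespace Dims
variable {d : Dims} {j i h : ℕ} {g : ℕ → ℕ} {J : Finset ℕ} {R R' : ℕ → ℕ}

/-! ### Balancing labels, one direction after the other -/

/-- `R v` is the corner of the slab of `v`: coordinates in `J` are kept, and the other ones are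
replaced by the smallest coordinate in the box of `v`. -/
def RepOK (d : Dims) (g : ℕ → ℕ) (J : Finset ℕ) (R : ℕ → ℕ) : Prop :=
  ∀ v < d.N, R v < d.N ∧
    ∀ l < d.k, d.x l (R v) = if l ∈ J then d.x l v else d.x l v - d.x l v % g l

/-- `R` only serves to name slabs, and this is the equivalence relation it encodes: `x - x % g` and
the quotient `x / g` determine each other. -/
theorem RepOK.eq_iff (hg : ∀ l < d.k, 0 < g l) (hR : d.RepOK g J R) {u v : ℕ} (hu : u < d.N)
    (hv : v < d.N) : R u = R v ↔
      ∀ l < d.k, (l ∈ J → d.x l u = d.x l v) ∧ d.x l u / g l = d.x l v / g l := by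
  constructor
  · intro h l hl
    have h1 := (hR u hu).2 l hl
    have h2 := (hR v hv).2 l hl
    rw [h, h2] at h1
    by_cases hJ : l ∈ J
    · rw [if_pos hJ, if_pos hJ] at h1
      exact ⟨fun _ => h1.symm, by rw [h1]⟩
    · rw [if_neg hJ, if_neg hJ] at h1
      refine ⟨fun h => absurd h hJ, ?_⟩
      have h3 := Nat.div_add_mod (d.x l u) (g l)
      have h4 := Nat.div_add_mod (d.x l v) (g l)
      exact Nat.eq_of_mul_eq_mul_left (hg l hl) (by omega)
  · intro h
    refine ext (hR u hu).1 (hR v hv).1 fun l hl => ?_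
    rw [(hR u hu).2 l hl, (hR v hv).2 l hl]
    split_ifs with hJ
    · exact (h l hl).1 hJ
    · exact sub_mod_eq_of_div_eq (h l hl).2

theorem RepOK.insert_eq_iff (hg : ∀ l < d.k, 0 < g l) (hR : d.RepOK g J R)
    (hR' : d.RepOK g (insert j J) R') (hj : j < d.k) {u v : ℕ} (hu : u < d.N)
    (hv : v < d.N) : R' u = R' v ↔ R u = R v ∧ d.x j u % g j = d.x j v % g j := by
  rw [hR'.eq_iff hg hu hv, hR.eq_iff hg hu hv]
  constructor
  · intro h
    refine ⟨fun l hl => ⟨fun hJ => (h l hl).1 (by simp [hJ]), (h l hl).2⟩, ?_⟩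
    rw [(h j hj).1 (by simp)]
  · rintro ⟨h1, h2⟩ l hl
    refine ⟨fun hJ => ?_, (h1 l hl).2⟩
    rcases Finset.mem_insert.1 hJ with e | e
    · subst e
      rw [← Nat.div_add_mod (d.x l u) (g l), (h1 l hl).2, h2, Nat.div_add_mod]
    · exact (h1 l hl).1 e

theorem RepOK.eq_of_sameLine (hg : ∀ l < d.k, 0 < g l) (hR : d.RepOK g J R) (hJ : j ∉ J)
    {u v : ℕ} (hu : u < d.N) (hv : v < d.N) (h : d.SameLine j (g j) u v) : R u = R v := by
  rw [hR.eq_iff hg hu hv]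
  intro l hl
  by_cases e : l = j
  · subst e; exact ⟨fun h => absurd h hJ, h.2⟩
  · rw [h.1 l hl e]; simp

theorem RepOK.len_eq (hg : ∀ l < d.k, 0 < g l) (hR : d.RepOK g J R) (hj : j < d.k) {u v : ℕ}
    (hu : u < d.N) (hv : v < d.N) (h : R u = R v) : d.len j (g j) u = d.len j (g j) v := by
  have := ((hR.eq_iff hg hu hv).1 h j hj).2
  rw [len, len, sub_mod_eq_of_div_eq this]

/-- The enumeration by lines. -/
theorem RepOK.lines (hg : ∀ l < d.k, 0 < g l) (hR : d.RepOK g J R) (hj : j < d.k) (hJ : j ∉ J) :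
    Lines d.N (fun u => R (d.enum j u)) (fun u => d.x j (d.enum j u) % g j)
      (fun u => d.len j (g j) (d.enum j u)) where
  y_lt u _ := off_lt_len hj (hg j hj) _
  len_eq u hu v hv h := hR.len_eq hg hj (enum_lt hj hu) (enum_lt hj hv) h
  zero := by simp [x_enum hj]
  next u hu h := by
    have hm := m_pos hj
    have hx := x_enum hj u
    obtain ⟨h1, h2⟩ := lt_of_lt_len h
    rw [hx] at h1 h2
    have h3 := Nat.mod_le (u % d.m j) (g j)
    have h4 : u % d.m j + 1 < d.m j := by omega
    have h5 : (u + 1) % d.m j = u % d.m j + 1 := by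
      rw [Nat.add_mod, Nat.mod_eq_of_lt (show 1 < d.m j by omega), Nat.mod_eq_of_lt h4]
    have h6 : (u + 1) / d.m j = u / d.m j := by
      have e1 := Nat.div_add_mod (u + 1) (d.m j)
      have e2 := Nat.div_add_mod u (d.m j)
      exact Nat.eq_of_mul_eq_mul_left hm (by omega)
    have h7 : (u % d.m j + 1) % g j = u % d.m j % g j + 1 := by
      rw [Nat.add_mod, Nat.mod_eq_of_lt (show 1 < g j by omega), Nat.mod_eq_of_lt h1]
    have h8 : (u % d.m j + 1) / g j = u % d.m j / g j := by
      have e1 := Nat.div_add_mod (u % d.m j + 1) (g j)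
      have e2 := Nat.div_add_mod (u % d.m j) (g j)
      exact Nat.eq_of_mul_eq_mul_left (hg j hj) (by omega)
    constructor
    · refine hR.eq_of_sameLine hg hJ (enum_lt hj hu) (enum_lt hj (by omega)) ⟨?_, ?_⟩
      · exact fun l _ hlj => x_enum_eq_of_div hj h6 hlj
      · rw [x_enum hj, x_enum hj, h5, h8]
    · simp only [x_enum hj]; rw [h5, h7]
  last u hu h := by
    have hm := m_pos hj
    have h3 := Nat.mod_le (u % d.m j) (g j)
    have hlt := Nat.mod_lt u hm
    simp only [len, x_enum hj] at h ⊢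
    by_cases h4 : u % d.m j + 1 < d.m j
    · have h5 : (u + 1) % d.m j = u % d.m j + 1 := by
        rw [Nat.add_mod, Nat.mod_eq_of_lt (show 1 < d.m j by omega), Nat.mod_eq_of_lt h4]
      have h6 : u % d.m j % g j + 1 = g j := by
        rcases min_choice (g j) (d.m j - (u % d.m j - u % d.m j % g j)) with e | e <;>
          rw [e] at h <;> omega
      rw [h5, ← Nat.div_add_mod (u % d.m j) (g j), add_assoc, h6]
      simp
    · have h5 : (u + 1) % d.m j = 0 := by
        have := Nat.div_add_mod u (d.m j)
        rw [show u + 1 = d.m j * (u / d.m j + 1) by rw [mul_add]; omega, Nat.mul_mod_right]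
      rw [h5, Nat.zero_mod]

/-- In every slab, as many items are marked as there are vertices in the left halves of the boxes
of width `2 h` in direction `i`. -/
def Balanced (d : Dims) (h i : ℕ) (R : ℕ → ℕ) (z : ℕ → Prop) [DecidablePred z] : Prop :=
  ∀ a, ((Finset.range d.N).filter fun v => R v = a ∧ z v).card =
    ((Finset.range d.N).filter fun v => R v = a ∧ d.x i v / h % 2 = 0).card

section stage
variable {O O' tgt : ℕ → ℕ} {z : ℕ → Prop} [DecidablePred z]

/-- Transfers `Lines.tgt_lt` and `Lines.tgt_ne` from the enumeration to vertices, in the form that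
`routed` needs. Within a line, indices in the enumeration differ by as much as offsets do. -/
theorem tgt_spec (hg : ∀ l < d.k, 0 < g l) (hR : d.RepOK g J R) (hj : j < d.k) (hJ : j ∉ J)
    (ht : ∀ u < d.N, tgt (O (d.enum j u)) = Lines.tgt (fun u => R (d.enum j u))
      (fun u => d.len j (g j) (d.enum j u)) (fun u => z (O (d.enum j u))) u) :
    (∀ v < d.N, tgt (O v) < d.len j (g j) v) ∧
    ∀ u < d.N, ∀ v < d.N, d.SameLine j (g j) u v → tgt (O u) = tgt (O v) → u = v := by
  have hL := hR.lines hg hj hJ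
  constructor
  · intro v hv
    obtain ⟨u, hu, rfl⟩ := (bijLt_enum hj).surj hv
    rw [ht u hu]
    exact hL.tgt_lt hu
  · have key : ∀ u < d.N, ∀ v < d.N, u < v → d.SameLine j (g j) (d.enum j u) (d.enum j v) →
        tgt (O (d.enum j u)) ≠ tgt (O (d.enum j v)) := by
      intro u hu v hv huv hs
      rw [ht u hu, ht v hv]
      refine hL.tgt_ne hv huv (hR.eq_of_sameLine hg hJ (enum_lt hj hu) (enum_lt hj hv) hs) ?_
      have h1 := div_eq_of_x_enum hj hu hv hs.1
      have h2 := hs.2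
      simp only [x_enum hj] at h2 ⊢
      have e1 := Nat.div_add_mod u (d.m j)
      have e2 := Nat.div_add_mod v (d.m j)
      have e3 := Nat.div_add_mod (u % d.m j) (g j)
      have e4 := Nat.div_add_mod (v % d.m j) (g j)
      rw [h1] at e1; rw [h2] at e3
      omega
    intro u hu v hv hs e
    obtain ⟨u, hu', rfl⟩ := (bijLt_enum hj).surj hu
    obtain ⟨v, hv', rfl⟩ := (bijLt_enum hj).surj hv
    rcases lt_trichotomy u v with h | h | h
    · exact absurd e (key u hu' v hv' h hs)
    · rw [h]
    · exact absurd e.symm (key v hv' u hu' h hs.symm)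

/-- The vertices of a slab in the left halves, counted by offset. -/
theorem card_left (hg : ∀ l < d.k, 0 < g l) (hR : d.RepOK g J R) (hj : j < d.k) (hJ : j ∉ J)
    (hi : i < d.k) (hgi : g i = 2 * h) (hlast : j = i → ∀ l < d.k, l ≠ i → l ∈ J)
    {v : ℕ} (hv : v < d.N) :
    Nat.count (fun q => q % d.len j (g j) v = d.x j v % g j)
      ((Finset.range d.N).filter fun u => R u = R v ∧ d.x i u / h % 2 = 0).card =
    ((Finset.range d.N).filter fun u => (R u = R v ∧ d.x j u % g j = d.x j v % g j) ∧
      d.x i u / h % 2 = 0).card := by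
  set L := d.len j (g j) v with hL
  have hgj := hg j hj
  have hoff : d.x j v % g j < L := off_lt_len hj hgj v
  let f : ℕ → ℕ := fun y => ((Finset.range d.N).filter fun u =>
    (R u = R v ∧ d.x j u % g j = y) ∧ d.x i u / h % 2 = 0).card
  have hsum : ((Finset.range d.N).filter fun u => R u = R v ∧ d.x i u / h % 2 = 0).card =
      ∑ y ∈ Finset.range L, f y := by
    rw [Finset.card_eq_sum_card_fiberwise (f := fun u => d.x j u % g j) (t := Finset.range L)]
    · refine Finset.sum_congr rfl fun y _ => ?_
      rw [Finset.filter_filter]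
      congr 1
      ext u; simp; tauto
    · intro u hu
      simp only [Finset.coe_filter, Finset.mem_range, Set.mem_ofPred_eq] at hu
      simp only [Finset.coe_range, Set.mem_Iio]
      rw [hL, ← hR.len_eq hg hj hu.1 hv hu.2.1]
      exact off_lt_len hj hgj u
  rw [hsum]
  change _ = f (d.x j v % g j)
  by_cases hji : j = i
  · subst hji
    -- The last stage: all other coordinates are fixed, so the slab is one line, whose left vertices
    -- are those with offset below `h`. There are `min h L ≤ L` of them, and the cyclic filling does
    -- not wrap around. The minimum accounts for boxes truncated by the border of the grid.
    have hf : ∀ y < L, f y = if y < h then 1 else 0 := by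
      intro y hy
      have hh : 0 < h := by omega
      have hz : ∀ a : ℕ, a / h % 2 = 0 ↔ a % (2 * h) < h := by
        intro a
        rw [mul_comm, Nat.mod_mul]
        have := Nat.mod_lt a hh
        rcases Nat.mod_two_eq_zero_or_one (a / h) with e | e <;> simp [e] <;> omega
      have hset : ((Finset.range d.N).filter fun u =>
          (R u = R v ∧ d.x j u % g j = y) ∧ d.x j u / h % 2 = 0) =
          if y < h then {d.vtx j (g j) v y} else ∅ := by
        ext u
        simp only [Finset.mem_filter, Finset.mem_range]
        split_ifs with hyh
        · rw [Finset.mem_singleton]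
          constructor
          · rintro ⟨hu, ⟨h1, h2⟩, -⟩
            have h3 := (hR.eq_iff hg hu hv).1 h1
            have h4 : d.SameLine j (g j) u v :=
              ⟨fun l hl hlj => (h3 l hl).1 (hlast rfl l hl hlj), (h3 j hj).2⟩
            rw [← h2]; exact h4.eq_vtx hj hgj hu hv
          · rintro rfl
            have h5 := vtx_lt hj hv hy
            refine ⟨h5, ⟨hR.eq_of_sameLine hg hJ h5 hv (sameLine_vtx hj hy), off_vtx hj hy⟩, ?_⟩
            rw [hz, ← hgi, off_vtx hj hy]; exact hyh
        · simp only [Finset.notMem_empty, iff_false]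
          rintro ⟨-, ⟨-, h2⟩, h3⟩
          rw [hz, ← hgi, h2] at h3
          exact hyh h3
      simp only [f, hset]
      split_ifs <;> simp
    rw [Finset.sum_congr rfl fun y hy => hf y (Finset.mem_range.1 hy), hf _ hoff]
    rw [Finset.sum_ite, Finset.sum_const_zero, add_zero, Finset.sum_const, smul_eq_mul, mul_one]
    have : ((Finset.range L).filter fun y => y < h) = Finset.range (min h L) := by
      ext y; simp; omega
    rw [this, Finset.card_range, Lines.count_mod_le (min_le_right _ _)]
    simp [hoff]
  · have hf : ∀ y < L, f y = f (d.x j v % g j) := by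
      -- Moving along `j` preserves coordinate `i` and the slab, so all offsets carry equally many
      -- left vertices, and their total is a multiple of `L`.
      have hle : ∀ y < L, ∀ y' < L, f y ≤ f y' := by
        intro y hy y' hy'
        refine Finset.card_le_card_of_injOn (fun u => d.vtx j (g j) u y') ?_ ?_
        · intro u hu
          simp only [Finset.coe_filter, Finset.mem_range, Set.mem_ofPred_eq] at hu ⊢
          obtain ⟨hu, ⟨h1, h2⟩, h3⟩ := hu
          have hlen := hR.len_eq hg hj hu hv h1
          have h4 : y' < d.len j (g j) u := by rw [hlen]; exact hy'
          have h5 := vtx_lt hj hu h4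
          refine ⟨h5, ⟨(hR.eq_of_sameLine hg hJ h5 hu (sameLine_vtx hj h4)).trans h1,
            off_vtx hj h4⟩, ?_⟩
          rw [(sameLine_vtx hj h4).1 i hi (Ne.symm hji)]; exact h3
        · intro u hu u' hu' e
          simp only [Finset.coe_filter, Finset.mem_range, Set.mem_ofPred_eq] at hu hu' e
          have h4 : y' < d.len j (g j) u := by rw [hR.len_eq hg hj hu.1 hv hu.2.1.1]; exact hy'
          have h4' : y' < d.len j (g j) u' := by
            rw [hR.len_eq hg hj hu'.1 hv hu'.2.1.1]; exact hy'
          have h5 := (sameLine_vtx hj h4).symm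
          rw [e] at h5
          exact eq_of_sameLine hu.1 hu'.1 (h5.trans (sameLine_vtx hj h4'))
            (hu.2.1.2.trans hu'.2.1.2.symm)
      exact fun y hy => le_antisymm (hle y hy _ hoff) (hle _ hoff y hy)
    rw [Finset.sum_congr rfl fun y hy => hf y (Finset.mem_range.1 hy), Finset.sum_const,
      Finset.card_range, smul_eq_mul, Lines.count_mod_mul hoff]

/-- A robot at offset `b` of a slab after the stage came along its line from the same old slab and
had target `b`, and conversely. So the marked robots of a new slab are those of the old slab with a
given target. `Lines.count_tgt` expresses their number through the old marked count, and `card_left`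
does the same for the left vertices. -/
theorem balanced_stage (hg : ∀ l < d.k, 0 < g l) (hR : d.RepOK g J R)
    (hR' : d.RepOK g (insert j J) R') (hj : j < d.k) (hJ : j ∉ J)
    (hi : i < d.k) (hgi : g i = 2 * h) (hlast : j = i → ∀ l < d.k, l ≠ i → l ∈ J)
    (ht : ∀ u < d.N, tgt (O (d.enum j u)) = Lines.tgt (fun u => R (d.enum j u))
      (fun u => d.len j (g j) (d.enum j u)) (fun u => z (O (d.enum j u))) u)
    (hO : BijLt d.N O) (hO' : BijLt d.N O')
    (hr : ∀ v < d.N, tgt (O' v) = d.x j v % g j ∧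
      ∃ u < d.N, O' v = O u ∧ d.SameLine j (g j) u v)
    (hb : d.Balanced h i R fun v => z (O v)) : d.Balanced h i R' fun v => z (O' v) := by
  intro a
  by_cases ha : ∃ v < d.N, R' v = a
  swap
  · rw [Finset.filter_false_of_mem, Finset.filter_false_of_mem]
    · exact fun v hv h => ha ⟨v, Finset.mem_range.1 hv, h.1⟩
    · exact fun v hv h => ha ⟨v, Finset.mem_range.1 hv, h.1⟩
  obtain ⟨v, hv, rfl⟩ := ha
  have hiff : ∀ u < d.N, R' u = R' v ↔ R u = R v ∧ d.x j u % g j = d.x j v % g j :=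
    fun u hu => hR.insert_eq_iff hg hR' hj hu hv
  have e1 : ((Finset.range d.N).filter fun u => R' u = R' v ∧ d.x i u / h % 2 = 0) =
      (Finset.range d.N).filter fun u => (R u = R v ∧ d.x j u % g j = d.x j v % g j) ∧
      d.x i u / h % 2 = 0 :=
    Finset.filter_congr fun u hu => by rw [hiff u (Finset.mem_range.1 hu)]
  rw [e1, ← card_left hg hR hj hJ hi hgi hlast hv, ← hb (R v)]
  have e2 : ((Finset.range d.N).filter fun u => R' u = R' v ∧ z (O' u)).card =
      ((Finset.range d.N).filter fun u => R u = R v ∧ z (O u) ∧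
        tgt (O u) = d.x j v % g j).card := by
    choose! p hp using fun u hu => (hr u hu).2
    refine Finset.card_bij (fun u _ => p u) ?_ ?_ ?_
    · intro u hu
      simp only [Finset.mem_filter, Finset.mem_range] at hu ⊢
      obtain ⟨hu, h1, h2⟩ := hu
      obtain ⟨h3, h4, h5⟩ := hp u hu
      rw [hiff u hu] at h1
      rw [← h4, (hr u hu).1, hR.eq_of_sameLine hg hJ h3 hu h5]
      exact ⟨h3, h1.1, h2, h1.2⟩
    · intro u hu u' hu' e
      simp only [Finset.mem_filter, Finset.mem_range] at hu hu'
      have h1 := (hp u hu.1).2.1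
      rw [e, ← (hp u' hu'.1).2.1] at h1
      exact hO'.2 u hu.1 u' hu'.1 h1
    · intro w hw
      simp only [Finset.mem_filter, Finset.mem_range] at hw
      obtain ⟨hw, h1, h2, h3⟩ := hw
      obtain ⟨u, hu, h4⟩ := hO'.surj (hO.1 w hw)
      obtain ⟨h5, h6, h7⟩ := hp u hu
      have h8 : p u = w := hO.2 _ h5 _ hw (h6.symm.trans h4)
      refine ⟨u, ?_, h8⟩
      simp only [Finset.mem_filter, Finset.mem_range]
      rw [h8] at h7
      refine ⟨hu, ?_, by rw [h4]; exact h2⟩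
      rw [hiff u hu]
      exact ⟨(hR.eq_of_sameLine hg hJ hw hu h7).symm.trans h1, by rw [← (hr u hu).1, h4, h3]⟩
  have hcount := Lines.count_tgt (n := d.N) (S := fun u => R (d.enum j u))
    (len := fun u => d.len j (g j) (d.enum j u)) (z := fun u => z (O (d.enum j u))) (a := R v)
    (b := d.x j v % g j) (l := d.len j (g j) v)
    (fun u hu h => hR.len_eq hg hj (enum_lt hj hu) hv h)
  have a1 : Lines.cnt (fun u => R (d.enum j u)) (fun u => z (O (d.enum j u))) (R v) d.N =
      ((Finset.range d.N).filter fun u => R u = R v ∧ z (O u)).card := by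
    rw [Lines.cnt, Nat.count_eq_card_filter_range]
    exact (bijLt_enum hj).card_filter (fun u => R u = R v ∧ z (O u))
  rw [a1] at hcount
  refine (e2.trans ?_).trans hcount
  rw [Nat.count_eq_card_filter_range, ← (bijLt_enum hj).card_filter
    (fun u => R u = R v ∧ z (O u) ∧ tgt (O u) = d.x j v % g j)]
  refine congrArg Finset.card (Finset.filter_congr fun u hu => ?_)
  rw [ht u (Finset.mem_range.1 hu)]

end stage

/-- Initially, slabs are boxes, and are balanced if every box contains its own robots. -/
theorem balanced_zero {G : ℕ → ℕ} (hG : BijLt d.N G) (hg : ∀ l < d.k, 0 < g l)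
    (hR : d.RepOK g ∅ R)
    (hbox : ∀ v < d.N, ∀ l < d.k, d.x l v / g l = d.x l (G v) / g l) :
    d.Balanced h i R fun v => d.x i (G v) / h % 2 = 0 := by
  intro a
  rw [← hG.card_filter (fun v => R v = a ∧ d.x i v / h % 2 = 0)]
  refine congrArg Finset.card (Finset.filter_congr fun v hv => ?_)
  have hv := Finset.mem_range.1 hv
  have : R v = R (G v) := (hR.eq_iff hg hv (hG.1 v hv)).2 fun l hl => ⟨by simp, hbox v hv l hl⟩
  rw [this]

/-- Finally, slabs are vertices. -/
theorem balanced_last {z : ℕ → Prop} [DecidablePred z] (hg : ∀ l < d.k, 0 < g l)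
    (hR : d.RepOK g J R) (hJ : ∀ l < d.k, l ∈ J) (hb : d.Balanced h i R z) {v : ℕ} (hv : v < d.N) :
    z v ↔ d.x i v / h % 2 = 0 := by
  have h1 : ∀ p : ℕ → Prop, ∀ _ : DecidablePred p,
      ((Finset.range d.N).filter fun u => R u = R v ∧ p u).card = if p v then 1 else 0 := by
    intro p _
    have : ((Finset.range d.N).filter fun u => R u = R v ∧ p u) = if p v then {v} else ∅ := by
      ext u
      simp only [Finset.mem_filter, Finset.mem_range]
      have e : u < d.N → R u = R v → u = v := fun hu h =>
        ext hu hv fun l hl => ((hR.eq_iff hg hu hv).1 h l hl).1 (hJ l hl)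
      split_ifs with hp
      · rw [Finset.mem_singleton]
        exact ⟨fun h => e h.1 h.2.1, by rintro rfl; exact ⟨hv, rfl, hp⟩⟩
      · simp only [Finset.notMem_empty, iff_false]
        exact fun h => hp (e h.1 h.2.1 ▸ h.2.2)
    rw [this]; split_ifs <;> simp
  have := hb (R v)
  rw [h1, h1] at this
  by_cases e1 : z v <;> by_cases e2 : d.x i v / h % 2 = 0 <;> simp_all

end Dims

/-! ### Exchanging two neighbours in a ladder with three rungs -/

/-- Three words of five moves on the ladder `0 1 2 / 3 4 5`.  Entry `(6 t + s) * 6 + q` is the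
initial place of the robot that is at place `q` after `s` moves of the word `t`. -/
def wordTab : List ℕ :=
  [0, 1, 2, 3, 4, 5, 3, 0, 2, 4, 1, 5, 3, 1, 0, 4, 5, 2,
   1, 0, 2, 3, 4, 5, 1, 0, 2, 3, 4, 5, 1, 0, 2, 3, 4, 5,
   0, 1, 2, 3, 4, 5, 3, 0, 2, 4, 1, 5, 4, 3, 2, 1, 0, 5,
   4, 0, 3, 1, 5, 2, 0, 3, 2, 4, 1, 5, 3, 1, 2, 0, 4, 5,
   0, 1, 2, 3, 4, 5, 3, 0, 2, 4, 1, 5, 0, 2, 5, 3, 4, 1,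
   0, 4, 2, 3, 1, 5, 0, 4, 2, 3, 1, 5, 0, 4, 2, 3, 1, 5]

/-- The initial place of the robot that is at place `q` after `s` moves of the word `t`. -/
def word (t s q : ℕ) : ℕ := wordTab.getD ((t * 6 + s) * 6 + q) 0

/-- Adjacency in the ladder `0 1 2 / 3 4 5`. -/
def Rung (q r : ℕ) : Prop :=
  (q + 3 = r ∨ r + 3 = q) ∨ (q + 1 = r ∧ q ≠ 2) ∨ (r + 1 = q ∧ r ≠ 2)

instance (q r : ℕ) : Decidable (Rung q r) := by unfold Rung; infer_instance

/-- The first one of the two places exchanged by the word `t`. -/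
def swapFst (t : ℕ) : ℕ := if t = 2 then 1 else 0
/-- The second one of the two places exchanged by the word `t`. -/
def swapSnd (t : ℕ) : ℕ := if t = 0 then 1 else if t = 1 then 3 else 4

/-- Every non-idle move of a word rotates one of the two squares or the outer hexagon of the ladder.
Up to symmetry the words exchange each kind of edge: `0 1` on a long side, the end rung `0 3`, the
middle rung `1 4`. Words `0` and `2` need three moves and are padded with idle ones to the length of
word `1`, so that all ladders run in lockstep. -/
theorem word_lt : ∀ t < 3, ∀ s < 6, ∀ q < 6, word t s q < 6 := by decide
theorem word_inj : ∀ t < 3, ∀ s < 6, ∀ q < 6, ∀ r < 6, word t s q = word t s r → q = r := by decide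
theorem word_zero : ∀ t < 3, ∀ q < 6, word t 0 q = q := by decide
theorem word_five : ∀ t < 3, ∀ q < 6, word t 5 q =
    if q = swapFst t then swapSnd t else if q = swapSnd t then swapFst t else q := by decide
set_option synthInstance.maxSize 1000 in
theorem word_adj : ∀ t < 3, ∀ s < 5, ∀ q < 6, ∀ r < 6, word t s q = word t (s + 1) r →
    q = r ∨ Rung q r := by decide
set_option synthInstance.maxSize 1000 in
theorem word_noswap : ∀ t < 3, ∀ s < 5, ∀ q < 6, ∀ r < 6, word t s q = word t (s + 1) r →
    word t s r = word t (s + 1) q → q = r := by decide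

/-! ### Simultaneous moves on disjoint ladders -/

namespace Dims
variable {d : Dims}

/-- A valid move, in terms of the robots `O v` and `O' v` at the vertex `v` before and after it. -/
def Move (d : Dims) (O O' : ℕ → ℕ) : Prop :=
  (∀ u < d.N, ∀ v < d.N, O u = O' v → u = v ∨ d.Adj u v) ∧
    ∀ u < d.N, ∀ v < d.N, O u = O' v → O v = O' u → u = v

/-- The places `c 0, …, c 5` form a ladder near `v`, and the word `t` exchanges `v` with its
neighbour in direction `j`. -/
structure Block (d : Dims) (j j' j'' v : ℕ) (c : ℕ → ℕ) (t : ℕ) : Prop where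
  t_lt : t < 3
  lt : ∀ q < 6, c q < d.N
  adj : ∀ q < 6, ∀ r < 6, Rung q r → d.Adj (c q) (c r)
  inj : ∀ q < 6, ∀ r < 6, c q = c r → q = r
  pair : (c (swapFst t) = v ∧ c (swapSnd t) = v + d.P j) ∨
    (c (swapFst t) = v + d.P j ∧ c (swapSnd t) = v)
  near : ∀ q < 6, ∀ l < d.k, d.x l (c q) ≤ d.x l v + 2 ∧ d.x l v ≤ d.x l (c q) + 2 ∧
    (l ≠ j → l ≠ j' → l ≠ j'' → d.x l (c q) = d.x l v)

/-- Vertices of the same class have disjoint blocks. -/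
def cls (d : Dims) (j j' j'' v : ℕ) : ℕ :=
  d.x j v % 5 + 5 * (d.x j' v % 5) + 25 * (d.x j'' v % 5)

theorem cls_lt (j j' j'' v : ℕ) : d.cls j j' j'' v < 125 := by unfold cls; omega

/-- Both base vertices are within 2 of the common place in each of the three directions. Their
coordinates then differ by at most 4 and agree modulo 5, so they are equal; the remaining
coordinates are those of the common place. -/
theorem Block.disjoint {j j' j'' u v t t' q r : ℕ} {c c' : ℕ → ℕ} (hc : d.Block j j' j'' u c t)
    (hc' : d.Block j j' j'' v c' t') (hu : u < d.N) (hv : v < d.N)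
    (hcls : d.cls j j' j'' u = d.cls j j' j'' v) (hq : q < 6) (hr : r < 6) (h : c q = c' r) :
    u = v := by
  refine ext hu hv fun l hl => ?_
  obtain ⟨h1, h2, h3⟩ := hc.near q hq l hl
  obtain ⟨h4, h5, h6⟩ := hc'.near r hr l hl
  rw [h] at h1 h2 h3
  unfold cls at hcls
  by_cases e1 : l = j
  · subst e1; omega
  by_cases e2 : l = j'
  · subst e2; omega
  by_cases e3 : l = j''
  · subst e3; omega
  rw [← h3 e1 e2 e3, h6 e1 e2 e3]

section pass
variable {j j' j'' : ℕ} {F : ℕ → Prop} {c : ℕ → ℕ → ℕ} {ty : ℕ → ℕ} {O₀ O O' : ℕ → ℕ} {s : ℕ}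

/-- `O` is obtained from `O₀` by the first `s` moves on the blocks of all `v` with `F v`. -/
def AfterMoves (d : Dims) (F : ℕ → Prop) (c : ℕ → ℕ → ℕ) (ty : ℕ → ℕ) (O₀ : ℕ → ℕ) (s : ℕ)
    (O : ℕ → ℕ) : Prop :=
  (∀ v, F v → ∀ q < 6, O (c v q) = O₀ (c v (word (ty v) s q))) ∧
    ∀ u < d.N, (∀ v, F v → ∀ q < 6, c v q ≠ u) → O u = O₀ u

/-- Disjoint blocks. -/
structure Blocks (d : Dims) (j j' j'' : ℕ) (F : ℕ → Prop) (c : ℕ → ℕ → ℕ) (ty : ℕ → ℕ) : Prop where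
  block : ∀ v, F v → d.Block j j' j'' v (c v) (ty v)
  disj : ∀ u v q r, F u → F v → q < 6 → r < 6 → c u q = c v r → u = v

theorem AfterMoves.zero (hB : d.Blocks j j' j'' F c ty) : d.AfterMoves F c ty O 0 O :=
  ⟨fun v hv q hq => by rw [word_zero _ (hB.block v hv).t_lt q hq], fun _ _ _ => rfl⟩

theorem AfterMoves.cases (hO : d.AfterMoves F c ty O₀ s O) {u : ℕ} (hu : u < d.N) :
    (∃ v q, F v ∧ q < 6 ∧ u = c v q ∧ O u = O₀ (c v (word (ty v) s q))) ∨
      (∀ v, F v → ∀ q < 6, c v q ≠ u) ∧ O u = O₀ u := by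
  by_cases h : ∀ v, F v → ∀ q < 6, c v q ≠ u
  · exact Or.inr ⟨h, hO.2 u hu h⟩
  · push Not at h
    obtain ⟨v, hv, q, hq, rfl⟩ := h
    exact Or.inl ⟨v, q, hv, hq, rfl, hO.1 v hv q hq⟩

/-- A robot seen at two times is traced back to its place under `O₀`. Blocks are disjoint and
permuted within themselves, so the two places either coincide or lie in one block and are related by
its word. Injectivity, adjacency and the absence of swaps thereby reduce to the finite checks on
`word`. -/
theorem AfterMoves.compare (hB : d.Blocks j j' j'' F c ty) (h₀ : BijLt d.N O₀) {s' : ℕ} (hs : s < 6)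
    (hs' : s' < 6) (hO : d.AfterMoves F c ty O₀ s O) (hO' : d.AfterMoves F c ty O₀ s' O') {u v : ℕ}
    (hu : u < d.N) (hv : v < d.N) (h : O u = O' v) :
    u = v ∨ ∃ w q r, F w ∧ q < 6 ∧ r < 6 ∧ u = c w q ∧ v = c w r ∧
      word (ty w) s q = word (ty w) s' r := by
  have hlt : ∀ w, F w → ∀ s < 6, ∀ q < 6, c w (word (ty w) s q) < d.N := fun w hw s hs q hq =>
    (hB.block w hw).lt _ (word_lt _ (hB.block w hw).t_lt s hs q hq)
  rcases hO.cases hu with ⟨w, q, hw, hq, rfl, e⟩ | ⟨h1, e⟩ <;>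
    rcases hO'.cases hv with ⟨w', r, hw', hr, rfl, e'⟩ | ⟨h1', e'⟩
  · rw [e, e'] at h
    have h2 := h₀.2 _ (hlt w hw s hs q hq) _ (hlt w' hw' s' hs' r hr) h
    obtain rfl := hB.disj _ _ _ _ hw hw' (word_lt _ (hB.block w hw).t_lt s hs q hq)
      (word_lt _ (hB.block w' hw').t_lt s' hs' r hr) h2
    exact Or.inr ⟨w, q, r, hw, hq, hr, rfl, rfl, (hB.block w hw).inj _
      (word_lt _ (hB.block w hw).t_lt s hs q hq) _ (word_lt _ (hB.block w hw).t_lt s' hs' r hr) h2⟩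
  · rw [e, e'] at h
    exact absurd (h₀.2 _ (hlt w hw s hs q hq) _ hv h)
      (h1' w hw _ (word_lt _ (hB.block w hw).t_lt s hs q hq))
  · rw [e, e'] at h
    exact absurd (h₀.2 _ hu _ (hlt w' hw' s' hs' r hr) h).symm
      (h1 w' hw' _ (word_lt _ (hB.block w' hw').t_lt s' hs' r hr))
  · rw [e, e'] at h
    exact Or.inl (h₀.2 _ hu _ hv h)

theorem AfterMoves.bijLt (hB : d.Blocks j j' j'' F c ty) (h₀ : BijLt d.N O₀) (hs : s < 6)
    (hO : d.AfterMoves F c ty O₀ s O) : BijLt d.N O := by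
  constructor
  · intro u hu
    rcases hO.cases hu with ⟨w, q, hw, hq, -, e⟩ | ⟨-, e⟩ <;> rw [e]
    · exact h₀.1 _ ((hB.block w hw).lt _ (word_lt _ (hB.block w hw).t_lt s hs q hq))
    · exact h₀.1 _ hu
  · intro u hu v hv h
    rcases hO.compare hB h₀ hs hs hO hu hv h with h | ⟨w, q, r, hw, hq, hr, rfl, rfl, hqr⟩
    · exact h
    · rw [word_inj _ (hB.block w hw).t_lt s hs q hq r hr hqr]

theorem AfterMoves.move (hB : d.Blocks j j' j'' F c ty) (h₀ : BijLt d.N O₀) (hs : s < 5)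
    (hO : d.AfterMoves F c ty O₀ s O) (hO' : d.AfterMoves F c ty O₀ (s + 1) O') : d.Move O O' := by
  constructor
  · intro u hu v hv h
    rcases hO.compare hB h₀ (by omega) (by omega) hO' hu hv h with
      h | ⟨w, q, r, hw, hq, hr, rfl, rfl, hqr⟩
    · exact Or.inl h
    · rcases word_adj _ (hB.block w hw).t_lt s hs q hq r hr hqr with rfl | h
      · exact Or.inl rfl
      · exact Or.inr ((hB.block w hw).adj q hq r hr h)
  · intro u hu v hv h h'
    rcases hO.compare hB h₀ (by omega) (by omega) hO' hu hv h with
      h | ⟨w, q, r, hw, hq, hr, rfl, rfl, hqr⟩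
    · exact h
    · rcases hO.compare hB h₀ (by omega) (by omega) hO' hv hu h' with
        h | ⟨w', q', r', hw', hq', hr', e1, e2, hqr'⟩
      · exact h.symm
      · obtain rfl := hB.disj _ _ _ _ hw hw' hq hr' e2
        obtain rfl := (hB.block w hw).inj _ hq _ hr' e2
        obtain rfl := (hB.block w hw).inj _ hr _ hq' e1
        rw [word_noswap _ (hB.block w hw).t_lt s hs q hq r hr hqr hqr']

/-- After five moves, the pairs of neighbours are exchanged. -/
theorem AfterMoves.five [DecidablePred F] (hB : d.Blocks j j' j'' F c ty)
    (hO : d.AfterMoves F c ty O₀ 5 O) {u : ℕ} (hu : u < d.N) :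
    O u = O₀ (swp (d.P j) F u) := by
  have key : ∀ v, F v → O v = O₀ (v + d.P j) ∧ O (v + d.P j) = O₀ v ∧
      ∀ q < 6, c v q ≠ v → c v q ≠ v + d.P j → O (c v q) = O₀ (c v q) := by
    intro v hv
    have hb := hB.block v hv
    have ht := hb.t_lt
    have h1 : swapFst (ty v) < 6 := by unfold swapFst; split_ifs <;> omega
    have h2 : swapSnd (ty v) < 6 := by unfold swapSnd; split_ifs <;> omega
    have h3 := hO.1 v hv _ h1
    have h4 := hO.1 v hv _ h2
    rw [word_five _ ht _ h1, if_pos rfl] at h3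
    rw [word_five _ ht _ h2, if_pos rfl] at h4
    have h5 : swapSnd (ty v) ≠ swapFst (ty v) := by
      unfold swapFst swapSnd; split_ifs <;> omega
    rw [if_neg h5] at h4
    have h6 : ∀ q < 6, c v q ≠ v → c v q ≠ v + d.P j → O (c v q) = O₀ (c v q) := by
      intro q hq e1 e2
      rw [hO.1 v hv q hq, word_five _ ht q hq]
      have h7 : q ≠ swapFst (ty v) := by
        rintro rfl; rcases hb.pair with h | h
        · exact e1 h.1
        · exact e2 h.1
      have h8 : q ≠ swapSnd (ty v) := by
        rintro rfl; rcases hb.pair with h | h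
        · exact e2 h.2
        · exact e1 h.2
      rw [if_neg h7, if_neg h8]
    rcases hb.pair with ⟨e1, e2⟩ | ⟨e1, e2⟩ <;> rw [e1, e2] at h3 h4
    · exact ⟨h3, h4, h6⟩
    · exact ⟨h4, h3, h6⟩
  unfold swp
  split_ifs with h1 h2
  · exact (key u h1).1
  · have := (key _ h2.2).2.1
    rwa [Nat.sub_add_cancel h2.1] at this
  · rcases hO.cases hu with ⟨v, q, hv, hq, rfl, -⟩ | ⟨-, e⟩
    · refine (key v hv).2.2 q hq (fun e => h1 (by rwa [e])) fun e => h2 ?_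
      rw [e, Nat.add_sub_cancel]
      exact ⟨by omega, hv⟩
    · exact e

end pass

/-! ### The ladder of an edge -/

/-- The coordinate of a neighbour of `v` in direction `l`. -/
def nbc (d : Dims) (l v : ℕ) : ℕ := if d.x l v + 1 < d.m l then d.x l v + 1 else d.x l v - 1

theorem nbc_spec {l v : ℕ} (hl : l < d.k) :
    d.nbc l v < d.m l ∧ (d.x l v + 1 = d.nbc l v ∨ d.nbc l v + 1 = d.x l v) := by
  have := x_lt (d := d) hl v
  have := d.two_le l hl
  unfold nbc; split_ifs <;> omega

theorem adj_setc {l v y : ℕ} (hl : l < d.k) (hy : y < d.m l)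
    (h : d.x l v + 1 = y ∨ y + 1 = d.x l v) : d.Adj v (d.setc l v y) :=
  ⟨l, hl, by rwa [x_setc_self hl hy], fun _ _ hl' => (x_setc_ne hl hy hl').symm⟩

/-- A path of three vertices and its translate in direction `b` form a ladder. -/
theorem Block.of_path {j j' j'' v b y t : ℕ} {p : ℕ → ℕ} (ht : t < 3) (hb : b < d.k)
    (hb' : b = j ∨ b = j' ∨ b = j'')
    (hp : ∀ q < 3, p q < d.N) (hxb : ∀ q < 3, d.x b (p q) = d.x b v) (hy : y < d.m b)
    (hyb : d.x b v + 1 = y ∨ y + 1 = d.x b v) (h01 : d.Adj (p 0) (p 1)) (h12 : d.Adj (p 1) (p 2))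
    (hinj : ∀ q < 3, ∀ r < 3, p q = p r → q = r)
    (hpair : let c := fun q => if q < 3 then p q else d.setc b (p (q - 3)) y
      (c (swapFst t) = v ∧ c (swapSnd t) = v + d.P j) ∨
      (c (swapFst t) = v + d.P j ∧ c (swapSnd t) = v))
    (hnear : ∀ q < 3, ∀ l < d.k, d.x l (p q) ≤ d.x l v + 2 ∧ d.x l v ≤ d.x l (p q) + 2 ∧
      (l ≠ j → l ≠ j' → l ≠ j'' → d.x l (p q) = d.x l v)) :
    d.Block j j' j'' v (fun q => if q < 3 then p q else d.setc b (p (q - 3)) y) t := by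
  have hadj : ∀ q < 3, ∀ r < 3, (q + 1 = r) → d.Adj (p q) (p r) := by
    intro q hq r hr h
    have : q = 0 ∧ r = 1 ∨ q = 1 ∧ r = 2 := by omega
    rcases this with ⟨rfl, rfl⟩ | ⟨rfl, rfl⟩
    · exact h01
    · exact h12
  have hadj' : ∀ q < 3, ∀ r < 3, (q + 1 = r) → d.Adj (d.setc b (p q) y) (d.setc b (p r) y) := by
    intro q hq r hr h
    obtain ⟨l, hl, h1, h2⟩ := hadj q hq r hr h
    have hlb : l ≠ b := by
      rintro rfl; rw [hxb q hq, hxb r hr] at h1; omega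
    refine ⟨l, hl, by rwa [x_setc_ne hb hy hlb, x_setc_ne hb hy hlb], fun l' hl' hll' => ?_⟩
    rw [x_setc hb hy, x_setc hb hy]
    split_ifs
    · rfl
    · exact h2 l' hl' hll'
  have hrung : ∀ q < 3, d.Adj (p q) (d.setc b (p q) y) := fun q hq =>
    adj_setc hb hy (by rw [hxb q hq]; exact hyb)
  have hup : ∀ q < 6, ∀ r < 6, q < r → Rung q r →
      d.Adj (if q < 3 then p q else d.setc b (p (q - 3)) y)
        (if r < 3 then p r else d.setc b (p (r - 3)) y) := by
    intro q hq r hr hqr h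
    unfold Rung at h
    by_cases hr3 : r < 3
    · rw [if_pos (by omega), if_pos hr3]; exact hadj q (by omega) r hr3 (by omega)
    · by_cases hq3 : q < 3
      · rw [if_pos hq3, if_neg hr3, show r - 3 = q by omega]; exact hrung q hq3
      · rw [if_neg hq3, if_neg hr3]
        exact hadj' _ (by omega) _ (by omega) (by omega)
  refine ⟨ht, fun q hq => ?_, fun q hq r hr h => ?_, fun q hq r hr h => ?_, hpair,
    fun q hq l hl => ?_⟩
  · split_ifs with h
    · exact hp q h
    · exact setc_lt hb (hp _ (by omega)) hy
  · rcases lt_trichotomy q r with e | e | e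
    · exact hup q hq r hr e h
    · subst e; unfold Rung at h; omega
    · refine (hup r hr q hq e ?_).symm
      unfold Rung at h ⊢; omega
  · have hne : ∀ q < 3, ∀ r < 3, p q ≠ d.setc b (p r) y := by
      intro q hq r hr e
      have := congrArg (d.x b) e
      rw [x_setc_self hb hy, hxb q hq] at this
      omega
    have hback : ∀ q < 3, p q = d.setc b (d.setc b (p q) y) (d.x b v) := by
      intro q hq
      rw [← hxb q hq]
      exact eq_setc hb (hp q hq) (setc_lt hb (hp q hq) hy) fun l _ hlb => (x_setc_ne hb hy hlb).symm
    by_cases hq3 : q < 3 <;> by_cases hr3 : r < 3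
    · rw [if_pos hq3, if_pos hr3] at h; exact hinj q hq3 r hr3 h
    · rw [if_pos hq3, if_neg hr3] at h; exact absurd h (hne q hq3 _ (by omega))
    · rw [if_neg hq3, if_pos hr3] at h; exact absurd h.symm (hne r hr3 _ (by omega))
    · rw [if_neg hq3, if_neg hr3] at h
      have := hinj (q - 3) (by omega) (r - 3) (by omega)
        (by rw [hback _ (by omega), h, ← hback _ (by omega)])
      omega
  · split_ifs with h
    · exact hnear q h l hl
    · rw [x_setc hb hy]
      split_ifs with e
      · subst e
        refine ⟨by omega, by omega, fun h1 h2 h3 => ?_⟩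
        rcases hb' with h | h | h
        · exact absurd h h1
        · exact absurd h h2
        · exact absurd h h3
      · exact hnear _ (by omega) l hl

end Dims

/-- Description of a ladder: the word to be used, the three places of one side, and the translation
to the other side. -/
structure Lad where
  ty : ℕ
  p0 : ℕ
  p1 : ℕ
  p2 : ℕ
  ad : ℕ
  sb : ℕ

/-- The places of one side of the ladder. -/
def Lad.path (L : Lad) (q : ℕ) : ℕ := if q = 0 then L.p0 else if q = 1 then L.p1 else L.p2

/-- The places of the ladder. -/
def Lad.code (L : Lad) (q : ℕ) : ℕ := if q < 3 then L.path q else L.path (q - 3) + L.ad - L.sb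

namespace Dims
variable {d : Dims} {j l v : ℕ}

/-- `1` if coordinate `l` of `v` can be increased, and `0` otherwise. -/
def up (d : Dims) (l v : ℕ) : ℕ := if d.x l v + 1 < d.m l then 1 else 0

/-- Two further directions. -/
def nx (d : Dims) (a j : ℕ) : ℕ := (j + a) % d.k

/-- The ladder that is used to exchange `v` with its neighbour in direction `j`. -/
def ladder (d : Dims) (j v : ℕ) : Lad :=
  if 2 < d.k then
    ⟨2, v + d.P (d.nx 1 j) * d.up (d.nx 1 j) v - d.P (d.nx 1 j) * (1 - d.up (d.nx 1 j) v), v,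
      v + d.P (d.nx 2 j) * d.up (d.nx 2 j) v - d.P (d.nx 2 j) * (1 - d.up (d.nx 2 j) v), d.P j, 0⟩
  else if 2 < d.m j then
    if d.x j v + 2 < d.m j then
      ⟨0, v, v + d.P j, v + 2 * d.P j, d.P (d.nx 1 j) * d.up (d.nx 1 j) v,
        d.P (d.nx 1 j) * (1 - d.up (d.nx 1 j) v)⟩
    else ⟨0, v + d.P j, v, v - d.P j, d.P (d.nx 1 j) * d.up (d.nx 1 j) v,
        d.P (d.nx 1 j) * (1 - d.up (d.nx 1 j) v)⟩
  else if d.x (d.nx 1 j) v + 2 < d.m (d.nx 1 j) then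
    ⟨1, v, v + d.P (d.nx 1 j), v + 2 * d.P (d.nx 1 j), d.P j, 0⟩
  else if 1 < d.x (d.nx 1 j) v then
    ⟨1, v, v - d.P (d.nx 1 j), v - 2 * d.P (d.nx 1 j), d.P j, 0⟩
  else ⟨2, v - d.P (d.nx 1 j), v, v + d.P (d.nx 1 j), d.P j, 0⟩

theorem nx_lt (a j : ℕ) : d.nx a j < d.k := Nat.mod_lt _ (by have := d.two_le_k; omega)

theorem nx_one_ne (hj : j < d.k) : d.nx 1 j ≠ j := by
  have := d.two_le_k
  unfold nx
  by_cases h : j + 1 < d.k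
  · rw [Nat.mod_eq_of_lt h]; omega
  · rw [show j + 1 = d.k by omega, Nat.mod_self]; omega

theorem nx_two_ne (hj : j < d.k) (hk : 2 < d.k) : d.nx 2 j ≠ j ∧ d.nx 2 j ≠ d.nx 1 j := by
  unfold nx
  by_cases h : j + 2 < d.k
  · rw [Nat.mod_eq_of_lt h, Nat.mod_eq_of_lt (by omega)]; omega
  · rw [Nat.mod_eq_sub_mod (by omega), Nat.mod_eq_of_lt (show j + 2 - d.k < d.k by omega)]
    by_cases h1 : j + 1 < d.k
    · rw [Nat.mod_eq_of_lt h1]; omega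
    · rw [show j + 1 = d.k by omega, Nat.mod_self]; omega

theorem setc_x (v : ℕ) : d.setc l v (d.x l v) = v := by
  unfold setc; omega

theorem setc_succ : d.setc l v (d.x l v + 1) = v + d.P l := by
  rw [setc_add, one_mul]

theorem setc_pred (h : 1 ≤ d.x l v) : d.setc l v (d.x l v - 1) = v - d.P l := by
  rw [setc_sub h, one_mul]

/-- The left-hand side is the branch-free expression that the machine evaluates: exactly one of the
two terms is nonzero, so that a neighbour inside the grid is reached. -/
theorem shift_up {w : ℕ} (h : d.x l w = d.x l v) (hl : l < d.k) :
    w + d.P l * d.up l v - d.P l * (1 - d.up l v) = d.setc l w (d.nbc l v) := by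
  unfold up nbc
  have := x_lt (d := d) hl v
  have := d.two_le l hl
  split_ifs
  · rw [← h, setc_succ]; simp
  · rw [← h, setc_pred (by omega)]; simp

theorem setc_ne {a y z w w' : ℕ} (ha : a < d.k) (hy : y < d.m a) (hz : z < d.m a) (h : y ≠ z) :
    d.setc a w y ≠ d.setc a w' z := fun e => h (by
  have := congrArg (d.x a) e
  rwa [x_setc_self ha hy, x_setc_self ha hz] at this)

theorem Block.of_lad {j' j'' b y : ℕ} (L : Lad) (ht : L.ty < 3) (hb : b < d.k)
    (hb' : b = j ∨ b = j' ∨ b = j'')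
    (hp : ∀ q, L.path q < d.N) (hxb : ∀ q, d.x b (L.path q) = d.x b v) (hy : y < d.m b)
    (hyb : d.x b v + 1 = y ∨ y + 1 = d.x b v)
    (hs : ∀ q, L.path q + L.ad - L.sb = d.setc b (L.path q) y)
    (h01 : d.Adj L.p0 L.p1) (h12 : d.Adj L.p1 L.p2)
    (hne : L.p0 ≠ L.p1 ∧ L.p1 ≠ L.p2 ∧ L.p0 ≠ L.p2)
    (hpair : (L.code (swapFst L.ty) = v ∧ L.code (swapSnd L.ty) = v + d.P j) ∨
      (L.code (swapFst L.ty) = v + d.P j ∧ L.code (swapSnd L.ty) = v))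
    (hnear : ∀ q, ∀ l < d.k, d.x l (L.path q) ≤ d.x l v + 2 ∧ d.x l v ≤ d.x l (L.path q) + 2 ∧
      (l ≠ j → l ≠ j' → l ≠ j'' → d.x l (L.path q) = d.x l v)) :
    d.Block j j' j'' v L.code L.ty := by
  have e : L.code = fun q => if q < 3 then L.path q else d.setc b (L.path (q - 3)) y := by
    funext q; simp only [Lad.code, hs]
  rw [e] at hpair ⊢
  refine Block.of_path ht hb hb' (fun q _ => hp q) (fun q _ => hxb q) hy hyb h01 h12 ?_ hpair
    fun q _ => hnear q
  obtain ⟨n1, n2, n3⟩ := hne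
  intro q hq r hr h
  interval_cases q <;> interval_cases r <;> simp_all [Lad.path]

theorem forall_path {L : Lad} {p : ℕ → Prop} (h0 : p L.p0) (h1 : p L.p1) (h2 : p L.p2) (q : ℕ) :
    p (L.path q) := by
  unfold Lad.path; split_ifs <;> assumption

/-- A ladder along direction `a`. -/
theorem Block.of_line {j' j'' a b y z0 z1 z2 : ℕ} (L : Lad) (ht : L.ty < 3) (hb : b < d.k)
    (ha : a < d.k) (hab : a ≠ b) (ha' : a = j ∨ a = j')
    (hb' : b = j ∨ b = j') (hv : v < d.N) (hy : y < d.m b)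
    (hyb : d.x b v + 1 = y ∨ y + 1 = d.x b v)
    (hs : ∀ w, d.x b w = d.x b v → w + L.ad - L.sb = d.setc b w y)
    (e0 : L.p0 = d.setc a v z0) (e1 : L.p1 = d.setc a v z1) (e2 : L.p2 = d.setc a v z2)
    (hz0 : z0 < d.m a) (hz1 : z1 < d.m a) (hz2 : z2 < d.m a)
    (h01 : z0 + 1 = z1 ∨ z1 + 1 = z0) (h12 : z1 + 1 = z2 ∨ z2 + 1 = z1) (h02 : z0 ≠ z2)
    (hn : z0 = d.x a v ∨ z1 = d.x a v)
    (hpair : (L.code (swapFst L.ty) = v ∧ L.code (swapSnd L.ty) = v + d.P j) ∨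
      (L.code (swapFst L.ty) = v + d.P j ∧ L.code (swapSnd L.ty) = v)) :
    d.Block j j' j'' v L.code L.ty := by
  have hxb : ∀ q, d.x b (L.path q) = d.x b v := by
    refine forall_path (p := fun w => d.x b w = d.x b v) ?_ ?_ ?_
    · rw [e0, x_setc_ne ha hz0 hab.symm]
    · rw [e1, x_setc_ne ha hz1 hab.symm]
    · rw [e2, x_setc_ne ha hz2 hab.symm]
  have hadj : ∀ y z, y < d.m a → z < d.m a → (y + 1 = z ∨ z + 1 = y) →
      d.Adj (d.setc a v y) (d.setc a v z) := fun y z hy hz h =>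
    ⟨a, ha, by rwa [x_setc_self ha hy, x_setc_self ha hz], fun l _ hl => by
      rw [x_setc_ne ha hy hl, x_setc_ne ha hz hl]⟩
  have hnear : ∀ z, z < d.m a → z ≤ d.x a v + 2 ∧ d.x a v ≤ z + 2 → ∀ l < d.k,
      d.x l (d.setc a v z) ≤ d.x l v + 2 ∧ d.x l v ≤ d.x l (d.setc a v z) + 2 ∧
      (l ≠ j → l ≠ j' → l ≠ j'' → d.x l (d.setc a v z) = d.x l v) := by
    intro z hz h l hl
    rw [x_setc ha hz]
    split_ifs with e
    · subst e
      refine ⟨h.1, h.2, fun h1 h2 _ => ?_⟩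
      rcases ha' with h | h
      · exact absurd h h1
      · exact absurd h h2
    · exact ⟨by omega, by omega, fun _ _ _ => rfl⟩
  refine Block.of_lad L ht hb (by tauto) ?_ hxb hy hyb (fun q => hs _ (hxb q)) ?_ ?_ ?_ hpair ?_
  · refine forall_path (p := fun w => w < d.N) ?_ ?_ ?_
    · rw [e0]; exact setc_lt ha hv hz0
    · rw [e1]; exact setc_lt ha hv hz1
    · rw [e2]; exact setc_lt ha hv hz2
  · rw [e0, e1]; exact hadj _ _ hz0 hz1 h01
  · rw [e1, e2]; exact hadj _ _ hz1 hz2 h12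
  · rw [e0, e1, e2]
    exact ⟨setc_ne ha hz0 hz1 (by omega), setc_ne ha hz1 hz2 (by omega), setc_ne ha hz0 hz2 h02⟩
  · refine forall_path (p := fun w => ∀ l < d.k, d.x l w ≤ d.x l v + 2 ∧ d.x l v ≤ d.x l w + 2 ∧
      (l ≠ j → l ≠ j' → l ≠ j'' → d.x l w = d.x l v)) ?_ ?_ ?_
    · rw [e0]; exact hnear _ hz0 (by omega)
    · rw [e1]; exact hnear _ hz1 (by omega)
    · rw [e2]; exact hnear _ hz2 (by omega)

/-- `N ≥ 6` excludes the 2×2 grid, the only one that contains no ladder. -/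
theorem three_le_of_k_eq_two (hj : j < d.k) (hk : ¬ 2 < d.k) (hm : ¬ 2 < d.m j) :
    2 < d.m (d.nx 1 j) := by
  have hk : d.k = 2 := by have := d.two_le_k; omega
  have h := d.six_le
  have h0 := d.two_le 0 (by omega)
  have h1 := d.two_le 1 (by omega)
  rw [hk, Finset.prod_range_succ, Finset.prod_range_one] at h
  unfold nx
  rw [hk] at hj ⊢
  interval_cases j
  · norm_num
    by_contra hc
    rw [show d.m 0 = 2 by omega] at h; omega
  · norm_num
    by_contra hc
    rw [show d.m 1 = 2 by omega] at h; omega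

/-- The ladder is a block. -/
theorem ladder_block (hj : j < d.k) (hv : v < d.N) (hx : d.x j v + 1 < d.m j) :
    d.Block j (d.nx 1 j) (d.nx 2 j) v (d.ladder j v).code (d.ladder j v).ty := by
  have hj' := nx_lt (d := d) 1 j
  have hj'' := nx_lt (d := d) 2 j
  have hne := nx_one_ne hj
  have hA : ∀ w, d.x j w = d.x j v → w + d.P j - 0 = d.setc j w (d.x j v + 1) := fun w hw => by
    rw [← hw, setc_succ, Nat.sub_zero]
  obtain ⟨hy', hyb'⟩ := nbc_spec (v := v) hj'
  have h6 := three_le_of_k_eq_two hj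
  have h7 := nx_two_ne hj
  unfold ladder
  generalize d.nx 1 j = j' at *
  generalize d.nx 2 j = j'' at *
  have hx' := x_lt hj' v
  split_ifs with h1 h2 h3 h4 h5
  -- With at least three directions the ladder is bent at `v`: its path joins neighbours of `v` in
  -- two further directions, and the edge to be exchanged is the middle rung. No side longer than 2
  -- is needed.
  · obtain ⟨hn1, hn2⟩ := h7 h1
    obtain ⟨hy'', hyb''⟩ := nbc_spec (v := v) hj''
    rw [shift_up rfl hj', shift_up rfl hj'']
    refine Block.of_lad _ (by norm_num) hj (Or.inl rfl) ?_ ?_ hx (Or.inl rfl) ?_ ?_ ?_ ?_ ?_ ?_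
    · exact forall_path (p := fun w => w < d.N) (setc_lt hj' hv hy') hv (setc_lt hj'' hv hy'')
    · refine forall_path (p := fun w => d.x j w = d.x j v) ?_ rfl ?_
      · exact x_setc_ne hj' hy' hne.symm
      · exact x_setc_ne hj'' hy'' hn1.symm
    · refine forall_path (p := fun w => w + d.P j - 0 = d.setc j w (d.x j v + 1)) (hA _ ?_)
        (hA _ rfl) (hA _ ?_)
      · exact x_setc_ne hj' hy' hne.symm
      · exact x_setc_ne hj'' hy'' hn1.symm
    · exact (adj_setc hj' hy' hyb').symm
    · exact adj_setc hj'' hy'' hyb''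
    · have n1 : d.setc j' v (d.nbc j' v) ≠ v := fun e => by
        have := congrArg (d.x j') e
        rw [x_setc_self hj' hy'] at this; omega
      have n2 : v ≠ d.setc j'' v (d.nbc j'' v) := fun e => by
        have := congrArg (d.x j'') e
        rw [x_setc_self hj'' hy''] at this; omega
      have n3 : d.setc j' v (d.nbc j' v) ≠ d.setc j'' v (d.nbc j'' v) := fun e => by
        have := congrArg (d.x j') e
        rw [x_setc_self hj' hy', x_setc_ne hj'' hy'' (Ne.symm hn2)] at this
        omega
      exact ⟨n1, n2, n3⟩
    · left; simp [swapFst, swapSnd, Lad.code, Lad.path]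
    · refine forall_path (p := fun w => ∀ l < d.k, d.x l w ≤ d.x l v + 2 ∧ d.x l v ≤ d.x l w + 2 ∧
        (l ≠ j → l ≠ j' → l ≠ j'' → d.x l w = d.x l v)) ?_ ?_ ?_
      · intro l hl
        rw [x_setc hj' hy']
        split_ifs with e
        · subst e; exact ⟨by omega, by omega, fun _ h => absurd rfl h⟩
        · exact ⟨by omega, by omega, fun _ _ _ => rfl⟩
      · exact fun l _ => ⟨Nat.le_add_right _ _, Nat.le_add_right _ _, fun _ _ _ => rfl⟩
      · intro l hl
        rw [x_setc hj'' hy'']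
        split_ifs with e
        · subst e; exact ⟨by omega, by omega, fun _ _ h => absurd rfl h⟩
        · exact ⟨by omega, by omega, fun _ _ _ => rfl⟩
  -- Two directions and `m j > 2`: the path runs along `j` and starts with the edge; the next case
  -- is its mirror image at the far border.
  · refine Block.of_line (a := j) (b := j') (y := d.nbc j' v) (z0 := d.x j v) (z1 := d.x j v + 1)
      (z2 := d.x j v + 2) _ (by norm_num) hj' hj hne.symm (Or.inl rfl) (Or.inr rfl) hv hy' hyb'
      (fun w hw => shift_up hw hj') (setc_x v).symm setc_succ.symm setc_add.symm
      (by omega) hx h3 (by omega) (by omega) (by omega) (by omega) ?_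
    left; simp [swapFst, swapSnd, Lad.code, Lad.path]
  · refine Block.of_line (a := j) (b := j') (y := d.nbc j' v) (z0 := d.x j v + 1) (z1 := d.x j v)
      (z2 := d.x j v - 1) _ (by norm_num) hj' hj hne.symm (Or.inl rfl) (Or.inr rfl) hv hy' hyb'
      (fun w hw => shift_up hw hj') setc_succ.symm (setc_x v).symm (setc_pred (by omega)).symm
      (by omega) (by omega) (by omega) (by omega) (by omega) (by omega) (by omega) ?_
    right; simp [swapFst, swapSnd, Lad.code, Lad.path]
  -- Now `m j = 2`, and the path runs in the other direction, with the edge as an end rung.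
  · refine Block.of_line (a := j') (b := j) (y := d.x j v + 1) (z0 := d.x j' v)
      (z1 := d.x j' v + 1) (z2 := d.x j' v + 2) _ (by norm_num) hj hj' hne (Or.inr rfl)
      (Or.inl rfl) hv hx (Or.inl rfl) hA (setc_x v).symm setc_succ.symm setc_add.symm
      (by omega) (by omega) h4 (by omega) (by omega) (by omega) (by omega) ?_
    left; simp [swapFst, swapSnd, Lad.code, Lad.path]
  · refine Block.of_line (a := j') (b := j) (y := d.x j v + 1) (z0 := d.x j' v)
      (z1 := d.x j' v - 1) (z2 := d.x j' v - 2) _ (by norm_num) hj hj' hne (Or.inr rfl)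
      (Or.inl rfl) hv hx (Or.inl rfl) hA (setc_x v).symm (setc_pred (by omega)).symm
      (setc_sub (by omega)).symm
      (by omega) (by omega) (by omega) (by omega) (by omega) (by omega) (by omega) ?_
    left; simp [swapFst, swapSnd, Lad.code, Lad.path]
  -- Neither side offers two further vertices, so the other side length is 3 and `v` is in its
  -- middle: the edge is the middle rung.
  · have h6 := h6 h1 h2
    refine Block.of_line (a := j') (b := j) (y := d.x j v + 1) (z0 := d.x j' v - 1)
      (z1 := d.x j' v) (z2 := d.x j' v + 1) _ (by norm_num) hj hj' hne (Or.inr rfl)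
      (Or.inl rfl) hv hx (Or.inl rfl) hA (setc_pred (by omega)).symm (setc_x v).symm
      setc_succ.symm
      (by omega) (by omega) (by omega) (by omega) (by omega) (by omega) (by omega) ?_
    left; simp [swapFst, swapSnd, Lad.code, Lad.path]

end Dims

/-! ### The program -/

-- Memory map. Registers: `0` is `k` (finally the makespan), `1` is `N`, `2` counts the moves, `3`
-- is `h`, `4` the direction `i` of the cut, `5` the stage, `6` the direction `j` of the stage, `7`
-- to `13` its data, `14` the round, `15` the class, `16` the move within a word, `17` a vertex,
-- robot or item, `18` a direction in auxiliary loops, `19` and `20` the stride and length of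
-- direction `i`, `21` to `26` the ladder, `27` to `30` scratch. Arrays: `0` side lengths, `1` and
-- `2` initial and goal places, `3` output, `4` strides, `5` the robot at each vertex, `6` a copy of
-- it, `7` flags, `8` targets of robots, `9` slab names of vertices, `10` and `11` counters per slab
-- of marked and unmarked robots, `12` the places of a ladder, `13` the words.
infixr:60 " ;; " => Prog.seq

/-- The static part of the memory: the grid and the goal locations. -/
structure Ctx (d : Dims) (G : ℕ → ℕ) (s : State) : Prop where
  k : s.var 0 = d.k
  N : s.var 1 = d.N
  m : ∀ l < d.k, s.arr 0 l = d.m l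
  G : ∀ r < d.N, s.arr 2 r = G r
  P : ∀ l < d.k, s.arr 4 l = d.P l
  tab : ∀ q < 108, s.arr 13 q = wordTab.getD q 0

/-- The program does not write to the static part of the memory. -/
def Prog.static (p : Prog) : Bool :=
  0 ∉ p.wvar ∧ 1 ∉ p.wvar ∧ 0 ∉ p.warr ∧ 2 ∉ p.warr ∧ 4 ∉ p.warr ∧ 13 ∉ p.warr

theorem Ctx.frame {d : Dims} {G : ℕ → ℕ} {s s' : State} {p : Prog} (h : Ctx d G s)
    (hf : Frame p s s') (hp : p.static = true) : Ctx d G s' := by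
  simp only [Prog.static, decide_eq_true_eq] at hp
  obtain ⟨h1, h2, h3, h4, h5, h6⟩ := hp
  constructor
  · rw [hf.var _ h1]; exact h.k
  · rw [hf.var _ h2]; exact h.N
  · rw [hf.arr _ h3]; exact h.m
  · rw [hf.arr _ h4]; exact h.G
  · rw [hf.arr _ h5]; exact h.P
  · rw [hf.arr _ h6]; exact h.tab

/-- The words are long enough. -/
structure Big (d : Dims) (w B : ℕ) : Prop where
  room : Room w B
  le : 1000 * d.N ≤ B

/-- A valid move, in terms of the locations `L r` and `L' r` of the robot `r`. -/
def LocMove (d : Dims) (L L' : ℕ → ℕ) : Prop :=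
  (∀ r < d.N, L' r = L r ∨ d.Adj (L r) (L' r)) ∧
    ∀ r < d.N, ∀ r' < d.N, r ≠ r' → L r = L' r' → L r' ≠ L' r

/-- The output array holds a sequence of configurations that starts with `X`, and `O` lists the
robots at the vertices in the last one of them. -/
structure Cfg (d : Dims) (X O : ℕ → ℕ) (s : State) : Prop where
  bij : BijLt d.N O
  start : ∀ r < d.N, s.arr 3 r = X r
  hist : ∀ t ≤ s.var 2, BijLt d.N fun r => s.arr 3 (t * d.N + r)
  move : ∀ t < s.var 2,
    LocMove d (fun r => s.arr 3 (t * d.N + r)) (fun r => s.arr 3 ((t + 1) * d.N + r))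
  cur : ∀ v < d.N, s.arr 3 (s.var 2 * d.N + O v) = v

theorem Cfg.frame {d : Dims} {X O : ℕ → ℕ} {s s' : State} {p : Prog} (h : Cfg d X O s)
    (hf : Frame p s s') (hp : 2 ∉ p.wvar ∧ 3 ∉ p.warr) : Cfg d X O s' := by
  have h2 := hf.var _ hp.1
  have h3 := hf.arr _ hp.2
  obtain ⟨a, b, c, e, f⟩ := h
  constructor <;> first | assumption | (simp only [h2, h3]; assumption)

theorem Cfg.setVar {d : Dims} {X O : ℕ → ℕ} {s : State} (h : Cfg d X O s) {x u : ℕ} (hx : x ≠ 2) :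
    Cfg d X O (s.setVar x u) := by
  obtain ⟨a, b, c, e, f⟩ := h
  constructor <;>
    first | assumption | (simp only [State.setVar_arr, State.setVar_var, if_neg hx.symm]; assumption)

section
variable {d : Dims} {G X : ℕ → ℕ} {w B : ℕ} {s : State}

/-- Append the current configuration to the output. -/
def emit : Prog :=
  .for 17 (.var 1) (.put 3 (.var 2 * .var 1 + .get 5 (.var 17)) (.var 17))

theorem emit_runs (hB : Big d w B) (hc : Ctx d G s) (hO : BijLt d.N (s.arr 5)) (hT : s.var 2 ≤ B) :
    Runs w emit s ((d.N + 1) * 20) fun s' =>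
      (∀ v < d.N, s'.arr 3 (s.var 2 * d.N + s.arr 5 v) = v) ∧
      ∀ i < s.var 2 * d.N, s'.arr 3 i = s.arr 3 i := by
  have hle := hB.le
  have h6 := d.six_le_N
  refine (Runs.for_const hB.room (n := d.N) (c := 12)
    (fun n s' => (∀ v < n, s'.arr 3 (s.var 2 * d.N + s.arr 5 v) = v) ∧
      ∀ i < s.var 2 * d.N, s'.arr 3 i = s.arr 3 i) (by decide) (by decide) (by omega) ?_ ?_ ?_
    ?_).mono (by simp [Expr.cost]) fun _ _ h => h
  · intro s' hf
    have := (hc.frame hf (by decide)).N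
    simp [this]; omega
  · exact ⟨by simp, fun _ _ => rfl⟩
  · intro n hn s' hf ⟨h1, h2⟩ hv
    have e1 := (hc.frame hf (by decide)).N
    have e2 := hf.var 2 (by decide)
    have e5 := hf.arr 5 (by decide)
    have := hO.1 n hn
    refine (Prog.runs_of_wp hB.room (by decide) ?_).mono (by decide) fun _ _ h => h
    simp only [Prog.wp, Expr.bdd_add, Expr.bdd_mul, Expr.bdd_var, Expr.bdd_get, Expr.nval_add,
      Expr.nval_mul, Expr.nval_var, Expr.nval_get, e1, e2, e5, hv, State.setVar_arr,
      State.setArr_arr, if_true]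
    refine ⟨⟨⟨by omega, by omega⟩, by omega, by omega⟩, by omega, fun v hv => ?_, fun i hi => ?_⟩
    · rw [Function.update_apply]
      split_ifs with h
      · exact (hO.2 v (by omega) n hn (by omega)).symm
      · refine h1 v (Nat.lt_of_le_of_ne (by omega) ?_)
        rintro rfl; exact h rfl
    · rw [Function.update_apply, if_neg (by omega)]; exact h2 i hi
  · exact fun s' _ h => h

/-- Occupants and locations are inverse permutations: the routing works with the former, the output
and the definition of a valid move with the latter. -/
theorem Dims.Move.locMove {O O' L L' : ℕ → ℕ} (h : d.Move O O') (hO : BijLt d.N O)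
    (hO' : BijLt d.N O') (hL : ∀ v < d.N, L (O v) = v) (hL' : ∀ v < d.N, L' (O' v) = v) :
    LocMove d L L' := by
  constructor
  · intro r hr
    obtain ⟨u, hu, rfl⟩ := hO.surj hr
    obtain ⟨v, hv, e⟩ := hO'.surj hr
    have h1 := h.1 u hu v hv e.symm
    rw [hL u hu, ← e, hL' v hv]
    exact h1.imp Eq.symm id
  · intro r hr r' hr' hne h1 h2
    obtain ⟨u, hu, rfl⟩ := hO.surj hr
    obtain ⟨v, hv, rfl⟩ := hO.surj hr'
    obtain ⟨u', hu', e⟩ := hO'.surj hr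
    obtain ⟨v', hv', e'⟩ := hO'.surj hr'
    rw [hL u hu, ← e', hL' v' hv'] at h1
    rw [hL v hv, ← e, hL' u' hu'] at h2
    subst h1 h2
    exact hne (by rw [h.2 u hu v hv e.symm e'.symm])

/-- Append the current configuration to the output as the result of a move. -/
def record : Prog := .assign 2 (.var 2 + .const 1) ;; emit

theorem record_runs {O : ℕ → ℕ} (hB : Big d w B) (hc : Ctx d G s) (hC : Cfg d X O s)
    (hO : BijLt d.N (s.arr 5)) (hm : d.Move O (s.arr 5)) (hT : s.var 2 + 1 ≤ B) :
    Runs w record s ((d.N + 1) * 24) fun s' =>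
      Cfg d X (s.arr 5) s' ∧ s'.var 2 = s.var 2 + 1 := by
  have hle := hB.le
  have h6 := d.six_le_N
  have h1 : Runs w (.assign 2 (.var 2 + .const 1)) s 4 fun s' => s' = s.setVar 2 (s.var 2 + 1) := by
    refine (Prog.runs_of_wp hB.room (by decide) ?_).mono (by decide) fun _ _ h => h
    simp [Prog.wp]; omega
  refine (Runs.seq (t₂ := (d.N + 1) * 20) h1 fun s₁ hf₁ e => ?_).mono (by omega) fun _ _ h => h
  subst e
  refine (emit_runs hB (hc.frame hf₁ (by decide)) hO (by simpa using hT)).mono le_rfl ?_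
  intro s' hf ⟨h1, h2⟩
  have e2 := hf.var 2 (by decide)
  simp only [State.setVar_var, State.setVar_arr, if_true] at h1 h2 e2
  -- The new row lies beyond all earlier ones, so the recorded history is unchanged.
  have hlt : ∀ t ≤ s.var 2, ∀ r < d.N, t * d.N + r < (s.var 2 + 1) * d.N := fun t ht r hr => by
    have := Nat.mul_le_mul_right d.N ht
    rw [add_mul]; omega
  have hloc : ∀ r < d.N, ∃ v < d.N, s.arr 5 v = r ∧ s'.arr 3 ((s.var 2 + 1) * d.N + r) = v :=
    fun r hr => by
    obtain ⟨v, hv, rfl⟩ := hO.surj hr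
    exact ⟨v, hv, rfl, h1 v hv⟩
  refine ⟨⟨hO, fun r hr => ?_, fun t ht => ?_, fun t ht => ?_, by rwa [e2]⟩, e2⟩
  · rw [h2 _ (by have := hlt 0 (by omega) r hr; omega)]; exact hC.start r hr
  · rw [e2] at ht
    rcases Nat.lt_or_ge (s.var 2) t with h | h
    · obtain rfl : t = s.var 2 + 1 := by omega
      constructor
      · intro r hr
        obtain ⟨v, hv, -, e⟩ := hloc r hr
        simpa only [e] using hv
      · intro r hr r' hr' h
        obtain ⟨v, hv, e1, e⟩ := hloc r hr
        obtain ⟨v', hv', e1', e'⟩ := hloc r' hr'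
        simp only [e, e'] at h
        rw [← e1, ← e1', h]
    · exact (hC.hist t h).congr fun r hr => h2 _ (hlt t h r hr)
  · rw [e2] at ht
    have h3 : ∀ t ≤ s.var 2, ∀ r < d.N, s'.arr 3 (t * d.N + r) = s.arr 3 (t * d.N + r) :=
      fun t ht r hr => h2 _ (hlt t ht r hr)
    rcases Nat.lt_or_ge t (s.var 2) with h | h
    · have hm := hC.move t h
      refine ⟨fun r hr => ?_, fun r hr r' hr' => ?_⟩ <;> beta_reduce
      · rw [h3 t h.le r hr, h3 (t + 1) h r hr]; exact hm.1 r hr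
      · rw [h3 t h.le r hr, h3 (t + 1) h r hr, h3 t h.le r' hr', h3 (t + 1) h r' hr']
        exact hm.2 r hr r' hr'
    · obtain rfl : t = s.var 2 := by omega
      refine hm.locMove hC.bij hO (fun v hv => ?_) h1
      rw [h3 _ le_rfl _ (hC.bij.1 v hv)]; exact hC.cur v hv

end

/-! ### Executing ladder moves on the machine -/

/-- The registers that describe the direction `j` and the width `g` of the boxes. -/
structure Dir (d : Dims) (j g : ℕ) (s : State) : Prop where
  P : s.var 7 = d.P j
  m : s.var 8 = d.m j
  g : s.var 9 = g
  P' : s.var 10 = d.P (d.nx 1 j)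
  m' : s.var 11 = d.m (d.nx 1 j)
  P'' : s.var 12 = d.P (d.nx 2 j)
  m'' : s.var 13 = d.m (d.nx 2 j)

/-- The program does not write to the registers `7` to `13`. -/
def Prog.keepsDir (p : Prog) : Bool :=
  7 ∉ p.wvar ∧ 8 ∉ p.wvar ∧ 9 ∉ p.wvar ∧ 10 ∉ p.wvar ∧ 11 ∉ p.wvar ∧ 12 ∉ p.wvar ∧ 13 ∉ p.wvar

theorem Dir.frame {d : Dims} {j g : ℕ} {s s' : State} {p : Prog} (h : Dir d j g s)
    (hf : Frame p s s') (hp : p.keepsDir = true) : Dir d j g s' := by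
  simp only [Prog.keepsDir, decide_eq_true_eq] at hp
  obtain ⟨h1, h2, h3, h4, h5, h6, h7⟩ := hp
  constructor
  · rw [hf.var _ h1]; exact h.P
  · rw [hf.var _ h2]; exact h.m
  · rw [hf.var _ h3]; exact h.g
  · rw [hf.var _ h4]; exact h.P'
  · rw [hf.var _ h5]; exact h.m'
  · rw [hf.var _ h6]; exact h.P''
  · rw [hf.var _ h7]; exact h.m''

/-- The coordinate of the vertex in register `17` in direction `j`. -/
def co0 : Expr := .var 17 / .var 7 % .var 8
/-- The coordinate of the vertex in register `17` in direction `j + 1`. -/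
def co1 : Expr := .var 17 / .var 10 % .var 11
/-- The coordinate of the vertex in register `17` in direction `j + 2`. -/
def co2 : Expr := .var 17 / .var 12 % .var 13
/-- Whether `co1` can be increased. -/
def up1 : Expr := (co1 + .const 1).ltE (.var 11)
/-- Whether `co2` can be increased. -/
def up2 : Expr := (co2 + .const 1).ltE (.var 13)

/-- Assignment to the registers that describe a ladder. -/
def setLad (ty p0 p1 p2 ad sb : Expr) : Prog :=
  .assign 21 p0 ;; .assign 22 p1 ;; .assign 23 p2 ;; .assign 24 ad ;; .assign 25 sb ;; .assign 26 ty

/-- Computation of the ladder of the vertex in register `17`. -/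
def ladderProg : Prog :=
  .ite (.ltE (.const 2) (.var 0))
    (setLad (.const 2) (.var 17 + .var 10 * up1 - .var 10 * (.const 1 - up1)) (.var 17)
      (.var 17 + .var 12 * up2 - .var 12 * (.const 1 - up2)) (.var 7) (.const 0))
  (.ite (.ltE (.const 2) (.var 8))
    (.ite (.ltE (co0 + .const 2) (.var 8))
      (setLad (.const 0) (.var 17) (.var 17 + .var 7) (.var 17 + .const 2 * .var 7)
        (.var 10 * up1) (.var 10 * (.const 1 - up1)))
      (setLad (.const 0) (.var 17 + .var 7) (.var 17) (.var 17 - .var 7)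
        (.var 10 * up1) (.var 10 * (.const 1 - up1))))
  (.ite (.ltE (co1 + .const 2) (.var 11))
    (setLad (.const 1) (.var 17) (.var 17 + .var 10) (.var 17 + .const 2 * .var 10) (.var 7)
      (.const 0))
  (.ite (.ltE (.const 1) co1)
    (setLad (.const 1) (.var 17) (.var 17 - .var 10) (.var 17 - .const 2 * .var 10) (.var 7)
      (.const 0))
    (setLad (.const 2) (.var 17 - .var 10) (.var 17) (.var 17 + .var 10) (.var 7) (.const 0)))))

theorem Expr.nval_lt_ne_zero {s : State} {e f : Expr} :
    (e.ltE f).nval s ≠ 0 ↔ e.nval s < f.nval s := by simp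

theorem Expr.nval_lt_eq_zero {s : State} {e f : Expr} :
    (e.ltE f).nval s = 0 ↔ ¬ e.nval s < f.nval s := by simp

section
variable {d : Dims} {G X : ℕ → ℕ} {w B : ℕ} {s : State} {j g : ℕ}

/-- The ladder is stored in the registers `21` to `26`. -/
structure LadRegs (L : Lad) (s : State) : Prop where
  p0 : s.var 21 = L.p0
  p1 : s.var 22 = L.p1
  p2 : s.var 23 = L.p2
  ad : s.var 24 = L.ad
  sb : s.var 25 = L.sb
  ty : s.var 26 = L.ty

/-- The expressions depend only on the arrays and on registers below `21`, so the six successive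
assignments act like a simultaneous one. -/
theorem setLad_wp {ty p0 p1 p2 ad sb : Expr} {L : Lad} {Q : State → Prop}
    (hb : ∀ s' : State, (∀ x < 21, s'.var x = s.var x) → s'.arr = s.arr →
      (p0.Bdd B s' ∧ p1.Bdd B s' ∧ p2.Bdd B s' ∧ ad.Bdd B s' ∧ sb.Bdd B s' ∧ ty.Bdd B s') ∧
      p0.nval s' = L.p0 ∧ p1.nval s' = L.p1 ∧ p2.nval s' = L.p2 ∧ ad.nval s' = L.ad ∧
      sb.nval s' = L.sb ∧ ty.nval s' = L.ty)
    (hQ : ∀ s', LadRegs L s' → Q s') : (setLad ty p0 p1 p2 ad sb).wp B Q s := by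
  simp only [setLad, Prog.wp]
  obtain ⟨⟨b, -⟩, e0, -⟩ := hb s (fun _ _ => rfl) rfl
  refine ⟨b, ?_⟩
  rw [e0]
  obtain ⟨⟨-, b, -⟩, -, e1, -⟩ := hb (s.setVar 21 L.p0)
    (fun x hx => by simp; omega) rfl
  refine ⟨b, ?_⟩
  rw [e1]
  obtain ⟨⟨-, -, b, -⟩, -, -, e2, -⟩ := hb ((s.setVar 21 L.p0).setVar 22 L.p1)
    (fun x hx => by simp [show x ≠ 21 by omega, show x ≠ 22 by omega]) rfl
  refine ⟨b, ?_⟩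
  rw [e2]
  obtain ⟨⟨-, -, -, b, -⟩, -, -, -, e3, -⟩ := hb (((s.setVar 21 L.p0).setVar 22 L.p1).setVar 23 L.p2)
    (fun x hx => by simp [show x ≠ 21 by omega, show x ≠ 22 by omega, show x ≠ 23 by omega]) rfl
  refine ⟨b, ?_⟩
  rw [e3]
  obtain ⟨⟨-, -, -, -, b, -⟩, -, -, -, -, e4, -⟩ := hb
    ((((s.setVar 21 L.p0).setVar 22 L.p1).setVar 23 L.p2).setVar 24 L.ad)
    (fun x hx => by simp [show x ≠ 21 by omega, show x ≠ 22 by omega, show x ≠ 23 by omega,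
      show x ≠ 24 by omega]) rfl
  refine ⟨b, ?_⟩
  rw [e4]
  obtain ⟨⟨-, -, -, -, -, b⟩, -, -, -, -, -, e5⟩ := hb
    (((((s.setVar 21 L.p0).setVar 22 L.p1).setVar 23 L.p2).setVar 24 L.ad).setVar 25 L.sb)
    (fun x hx => by simp [show x ≠ 21 by omega, show x ≠ 22 by omega, show x ≠ 23 by omega,
      show x ≠ 24 by omega, show x ≠ 25 by omega]) rfl
  refine ⟨b, ?_⟩
  rw [e5]
  exact hQ _ (by constructor <;> simp)

theorem Dir.bounds (hB : Big d w B) (hD : Dir d j g s) (hj : j < d.k) (hg : g ≤ 2 * d.N) :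
    s.var 7 ≤ B ∧ s.var 8 ≤ B ∧ s.var 9 ≤ B ∧ s.var 10 ≤ B ∧ s.var 11 ≤ B ∧ s.var 12 ≤ B ∧
      s.var 13 ≤ B := by
  have hle := hB.le
  have a1 := Dims.P_le_N hj.le
  have a2 := Dims.P_le_N (Dims.nx_lt (d := d) 1 j).le
  have a3 := Dims.P_le_N (Dims.nx_lt (d := d) 2 j).le
  have a4 := Dims.m_le_N hj
  have a5 := Dims.m_le_N (Dims.nx_lt (d := d) 1 j)
  have a6 := Dims.m_le_N (Dims.nx_lt (d := d) 2 j)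
  rw [hD.P, hD.m, hD.g, hD.P', hD.m', hD.P'', hD.m'']
  refine ⟨?_, ?_, ?_, ?_, ?_, ?_, ?_⟩ <;> omega

theorem ladderProg_wp (hB : Big d w B) (hc : Ctx d G s) (hD : Dir d j g s) (hj : j < d.k)
    (hg : g ≤ 2 * d.N)
    {v : ℕ} (hv : v < d.N) (h17 : s.var 17 = v) {Q : State → Prop}
    (hQ : ∀ s', LadRegs (d.ladder j v) s' → Q s') : ladderProg.wp B Q s := by
  have hle := hB.le
  have h6 := d.six_le_N
  have hkN := d.k_lt_N
  obtain ⟨b7, b8, -, b10, b11, b12, b13⟩ := hD.bounds hB hj hg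
  have hk : s.var 0 ≤ B := by rw [hc.k]; omega
  have hk17 : s.var 17 ≤ B := by omega
  have h1B : 1 ≤ B := by omega
  have h2B : 2 ≤ B := by omega
  simp only [ladderProg, Prog.wp]
  unfold Dims.ladder at hQ
  have e0 : co0.nval s = d.x j v := by simp [co0, h17, hD.P, hD.m, Dims.x]
  have e1 : co1.nval s = d.x (d.nx 1 j) v := by simp [co1, h17, hD.P', hD.m', Dims.x]
  have b0 : co0.Bdd B s := ⟨⟨hk17, b7⟩, b8⟩
  have b1 : co1.Bdd B s := ⟨⟨hk17, b10⟩, b11⟩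
  have main : ∀ s' : State, (∀ x < 21, s'.var x = s.var x) →
      (up1.Bdd B s' ∧ up2.Bdd B s') ∧ up1.nval s' = d.up (d.nx 1 j) v ∧
        up2.nval s' = d.up (d.nx 2 j) v ∧ s'.var 7 = d.P j ∧ s'.var 10 = d.P (d.nx 1 j) ∧
        s'.var 12 = d.P (d.nx 2 j) ∧ s'.var 17 = v ∧ s'.var 7 ≤ B ∧ s'.var 10 ≤ B ∧ s'.var 12 ≤ B ∧
        s'.var 17 ≤ B := by
    intro s' h
    have f7 := h 7 (by norm_num)
    have f10 := h 10 (by norm_num)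
    have f11 := h 11 (by norm_num)
    have f12 := h 12 (by norm_num)
    have f13 := h 13 (by norm_num)
    have f17 := h 17 (by norm_num)
    have n1 : up1.nval s' = d.up (d.nx 1 j) v := by
      simp [up1, co1, f10, f11, f17, h17, hD.P', hD.m', Dims.up, Dims.x]; congr
    have n2 : up2.nval s' = d.up (d.nx 2 j) v := by
      simp [up2, co2, f12, f13, f17, h17, hD.P'', hD.m'', Dims.up, Dims.x]; congr
    refine ⟨⟨?_, ?_⟩, n1, n2, ?_⟩
    · simp [up1, co1, f10, f11, f17]; omega
    · simp [up2, co2, f12, f13, f17]; omega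
    · rw [f7, f10, f12, f17]
      exact ⟨hD.P, hD.P', hD.P'', h17, b7, b10, b12, hk17⟩
  simp only [Expr.bdd_lt, Expr.bdd_add, Expr.bdd_const, Expr.bdd_var, Expr.nval_lt_ne_zero,
    Expr.nval_lt_eq_zero, Expr.nval_const,
    Expr.nval_var, Expr.nval_add, e0, e1, b0, b1, hc.k, hD.m, hD.m']
  have b8' : d.m j ≤ B := hD.m ▸ b8
  have b11' : d.m (d.nx 1 j) ≤ B := hD.m' ▸ b11
  have hk' : d.k ≤ B := by omega
  refine ⟨⟨h2B, hk'⟩, fun c1 => ?_, fun c1 => ⟨⟨h2B, b8'⟩, fun c2 => ⟨⟨⟨trivial, h2B⟩, b8'⟩,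
    fun c3 => ?_, fun c3 => ?_⟩, fun c2 => ⟨⟨⟨trivial, h2B⟩, b11'⟩, fun c3 => ?_,
    fun c3 => ⟨⟨h1B, trivial⟩, fun c4 => ?_, fun c4 => ?_⟩⟩⟩⟩
  · rw [if_pos c1] at hQ
    refine setLad_wp (fun s' h _ => ?_) hQ
    obtain ⟨⟨m1, m2⟩, m3, m4, m5, m6, m7, m8, m9, m10, m11, m12⟩ := main s' h
    simp [m1, m2, m3, m4, m5, m6, m7, m8, m5 ▸ m9, m6 ▸ m10, m7 ▸ m11, m8 ▸ m12, h1B, h2B]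
  · rw [if_neg c1, if_pos c2, if_pos c3] at hQ
    refine setLad_wp (fun s' h _ => ?_) hQ
    obtain ⟨⟨m1, m2⟩, m3, m4, m5, m6, m7, m8, m9, m10, m11, m12⟩ := main s' h
    simp [m1, m3, m5, m6, m8, m5 ▸ m9, m6 ▸ m10, m8 ▸ m12, h1B, h2B]
  · rw [if_neg c1, if_pos c2, if_neg c3] at hQ
    refine setLad_wp (fun s' h _ => ?_) hQ
    obtain ⟨⟨m1, m2⟩, m3, m4, m5, m6, m7, m8, m9, m10, m11, m12⟩ := main s' h
    simp [m1, m3, m5, m6, m8, m5 ▸ m9, m6 ▸ m10, m8 ▸ m12, h1B]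
  · rw [if_neg c1, if_neg c2, if_pos c3] at hQ
    refine setLad_wp (fun s' h _ => ?_) hQ
    obtain ⟨⟨m1, m2⟩, m3, m4, m5, m6, m7, m8, m9, m10, m11, m12⟩ := main s' h
    simp [m5, m6, m8, m5 ▸ m9, m6 ▸ m10, m8 ▸ m12, h1B, h2B]
  · rw [if_neg c1, if_neg c2, if_neg c3, if_pos c4] at hQ
    refine setLad_wp (fun s' h _ => ?_) hQ
    obtain ⟨⟨m1, m2⟩, m3, m4, m5, m6, m7, m8, m9, m10, m11, m12⟩ := main s' h
    simp [m5, m6, m8, m5 ▸ m9, m6 ▸ m10, m8 ▸ m12, h1B, h2B]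
  · rw [if_neg c1, if_neg c2, if_neg c3, if_neg c4] at hQ
    refine setLad_wp (fun s' h _ => ?_) hQ
    obtain ⟨⟨m1, m2⟩, m3, m4, m5, m6, m7, m8, m9, m10, m11, m12⟩ := main s' h
    simp [m5, m6, m8, m5 ▸ m9, m6 ▸ m10, m8 ▸ m12, h2B]

end

theorem Dims.up_le {d : Dims} {l v : ℕ} : d.up l v ≤ 1 := by unfold Dims.up; split_ifs <;> omega

theorem Dims.ladder_le {d : Dims} {j v : ℕ} (hj : j < d.k) :
    (d.ladder j v).ad ≤ d.N ∧ (d.ladder j v).sb ≤ d.N := by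
  have h1 := P_le_N hj.le
  have h2 := P_le_N (nx_lt (d := d) 1 j).le
  have h3 : ∀ a ≤ 1, d.P (d.nx 1 j) * a ≤ d.N := fun a ha =>
    (Nat.mul_le_mul_left _ ha).trans (by omega)
  unfold ladder
  split_ifs <;> simp only [h1, h3, up_le, Nat.sub_le, Nat.zero_le, and_self]

/-- Apply one move to the ladder of the vertex in register `17`. -/
def blockProg : Prog :=
  ladderProg ;;
  .put 12 (.const 0) (.var 21) ;; .put 12 (.const 1) (.var 22) ;; .put 12 (.const 2) (.var 23) ;;
  .put 12 (.const 3) (.var 21 + .var 24 - .var 25) ;;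
  .put 12 (.const 4) (.var 22 + .var 24 - .var 25) ;;
  .put 12 (.const 5) (.var 23 + .var 24 - .var 25) ;;
  .for 27 (.const 6) (.put 5 (.get 12 (.var 27))
    (.get 6 (.get 12 (.get 13 ((.var 26 * .const 6 + .var 16 + .const 1) * .const 6 + .var 27)))))

/-- Whether the vertex in register `17` is flagged and belongs to the class in register `15`. -/
def selExpr : Expr :=
  .get 7 (.var 17) *
    .eqE (co0 % .const 5 + .const 5 * (co1 % .const 5) + .const 25 * (co2 % .const 5)) (.var 15)

/-- Apply one move to the ladders of all flagged vertices of a class. -/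
def applyProg : Prog := .for 17 (.var 1) (.ite selExpr blockProg .skip)

section
variable {d : Dims} {G X : ℕ → ℕ} {w B : ℕ} {s : State} {j g : ℕ}

/-- Robots are read from the saved array `6`, since a word refers to places before its first move;
thus writes to array `5` cannot disturb later reads. The places are distinct, so no write is undone.
-/
theorem blockProg_runs (hB : Big d w B) (hc : Ctx d G s) (hD : Dir d j g s) (hj : j < d.k)
    (hg : g ≤ 2 * d.N) {v : ℕ} (hv : v < d.N) (hx : d.x j v + 1 < d.m j) (h17 : s.var 17 = v)
    {O₀ : ℕ → ℕ} (hO₀ : ∀ u < d.N, O₀ u < d.N) (h6 : ∀ u < d.N, s.arr 6 u = O₀ u) {τ : ℕ}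
    (hτ : τ < 5) (h16 : s.var 16 = τ) :
    Runs w blockProg s 500 fun s' =>
      (∀ q < 6, s'.arr 5 ((d.ladder j v).code q) =
        O₀ ((d.ladder j v).code (word (d.ladder j v).ty (τ + 1) q))) ∧
      ∀ u, (∀ q < 6, (d.ladder j v).code q ≠ u) → s'.arr 5 u = s.arr 5 u := by
  have hle := hB.le
  have hN := d.six_le_N
  have hb := Dims.ladder_block hj hv hx
  obtain ⟨had, hsb⟩ := Dims.ladder_le (d := d) (v := v) hj
  set L := d.ladder j v with hL
  have hp0 : L.p0 < d.N := hb.lt 0 (by norm_num)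
  have hp1 : L.p1 < d.N := hb.lt 1 (by norm_num)
  have hp2 : L.p2 < d.N := hb.lt 2 (by norm_num)
  refine (Runs.seq (t₂ := 250) (Prog.runs_of_wp hB.room (by decide)
    (ladderProg_wp hB hc hD hj hg hv h17 (Q := LadRegs L) fun _ h => h)) ?_).mono (by decide)
    fun _ _ h => h
  intro s₁ hf₁ hR
  have a6₁ := hf₁.arr 6 (by decide)
  have a5₁ := hf₁.arr 5 (by decide)
  have hc₁ := hc.frame hf₁ (by decide)
  have v16₁ := hf₁.var 16 (by decide)
  rw [← a5₁]
  rw [← a6₁] at h6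
  rw [← v16₁] at h16
  clear hf₁ a6₁ a5₁ v16₁ h17 hD hc
  suffices hs : ∀ s₂ : State, (∀ q < 6, s₂.arr 12 q = L.code q) → s₂.arr 5 = s₁.arr 5 →
      s₂.arr 6 = s₁.arr 6 → s₂.arr 13 = s₁.arr 13 → s₂.var = s₁.var →
      Runs w (.for 27 (.const 6) (.put 5 (.get 12 (.var 27)) (.get 6 (.get 12 (.get 13
        ((.var 26 * .const 6 + .var 16 + .const 1) * .const 6 + .var 27)))))) s₂ 200 fun s' =>
      (∀ q < 6, s'.arr 5 (L.code q) = O₀ (L.code (word L.ty (τ + 1) q))) ∧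
      ∀ u, (∀ q < 6, L.code q ≠ u) → s'.arr 5 u = s₁.arr 5 u by
    have h0 : ∀ x i, ∀ s : State, ∀ R, ∀ p : Prog, ∀ e : Expr, e.Bdd B s → e.cost ≤ 5 →
        i ≤ B → e.size ≤ 5 → ∀ t, Runs w p (s.setArr x i (e.nval s)) t R →
        Runs w (.put x (.const i) e ;; p) s (t + 7) R := by
      intro x i s R p e h1 h2 h3 h4 t h
      obtain ⟨s', t', h5, h6, h7⟩ := Prog.runs_of_wp hB.room (p := .put x (.const i) e) (s := s)
        (Q := fun s' => s' = s.setArr x i (e.nval s))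
        (by simp [Prog.small, Expr.size]; omega) ⟨h3, h1, rfl⟩
      subst h7
      obtain ⟨s'', t'', h8, h9, h10⟩ := h
      simp only [Prog.cost, Expr.cost] at h6
      exact ⟨s'', _, .seq h5 h8, by omega, h10⟩
    have e0 := hR.p0
    have e1 := hR.p1
    have e2 := hR.p2
    have e3 := hR.ad
    have e4 := hR.sb
    refine Runs.mono (t := 200 + 7 + 7 + 7 + 7 + 7 + 7) ?_ (by norm_num) fun _ _ h => h
    apply h0 <;> [skip; decide; omega; decide; skip]
    · simp; omega
    apply h0 <;> [skip; decide; omega; decide; skip]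
    · simp; omega
    apply h0 <;> [skip; decide; omega; decide; skip]
    · simp; omega
    apply h0 <;> [skip; decide; omega; decide; skip]
    · simp; omega
    apply h0 <;> [skip; decide; omega; decide; skip]
    · simp; omega
    apply h0 <;> [skip; decide; omega; decide; skip]
    · simp; omega
    apply hs <;> try rfl
    intro q hq
    interval_cases q <;> simp [Lad.code, Lad.path, e0, e1, e2, e3, e4]
  intro s₂ h12 e5 e6 e13 ev
  have ht := hb.t_lt
  refine (Runs.for_const hB.room (n := 6) (c := 19)
    (fun n s' => (∀ q < n, s'.arr 5 (L.code q) = O₀ (L.code (word L.ty (τ + 1) q))) ∧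
      ∀ u, (∀ q < n, L.code q ≠ u) → s'.arr 5 u = s₁.arr 5 u) (by decide) (by decide)
      (by omega) ?_ ?_ ?_ ?_).mono (by decide) fun _ _ h => h
  · intro s' _; simp; omega
  · exact ⟨by simp, fun u _ => by rw [← e5]; rfl⟩
  · rintro n hn s' hf ⟨h1, h2⟩ hv
    have a6 := hf.arr 6 (by decide)
    have a12 := hf.arr 12 (by decide)
    have a13 := hf.arr 13 (by decide)
    have b16 := hf.var 16 (by decide)
    have b26 := hf.var 26 (by decide)
    rw [e6] at a6
    rw [e13] at a13
    rw [ev, h16] at b16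
    rw [ev, hR.ty] at b26
    have hidx : (L.ty * 6 + τ + 1) * 6 + n < 108 := by omega
    have hw : wordTab.getD ((L.ty * 6 + τ + 1) * 6 + n) 0 = word L.ty (τ + 1) n := rfl
    have hwl := word_lt L.ty ht (τ + 1) (by omega) n hn
    have hcl := hb.lt _ hwl
    have hcn := hb.lt _ hn
    have hO := hO₀ _ hcl
    refine (Prog.runs_of_wp hB.room (by decide) ?_).mono (by decide) fun _ _ h => h
    simp only [Prog.wp, Expr.bdd_add, Expr.bdd_mul, Expr.bdd_var, Expr.bdd_get, Expr.nval_add,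
      Expr.bdd_const, Expr.nval_const,
      Expr.nval_mul, Expr.nval_var, Expr.nval_get, a6, a12, a13, b16, b26, hv, State.setVar_arr,
      State.setArr_arr, if_true, h12 n hn, hc₁.tab _ hidx, hw, h12 _ hwl, h6 _ hcl]
    refine ⟨by omega, by omega, fun q hq => ?_, fun u hu => ?_⟩
    · rw [Function.update_apply]
      split_ifs with h
      · rw [hb.inj _ (by omega) _ hn h]
      · refine h1 q (Nat.lt_of_le_of_ne (by omega) ?_)
        rintro rfl; exact h rfl
    · rw [Function.update_apply, if_neg (fun e => hu n (by omega) e.symm)]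
      exact h2 u fun q hq => hu q (by omega)
  · exact fun s' _ h => h

theorem selExpr_spec (hB : Big d w B) (hD : Dir d j g s) (hj : j < d.k)
    (hg : g ≤ 2 * d.N) {v : ℕ} (hv : v < d.N) (h17 : s.var 17 = v) {F : ℕ → Prop} [DecidablePred F]
    (h7 : s.arr 7 v = if F v then 1 else 0) {q : ℕ} (hq : q ≤ B) (h15 : s.var 15 = q) :
    selExpr.Bdd B s ∧ (selExpr.nval s ≠ 0 ↔ F v ∧ d.cls j (d.nx 1 j) (d.nx 2 j) v = q) := by
  have hle := hB.le
  have h6 := d.six_le_N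
  obtain ⟨b7, b8, -, b10, b11, b12, b13⟩ := hD.bounds hB hj hg
  constructor
  · have : s.arr 7 v ≤ B := by rw [h7]; split_ifs <;> omega
    simp [selExpr, co0, co1, co2, *]
    omega
  · simp [selExpr, co0, co1, co2, h17, h15, h7, hD.P, hD.m, hD.P', hD.m', hD.P'', hD.m'',
      Dims.cls, Dims.x]
    exact and_comm

/-- The vertices whose ladders are used in a pass. -/
def Sel (d : Dims) (j : ℕ) (F : ℕ → Prop) (q v : ℕ) : Prop :=
  v < d.N ∧ F v ∧ d.cls j (d.nx 1 j) (d.nx 2 j) v = q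

instance (F : ℕ → Prop) [DecidablePred F] (q : ℕ) : DecidablePred (Sel d j F q) := fun v => by
  unfold Sel; infer_instance

theorem Sel.blocks (hj : j < d.k) {F : ℕ → Prop} (hF : ∀ v < d.N, F v → d.x j v + 1 < d.m j)
    (q : ℕ) : d.Blocks j (d.nx 1 j) (d.nx 2 j) (Sel d j F q) (fun v => (d.ladder j v).code)
      fun v => (d.ladder j v).ty where
  block v hv := Dims.ladder_block hj hv.1 (hF v hv.1 hv.2.1)
  disj _ _ _ _ hu hv ha hb h := (Dims.ladder_block hj hu.1 (hF _ hu.1 hu.2.1)).disjoint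
    (Dims.ladder_block hj hv.1 (hF _ hv.1 hv.2.1)) hu.1 hv.1 (hu.2.2.trans hv.2.2.symm) ha hb h

/-- The selected ladders are disjoint, so treating one of them leaves the others as they are, and
one scan over the vertices performs the move on all of them. -/
theorem applyProg_runs (hB : Big d w B) (hc : Ctx d G s) (hD : Dir d j g s) (hj : j < d.k)
    (hg : g ≤ 2 * d.N) {F : ℕ → Prop} [DecidablePred F]
    (hF : ∀ v < d.N, F v → d.x j v + 1 < d.m j)
    (h7 : ∀ v < d.N, s.arr 7 v = if F v then 1 else 0) {q : ℕ} (hq : q ≤ B) (h15 : s.var 15 = q)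
    {O₀ : ℕ → ℕ} (hO₀ : ∀ u < d.N, O₀ u < d.N) (h6 : ∀ u < d.N, s.arr 6 u = O₀ u) {τ : ℕ}
    (hτ : τ < 5) (h16 : s.var 16 = τ)
    (hA : d.AfterMoves (Sel d j F q) (fun v => (d.ladder j v).code)
      (fun v => (d.ladder j v).ty) O₀ τ (s.arr 5)) :
    Runs w applyProg s ((d.N + 1) * 600) fun s' =>
      d.AfterMoves (Sel d j F q) (fun v => (d.ladder j v).code)
        (fun v => (d.ladder j v).ty) O₀ (τ + 1) (s'.arr 5) := by
  have hle := hB.le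
  have hN := d.six_le_N
  have hbl := Sel.blocks hj hF q
  refine (Runs.for_const hB.room (n := d.N) (c := 560)
    (fun n s' => (∀ v < n, Sel d j F q v → ∀ q < 6, s'.arr 5 ((d.ladder j v).code q) =
        O₀ ((d.ladder j v).code (word (d.ladder j v).ty (τ + 1) q))) ∧
      ∀ u, (∀ v < n, Sel d j F q v → ∀ q < 6, (d.ladder j v).code q ≠ u) →
        s'.arr 5 u = s.arr 5 u) (by decide) (by decide) (by omega) ?_ ?_ ?_ ?_).mono
          (by simp [Expr.cost]) fun _ _ h => h
  · intro s' hf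
    have := (hc.frame hf (by decide)).N
    simp [this]; omega
  · exact ⟨by simp, fun _ _ => rfl⟩
  · rintro n hn s' hf ⟨h1, h2⟩ hv
    have hc' := hc.frame hf (by decide)
    have hD' := hD.frame hf (by decide)
    have e6 := hf.arr 6 (by decide)
    have e7 := hf.arr 7 (by decide)
    obtain ⟨hs1, hs2⟩ := selExpr_spec (F := F) hB hD' hj hg hn hv (by rw [e7]; exact h7 n hn) hq
      ((hf.var 15 (by decide)).trans h15)
    refine (Runs.ite hB.room (t := 500) (by decide) hs1 (fun h => ?_) fun h => ?_).mono (by decide)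
      fun _ _ h => h
    · have hS : Sel d j F q n := ⟨hn, hs2.1 h⟩
      refine (blockProg_runs hB hc' hD' hj hg hn (hF n hn hS.2.1) hv hO₀ (by rwa [e6]) hτ
        ((hf.var 16 (by decide)).trans h16)).mono le_rfl ?_
      rintro s'' - ⟨h3, h4⟩
      constructor
      · intro v hv hSv
        rcases Nat.lt_or_ge v n with h | h
        · intro a ha
          simp only [State.setVar_arr]
          rw [h4 _ fun b hb e => h.ne' (hbl.disj _ _ _ _ hS hSv hb ha e)]
          exact h1 v h hSv a ha
        · obtain rfl : v = n := by omega
          exact h3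
      · intro u hu
        simp only [State.setVar_arr]
        rw [h4 u (hu n (by omega) hS)]
        exact h2 u fun v hv => hu v (by omega)
    · have hS : ¬ Sel d j F q n := fun hS => hs2.2 hS.2 h
      refine ⟨s', 1, .skip s', by norm_num, fun v hv hSv => ?_, fun u hu => ?_⟩
      · rcases Nat.lt_or_ge v n with h | h
        · exact h1 v h hSv
        · obtain rfl : v = n := by omega
          exact absurd hSv hS
      · exact h2 u fun v hv => hu v (by omega)
  · rintro s' - ⟨h1, h2⟩
    refine ⟨fun v hv => h1 v hv.1 hv, fun u hu h => ?_⟩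
    rw [h2 u fun v _ => h v]
    exact hA.2 u hu h

end

/-! ### Rounds of odd-even transposition -/

/-- Flagged pairs do not overlap, so exchanging them class by class has the same effect as
exchanging all at once. This joins the 125 passes of a round. -/
theorem swp_union {A : ℕ} {F F₁ F₂ : ℕ → Prop} [DecidablePred F] [DecidablePred F₁]
    [DecidablePred F₂] (h : ∀ v, F v ↔ F₁ v ∨ F₂ v) (hd : ∀ v, F v → ¬ F (v + A))
    (hn : ∀ v, F₁ v → ¬ F₂ v) (u : ℕ) : swp A F₁ (swp A F₂ u) = swp A F u := by
  by_cases h2 : F₂ u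
  · have e : swp A F₂ u = u + A := if_pos h2
    have h3 : ¬ F₁ (u + A) := fun h' => hd u ((h u).2 (Or.inr h2)) ((h _).2 (Or.inl h'))
    have h4 : ¬ F₁ u := fun h' => hn u h' h2
    rw [e]
    simp [swp, h3, h4, (h u).2 (Or.inr h2)]
  · by_cases h5 : A ≤ u ∧ F₂ (u - A)
    · have e : swp A F₂ u = u - A := by rw [swp, if_neg h2, if_pos h5]
      have h6 : F (u - A) := (h _).2 (Or.inr h5.2)
      have h3 : ¬ F₁ (u - A) := fun h' => hn _ h' h5.2
      have h4 : ¬ (A ≤ u - A ∧ F₁ (u - A - A)) := fun h' => by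
        have := hd _ ((h _).2 (Or.inl h'.2))
        rw [Nat.sub_add_cancel h'.1] at this
        exact this h6
      have h7 : ¬ F u := by
        have := hd _ h6
        rwa [Nat.sub_add_cancel h5.1] at this
      rw [e, swp, if_neg h3, if_neg h4, swp, if_neg h7, if_pos ⟨h5.1, h6⟩]
    · have e : swp A F₂ u = u := by rw [swp, if_neg h2, if_neg h5]
      rw [e]
      have h8 : (A ≤ u ∧ F (u - A)) ↔ (A ≤ u ∧ F₁ (u - A)) := by
        rw [h (u - A)]; tauto
      simp only [swp, h u, h2, h8, or_false]

theorem swp_congr {A N : ℕ} {F F' : ℕ → Prop} [DecidablePred F] [DecidablePred F']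
    (h : ∀ v < N, F v ↔ F' v) {u : ℕ} (hu : u < N) : swp A F u = swp A F' u := by
  simp only [swp, h u hu, h (u - A) (by omega)]

theorem swp_lt {d : Dims} {j : ℕ} {F : ℕ → Prop} [DecidablePred F] (hj : j < d.k)
    (hF : ∀ v < d.N, F v → d.x j v + 1 < d.m j) {u : ℕ} (hu : u < d.N) :
    swp (d.P j) F u < d.N := by
  unfold swp
  split_ifs with h
  · rw [← Dims.setc_succ]; exact Dims.setc_lt hj hu (hF u hu h)
  · omega
  · exact hu

/-- Save the current configuration. -/
def saveProg : Prog := .for 17 (.var 1) (.put 6 (.var 17) (.get 5 (.var 17)))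

/-- Exchange the flagged pairs of the class in register `15`. -/
def passProg : Prog := saveProg ;; .for 16 (.const 5) (applyProg ;; record)

/-- Exchange all flagged pairs. -/
def passesProg : Prog := .for 15 (.const 125) passProg

/-- Whether to compare the vertex in register `17` with the next one in round `14`. -/
def cmpExpr : Expr :=
  .eqE (co0 % .var 9 % .const 2) (.var 14 % .const 2) * .ltE (co0 % .var 9 + .const 1) (.var 9) *
    .ltE (co0 + .const 1) (.var 8)

/-- Flag the pairs to be exchanged in a round. -/
def flagProg : Prog :=
  .for 17 (.var 1) (.put 7 (.var 17) (.const 0) ;;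
    .ite cmpExpr (.put 7 (.var 17)
      (.ltE (.get 8 (.get 5 (.var 17 + .var 7))) (.get 8 (.get 5 (.var 17))))) .skip)

/-- A round of odd-even transposition. -/
def roundProg : Prog := flagProg ;; passesProg

/-- Odd-even transposition on boxes of width at most `2 h`, where `h` is in register `3`. -/
def roundsProg : Prog := .for 14 (.const 4 * .var 3) roundProg

section
variable {d : Dims} {G X : ℕ → ℕ} {w B : ℕ} {s : State} {j g : ℕ}

theorem saveProg_runs (hB : Big d w B) (hc : Ctx d G s) (hO : BijLt d.N (s.arr 5)) :
    Runs w saveProg s ((d.N + 1) * 12) fun s' => ∀ v < d.N, s'.arr 6 v = s.arr 5 v := by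
  have hle := hB.le
  have h6 := d.six_le_N
  refine (Runs.for_const hB.room (n := d.N) (c := 4)
    (fun n s' => ∀ v < n, s'.arr 6 v = s.arr 5 v) (by decide) (by decide) (by omega) ?_ ?_ ?_
    ?_).mono (by simp [Expr.cost]) fun _ _ h => h
  · intro s' hf
    have := (hc.frame hf (by decide)).N
    simp [this]; omega
  · simp
  · intro n hn s' hf h1 hv
    have e5 := hf.arr 5 (by decide)
    have := hO.1 n hn
    refine (Prog.runs_of_wp hB.room (by decide) ?_).mono (by decide) fun _ _ h => h
    simp only [Prog.wp, Expr.bdd_var, Expr.bdd_get, Expr.nval_var, Expr.nval_get, e5, hv,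
      State.setVar_arr, State.setArr_arr, if_true]
    refine ⟨by omega, by omega, fun v hv => ?_⟩
    rw [Function.update_apply]
    split_ifs with h
    · rw [h]
    · exact h1 v (by omega)
  · exact fun s' _ h => h

theorem passProg_runs (hB : Big d w B) (hc : Ctx d G s) (hD : Dir d j g s) (hj : j < d.k)
    (hg : g ≤ 2 * d.N) {F : ℕ → Prop} [DecidablePred F]
    (hF : ∀ v < d.N, F v → d.x j v + 1 < d.m j)
    (h7 : ∀ v < d.N, s.arr 7 v = if F v then 1 else 0) {q : ℕ} (hq : q ≤ B) (h15 : s.var 15 = q)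
    (hC : Cfg d X (s.arr 5) s) (hT : s.var 2 + 5 ≤ B) :
    Runs w passProg s ((d.N + 1) * 4000) fun s' =>
      (∀ v < d.N, s'.arr 5 v = s.arr 5 (swp (d.P j) (Sel d j F q) v)) ∧
        Cfg d X (s'.arr 5) s' ∧ s'.var 2 = s.var 2 + 5 := by
  have hle := hB.le
  have hN := d.six_le_N
  have hbl := Sel.blocks hj hF q
  refine (Runs.seq (t₂ := (d.N + 1) * 3900) (saveProg_runs hB hc hC.bij) ?_).mono (by omega)
    fun _ _ h => h
  intro s₁ hf₁ h6
  have e5 := hf₁.arr 5 (by decide)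
  have e7 := hf₁.arr 7 (by decide)
  have hc₁ := hc.frame hf₁ (by decide)
  have hD₁ := hD.frame hf₁ (by decide)
  have e2 := hf₁.var 2 (by decide)
  have hC₁ := hC.frame hf₁ (by decide)
  have e15 := hf₁.var 15 (by decide)
  refine (Runs.for_const hB.room (n := 5) (c := (d.N + 1) * 624)
    (fun n s' => d.AfterMoves (Sel d j F q) (fun v => (d.ladder j v).code)
        (fun v => (d.ladder j v).ty) (s.arr 5) n (s'.arr 5) ∧
      Cfg d X (s'.arr 5) s' ∧ s'.var 2 = s.var 2 + n) (by decide) (by decide)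
    (by omega) ?_ ?_ ?_ ?_).mono (by simp [Expr.cost]; omega) fun _ _ h => h
  · intro s' _; simp; omega
  · refine ⟨?_, ?_, by simp [e2]⟩
    · simp only [State.setVar_arr, e5]; exact .zero hbl
    · simp only [State.setVar_arr, e5]; exact hC₁.setVar (by decide)
  · rintro n hn s₂ hf₂ ⟨h1, h2, h3⟩ hv
    have hc₂ := hc₁.frame hf₂ (by decide)
    refine (Runs.seq (t₁ := (d.N + 1) * 600) (t₂ := (d.N + 1) * 24) (applyProg_runs hB hc₂
      (hD₁.frame hf₂ (by decide)) hj hg hF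
      (by rwa [hf₂.arr 7 (by decide), e7]) hq (by rwa [hf₂.var 15 (by decide), e15]) hC.bij.1
      (by rwa [hf₂.arr 6 (by decide)]) hn hv h1) ?_).mono (by omega) fun _ _ h => h
    intro s₃ hf₃ h4
    have e2 := hf₃.var 2 (by decide)
    refine (record_runs hB (hc₂.frame hf₃ (by decide)) (h2.frame hf₃ (by decide))
      (h4.bijLt hbl hC.bij (by omega)) (h1.move hbl hC.bij hn h4) (by omega)).mono le_rfl ?_
    rintro s₄ hf₄ ⟨h5, h6⟩
    have e5 := hf₄.arr 5 (by decide)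
    simp only [State.setVar_arr]
    rw [e5]
    refine ⟨h4, h5.setVar (by decide), ?_⟩
    simp [h6, e2, h3]; omega
  · rintro s' - ⟨h1, h2, h3⟩
    exact ⟨fun v hv => h1.five hbl hv, h2, h3⟩

theorem passesProg_runs (hB : Big d w B) (hc : Ctx d G s) (hD : Dir d j g s) (hj : j < d.k)
    (hg : g ≤ 2 * d.N) {F : ℕ → Prop} [DecidablePred F]
    (hF : ∀ v < d.N, F v → d.x j v + 1 < d.m j) (hF' : ∀ v < d.N, F v → ¬ F (v + d.P j))
    (h7 : ∀ v < d.N, s.arr 7 v = if F v then 1 else 0)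
    (hC : Cfg d X (s.arr 5) s) (hT : s.var 2 + 625 ≤ B) :
    Runs w passesProg s ((d.N + 1) * 506000) fun s' =>
      (∀ v < d.N, s'.arr 5 v = s.arr 5 (swp (d.P j) F v)) ∧
        Cfg d X (s'.arr 5) s' ∧ s'.var 2 = s.var 2 + 625 := by
  have hle := hB.le
  have hN := d.six_le_N
  -- After `n` passes the flagged pairs of the classes below `n` are exchanged. The flags were
  -- stored before the first pass, so they do not react to the changing configuration.
  refine (Runs.for_const hB.room (n := 125) (c := (d.N + 1) * 4000)
    (fun n s' => (∀ v < d.N, s'.arr 5 v = s.arr 5 (swp (d.P j)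
        (fun v => v < d.N ∧ F v ∧ d.cls j (d.nx 1 j) (d.nx 2 j) v < n) v)) ∧
      Cfg d X (s'.arr 5) s' ∧ s'.var 2 = s.var 2 + 5 * n) (by decide) (by decide)
    (by omega) ?_ ?_ ?_ ?_).mono (by simp [Expr.cost]; omega) fun _ _ h => h
  · intro s' _; simp; omega
  · exact ⟨fun v _ => by simp [swp], hC.setVar (by decide), by simp⟩
  · rintro n hn s₁ hf₁ ⟨h1, h2, h3⟩ hv
    refine (passProg_runs hB (hc.frame hf₁ (by decide)) (hD.frame hf₁ (by decide)) hj hg hF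
      (by rwa [hf₁.arr 7 (by decide)]) (by omega) hv h2 (by omega)).mono le_rfl ?_
    rintro s₂ - ⟨h4, h5, h6⟩
    refine ⟨fun v hv => ?_, h5.setVar (by decide), by simp [h6, h3]; omega⟩
    simp only [State.setVar_arr]
    rw [h4 v hv, h1 _ (swp_lt hj (fun v _ h => hF v h.1 h.2.1) hv)]
    congr 1
    refine swp_union (fun v => ?_) (fun v h h' => hF' v h.1 h.2.1 h'.2.1) (fun v h h' => ?_) v
    · unfold Sel; rw [Nat.lt_succ_iff_lt_or_eq]; tauto
    · have := h.2.2; have := h'.2.2; omega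
  · rintro s' - ⟨h1, h2, h3⟩
    refine ⟨fun v hv => ?_, h2, h3⟩
    rw [h1 v hv, swp_congr (F' := F) (fun v hv => ?_) hv]
    have := Dims.cls_lt (d := d) j (d.nx 1 j) (d.nx 2 j) v
    tauto

theorem cmpExpr_spec (hB : Big d w B) (hD : Dir d j g s) (hj : j < d.k)
    (hg : g ≤ 2 * d.N) {v ρ : ℕ} (hv : v < d.N) (h17 : s.var 17 = v) (hρ : ρ ≤ B)
    (h14 : s.var 14 = ρ) : cmpExpr.Bdd B s ∧ (cmpExpr.nval s ≠ 0 ↔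
      d.x j v % g % 2 = ρ % 2 ∧ d.x j v % g + 1 < g ∧ d.x j v + 1 < d.m j) := by
  have hle := hB.le
  have h6 := d.six_le_N
  obtain ⟨b7, b8, b9, -⟩ := hD.bounds hB hj hg
  constructor
  · simp [cmpExpr, co0, *]
    omega
  · simp [cmpExpr, co0, h17, h14, hD.P, hD.m, hD.g, Dims.x]
    tauto

theorem flagProg_runs (hB : Big d w B) (hc : Ctx d G s) (hD : Dir d j g s) (hj : j < d.k)
    (hg : g ≤ 2 * d.N) {ρ : ℕ} (hρ : ρ ≤ B) (h14 : s.var 14 = ρ)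
    (hO : BijLt d.N (s.arr 5)) (ht : ∀ r < d.N, s.arr 8 r ≤ B) :
    Runs w flagProg s ((d.N + 1) * 100) fun s' =>
      ∀ v < d.N, s'.arr 7 v = if d.Flag j g ρ (s.arr 8) (s.arr 5) v then 1 else 0 := by
  have hle := hB.le
  have h6 := d.six_le_N
  refine (Runs.for_const hB.room (n := d.N) (c := 60)
    (fun n s' => ∀ v < n, s'.arr 7 v = if d.Flag j g ρ (s.arr 8) (s.arr 5) v then 1 else 0)
    (by decide) (by decide) (by omega) ?_ ?_ ?_ ?_).mono (by simp [Expr.cost])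
    fun _ _ h => h
  · intro s' hf
    have := (hc.frame hf (by decide)).N
    simp [this]; omega
  · simp
  · intro n hn s' hf h1 hv
    have e5 := hf.arr 5 (by decide)
    have e8 := hf.arr 8 (by decide)
    have hD' := hD.frame hf (by decide)
    have e14 := hf.var 14 (by decide)
    have hOn := hO.1 n hn
    obtain ⟨c1, c2⟩ := cmpExpr_spec (s := s'.setArr 7 n 0) hB
      ⟨hD'.P, hD'.m, hD'.g, hD'.P', hD'.m', hD'.P'', hD'.m''⟩ hj hg hn hv hρ (e14.trans h14)
    refine (Prog.runs_of_wp hB.room (by decide) ?_).mono (by decide) fun _ _ h => h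
    simp only [Prog.wp, Expr.bdd_const, Expr.nval_const, Expr.bdd_var, Expr.nval_var, hv]
    refine ⟨by omega, by omega, c1, fun h => ?_, fun h => ?_⟩
    · have h := c2.1 h
      have hlt := (Dims.add_P_of_flag hj hn h.2.1 h.2.2).1
      have b1 := ht _ hOn
      have b2 := ht _ (hO.1 _ hlt)
      have b3 := hO.1 _ hlt
      simp only [Expr.bdd_lt, Expr.bdd_add, Expr.bdd_var, Expr.bdd_get, Expr.nval_add,
        Expr.nval_lt, Expr.nval_var, Expr.nval_get, State.setVar_arr, State.setArr_var,
        State.setArr_arr, if_true, hv, hD'.P, if_neg (show ¬ 8 = 7 by decide),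
        if_neg (show ¬ 5 = 7 by decide), e5, e8]
      refine ⟨by omega, by omega, fun v hv => ?_⟩
      rw [Function.update_apply]
      split_ifs with e h2 h3 h3
      · rfl
      · exact absurd (e ▸ ⟨h.1, h.2.1, h.2.2, h2⟩) h3
      · exact absurd (e ▸ h3).2.2.2 h2
      · rfl
      all_goals
        rw [Function.update_apply, if_neg e]
        simpa [*] using h1 v (by omega)
    · have h : ¬ _ := fun h' => c2.2 h' h
      intro v hv
      simp only [State.setVar_arr, State.setArr_arr, if_true]
      rw [Function.update_apply]
      split_ifs with e h3
      · exact absurd (e ▸ ⟨h3.1, h3.2.1, h3.2.2.1⟩) h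
      · rfl
      all_goals simpa [*] using h1 v (by omega)
  · exact fun s' _ h => h

theorem roundProg_runs (hB : Big d w B) (hc : Ctx d G s) (hD : Dir d j g s) (hj : j < d.k)
    (hg : g ≤ 2 * d.N) {ρ : ℕ} (hρ : ρ ≤ B) (h14 : s.var 14 = ρ)
    (ht : ∀ r < d.N, s.arr 8 r ≤ B)
    (hC : Cfg d X (s.arr 5) s) (hT : s.var 2 + 625 ≤ B) :
    Runs w roundProg s ((d.N + 1) * 507000) fun s' =>
      (∀ v < d.N, s'.arr 5 v =
        s.arr 5 (swp (d.P j) (d.Flag j g ρ (s.arr 8) (s.arr 5)) v)) ∧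
        Cfg d X (s'.arr 5) s' ∧ s'.var 2 = s.var 2 + 625 := by
  refine (Runs.seq (t₂ := (d.N + 1) * 506000)
    (flagProg_runs hB hc hD hj hg hρ h14 hC.bij ht) ?_).mono (by omega) fun _ _ h => h
  intro s₁ hf h7
  have e5 := hf.arr 5 (by decide)
  have e2 := hf.var 2 (by decide)
  refine (passesProg_runs hB (hc.frame hf (by decide)) (hD.frame hf (by decide)) hj hg
    (fun v _ h => h.2.2.1) (fun v hv h h' => ?_) h7 (by rw [e5]; exact hC.frame hf (by decide))
    (by rwa [e2])).mono le_rfl ?_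
  · have h1 := (Dims.add_P_of_flag hj hv h.2.1 h.2.2.1).2.2.1
    have := h.1
    have := h'.1
    omega
  · rw [e5, e2]; exact fun _ _ h => h

/-- The rounds move every robot to its target offset. -/
theorem roundsProg_runs (hB : Big d w B) (hc : Ctx d G s) (hD : Dir d j g s) (hj : j < d.k)
    (hg : g ≤ 2 * d.N) (hg0 : 0 < g) {h : ℕ} (hh : s.var 3 = h) (hgh : g ≤ 2 * h) (hhN : h ≤ d.N)
    (hlt : ∀ v < d.N, s.arr 8 (s.arr 5 v) < d.len j g v)
    (hinj : ∀ u < d.N, ∀ v < d.N, d.SameLine j g u v →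
      s.arr 8 (s.arr 5 u) = s.arr 8 (s.arr 5 v) → u = v)
    (hC : Cfg d X (s.arr 5) s) (hT : s.var 2 + 2500 * h ≤ B) :
    Runs w roundsProg s ((4 * h + 1) * ((d.N + 1) * 507100)) fun s' =>
      (∀ v < d.N, s.arr 8 (s'.arr 5 v) = d.x j v % g ∧
        ∃ u < d.N, s'.arr 5 v = s.arr 5 u ∧ d.SameLine j g u v) ∧
        Cfg d X (s'.arr 5) s' ∧ s'.var 2 = s.var 2 + 2500 * h := by
  have hle := hB.le
  have hN := d.six_le_N
  have ht : ∀ r < d.N, s.arr 8 r ≤ B := fun r hr => by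
    obtain ⟨v, hv, rfl⟩ := hC.bij.surj hr
    have := hlt v hv
    have := Dims.lt_of_lt_len this
    omega
  -- The invariant carries the history `O` of all rounds, because `Dims.routed` speaks about the
  -- whole sequence. The number of rounds suffices since `2 g ≤ 4 h`.
  refine (Runs.for_const hB.room (n := 4 * h) (c := (d.N + 1) * 507000)
    (fun n s' => (∃ O : ℕ → ℕ → ℕ, O 0 = s.arr 5 ∧ O n = s'.arr 5 ∧ ∀ t < n, ∀ v < d.N,
        O (t + 1) v = O t (swp (d.P j) (d.Flag j g t (s.arr 8) (O t)) v)) ∧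
      Cfg d X (s'.arr 5) s' ∧ s'.var 2 = s.var 2 + 625 * n) (by decide) (by decide)
    (by omega) ?_ ?_ ?_ ?_).mono
      (Nat.mul_le_mul_left _ (by simp [Expr.cost]; omega)) fun _ _ h => h
  · intro s' hf
    have := hf.var 3 (by decide)
    simp [this, hh]; omega
  · exact ⟨⟨fun _ => s.arr 5, rfl, rfl, by simp⟩, hC.setVar (by decide), by simp⟩
  · rintro n hn s₁ hf₁ ⟨⟨O, h1, h2, h3⟩, h4, h5⟩ hv
    have e8 := hf₁.arr 8 (by decide)
    refine (roundProg_runs hB (hc.frame hf₁ (by decide)) (hD.frame hf₁ (by decide)) hj hg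
      (by omega) hv (by rwa [e8]) h4 (by omega)).mono le_rfl ?_
    rintro s₂ - ⟨h6, h7, h8⟩
    refine ⟨⟨fun t => if t ≤ n then O t else s₂.arr 5, by simp [h1], by simp, fun t ht v hu => ?_⟩,
      h7.setVar (by decide), by simp [h8, h5]; omega⟩
    simp only [if_pos (show t ≤ n by omega)]
    split_ifs with h
    · exact h3 t (by omega) v hu
    · obtain rfl : t = n := by omega
      rw [h6 v hu, h2, e8]
  · rintro s' - ⟨⟨O, h1, h2, h3⟩, h4, h5⟩
    have := (Dims.routed hj hg0 (O := O) (tgt := s.arr 8) (n := 4 * h) (h1 ▸ hC.bij) h3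
      (by rwa [h1]) (by rwa [h1]) (by omega)).2
    rw [h1, h2] at this
    exact ⟨this, h4, by omega⟩

end

/-! ### Computing the targets -/

/-- The width of the boxes in direction `l` when direction `i` is to be cut into boxes of
width `h`. -/
def wid (h i l : ℕ) : ℕ := h * (2 - if l < i then 1 else 0)

/-- The registers that describe the current cut. -/
structure Cut (d : Dims) (i h : ℕ) (s : State) : Prop where
  width : s.var 3 = h
  dir : s.var 4 = i
  P : s.var 19 = d.P i
  m : s.var 20 = d.m i

theorem Cut.frame {d : Dims} {i h : ℕ} {s s' : State} {p : Prog} (hS : Cut d i h s)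
    (hf : Frame p s s') (hp : 3 ∉ p.wvar ∧ 4 ∉ p.wvar ∧ 19 ∉ p.wvar ∧ 20 ∉ p.wvar) :
    Cut d i h s' := by
  obtain ⟨h1, h2, h3, h4⟩ := hp
  constructor
  · rw [hf.var _ h1]; exact hS.width
  · rw [hf.var _ h2]; exact hS.dir
  · rw [hf.var _ h3]; exact hS.P
  · rw [hf.var _ h4]; exact hS.m

/-- Reset the counters. -/
def clearProg : Prog := .for 17 (.var 1) (.put 10 (.var 17) (.const 0) ;; .put 11 (.var 17) (.const 0))

/-- The place number `17` of the enumeration along direction `j`. -/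
def enumExpr : Expr :=
  .var 17 / .var 8 / .var 7 * (.var 7 * .var 8) + .var 17 / .var 8 % .var 7 +
    .var 17 % .var 8 * .var 7

/-- The distance of the vertex in register `27` from its box to the end of the grid. -/
def restExpr : Expr :=
  .var 8 - (.var 27 / .var 7 % .var 8 - .var 27 / .var 7 % .var 8 % .var 9)

/-- Compute the target of one robot. -/
def targetBody : Prog :=
  .assign 27 enumExpr ;; .assign 28 (.get 5 (.var 27)) ;; .assign 29 (.get 9 (.var 27)) ;;
  .assign 30 restExpr ;; .ite (.ltE (.var 9) (.var 30)) (.assign 30 (.var 9)) .skip ;;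
  .ite (.get 2 (.var 28) / .var 19 % .var 20 / .var 3 % .const 2)
    (.put 8 (.var 28) (.var 30 - .const 1 - .get 11 (.var 29) % .var 30) ;;
      .put 11 (.var 29) (.get 11 (.var 29) + .const 1))
    (.put 8 (.var 28) (.get 10 (.var 29) % .var 30) ;;
      .put 10 (.var 29) (.get 10 (.var 29) + .const 1))

/-- Compute the targets of all robots. -/
def targetProg : Prog := .for 17 (.var 1) targetBody

section
variable {d : Dims} {G X : ℕ → ℕ} {w B : ℕ} {s : State} {i h j g : ℕ}

theorem clearProg_runs (hB : Big d w B) (hc : Ctx d G s) :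
    Runs w clearProg s ((d.N + 1) * 20) fun s' => ∀ v < d.N, s'.arr 10 v = 0 ∧ s'.arr 11 v = 0 := by
  have hle := hB.le
  have h6 := d.six_le_N
  refine (Runs.for_const hB.room (n := d.N) (c := 12)
    (fun n s' => ∀ v < n, s'.arr 10 v = 0 ∧ s'.arr 11 v = 0) (by decide) (by decide) (by omega)
    ?_ ?_ ?_ ?_).mono (by simp [Expr.cost]) fun _ _ h => h
  · intro s' hf
    have := (hc.frame hf (by decide)).N
    simp [this]; omega
  · simp
  · intro n hn s' hf h1 hv
    refine (Prog.runs_of_wp hB.room (by decide) ?_).mono (by decide) fun _ _ h => h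
    simp only [Prog.wp, Expr.bdd_var, Expr.bdd_const, Expr.nval_var, Expr.nval_const, hv,
      State.setVar_arr, State.setArr_arr, State.setArr_var, if_true, if_neg (show ¬ 11 = 10 by decide),
      if_neg (show ¬ 10 = 11 by decide)]
    refine ⟨by omega, by omega, by omega, by omega, fun v hv => ?_⟩
    rw [Function.update_apply, Function.update_apply]
    split_ifs with h
    · exact ⟨rfl, rfl⟩
    · exact h1 v (by omega)
  · exact fun s' _ h => h

theorem Lines.cnt_succ {S : ℕ → ℕ} {z : ℕ → Prop} [DecidablePred z] (a u : ℕ) :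
    Lines.cnt S z a (u + 1) = Lines.cnt S z a u + if S u = a ∧ z u then 1 else 0 :=
  Nat.count_succ _ _

theorem targetBody_wp (hB : Big d w B) (hc : Ctx d G s) (hG : ∀ r < d.N, G r < d.N)
    (hD : Dir d j g s) (hS : Cut d i h s) (hj : j < d.k) (hi : i < d.k) (hg : g ≤ 2 * d.N)
    (hg0 : 0 < g) (hh : h ≤ d.N)
    {u : ℕ} (hu : u < d.N) (h17 : s.var 17 = u) (hO : ∀ v < d.N, s.arr 5 v < d.N)
    (hR : ∀ v < d.N, s.arr 9 v < d.N) (h10 : ∀ a < d.N, s.arr 10 a ≤ u)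
    (h11 : ∀ a < d.N, s.arr 11 a ≤ u) {Q : State → Prop}
    (hQ : ∀ s' : State, (if d.x i (G (s.arr 5 (d.enum j u))) / h % 2 = 0 then
        s'.arr 8 = Function.update (s.arr 8) (s.arr 5 (d.enum j u))
          (s.arr 10 (s.arr 9 (d.enum j u)) % d.len j g (d.enum j u)) ∧
        s'.arr 10 = Function.update (s.arr 10) (s.arr 9 (d.enum j u))
          (s.arr 10 (s.arr 9 (d.enum j u)) + 1) ∧ s'.arr 11 = s.arr 11
      else
        s'.arr 8 = Function.update (s.arr 8) (s.arr 5 (d.enum j u))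
          (d.len j g (d.enum j u) - 1 - s.arr 11 (s.arr 9 (d.enum j u)) %
            d.len j g (d.enum j u)) ∧
        s'.arr 11 = Function.update (s.arr 11) (s.arr 9 (d.enum j u))
          (s.arr 11 (s.arr 9 (d.enum j u)) + 1) ∧ s'.arr 10 = s.arr 10) → Q s') :
    targetBody.wp B Q s := by
  have hle := hB.le
  have h6 := d.six_le_N
  obtain ⟨b7, b8, b9, -⟩ := hD.bounds hB hj hg
  have hPi := Dims.P_le_N (d := d) hi.le
  have hmi := Dims.m_le_N (d := d) hi
  have hv := Dims.enum_lt hj hu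
  have hr := hO _ hv
  have ha := hR _ hv
  have hGr := hG _ hr
  have h10 := h10 _ ha
  have h11 := h11 _ ha
  have hGe := hc.G _ hr
  have hlen : d.len j g (d.enum j u) = min g (d.m j - (d.x j (d.enum j u) -
    d.x j (d.enum j u) % g)) := rfl
  set v := d.enum j u with hvd
  have e1 : enumExpr.nval s = v := by
    simp [enumExpr, h17, hD.P, hD.m, hvd, Dims.enum]
  set e := d.m j - (d.x j v - d.x j v % g) with he
  have hem : e ≤ d.m j := Nat.sub_le _ _
  have hmj := Dims.m_le_N (d := d) hj
  have b1 : enumExpr.Bdd B s := by simp [enumExpr, *]; omega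
  generalize hr' : s.arr 5 v = r at *
  generalize ha' : s.arr 9 v = a at *
  have e2 : d.m j - (v / d.P j % d.m j - v / d.P j % d.m j % g) = e := rfl
  have e3 : ∀ x, x / d.P i % d.m i = d.x i x := fun _ => rfl
  simp only [targetBody, Prog.wp, e1, b1, restExpr, Expr.bdd_var, Expr.bdd_get, Expr.bdd_const,
    Expr.bdd_sub, Expr.bdd_div, Expr.bdd_mod, Expr.bdd_add, Expr.bdd_lt,
    Expr.nval_var, Expr.nval_get, Expr.nval_const, Expr.nval_lt_ne_zero, Expr.nval_lt_eq_zero,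
    Expr.nval_sub, Expr.nval_div, Expr.nval_mod, Expr.nval_add, State.setVar_var,
    State.setVar_arr, State.setArr_var, State.setArr_arr, reduceIte,
    Nat.reduceEqDiff, hr', ha', hD.P, hD.m, hD.g, hS.width, hS.P, hS.m, e2, hGe, e3, true_and]
  rw [hD.P] at b7
  rw [hD.m] at b8
  rw [hD.g] at b9
  have hb1 : v ≤ B ∧ d.P j ≤ B ∧ d.m j ≤ B ∧ g ≤ B ∧ r ≤ B ∧ a ≤ B ∧ e ≤ B ∧ G r ≤ B ∧ d.P i ≤ B ∧
    d.m i ≤ B ∧ h ≤ B ∧ 2 ≤ B ∧ 1 ≤ B ∧ s.arr 10 a ≤ B ∧ s.arr 11 a ≤ B := by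
    refine ⟨?_, ?_, ?_, ?_, ?_, ?_, ?_, ?_, ?_, ?_, ?_, ?_, ?_, ?_, ?_⟩ <;> omega
  simp only [hb1, true_and, and_true]
  constructor <;> intro hlt <;> [rw [min_eq_left hlt.le] at hlen; rw [min_eq_right (by omega)] at hlen]
  all_goals
    constructor <;> intro hz <;> apply hQ
    · rw [if_neg hz]
      simp [hlen]
    · rw [if_pos hz]
      simp [hlen]

/-- The counters, indexed by the slab representative, hold the running values of `Lines.cnt`. Each
target then costs constant time, although the slabs are interleaved in the enumeration. -/
theorem targetProg_runs (hB : Big d w B) (hc : Ctx d G s) (hG : ∀ r < d.N, G r < d.N)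
    (hD : Dir d j g s) (hS : Cut d i h s) (hj : j < d.k) (hi : i < d.k) (hg : g ≤ 2 * d.N)
    (hg0 : 0 < g) (hh : h ≤ d.N) (hO : BijLt d.N (s.arr 5)) (hR : ∀ v < d.N, s.arr 9 v < d.N)
    (h10 : ∀ v < d.N, s.arr 10 v = 0 ∧ s.arr 11 v = 0) :
    Runs w targetProg s ((d.N + 1) * 200) fun s' => ∀ u < d.N,
      s'.arr 8 (s.arr 5 (d.enum j u)) = Lines.tgt (fun u => s.arr 9 (d.enum j u))
      (fun u => d.len j g (d.enum j u))
      (fun u => d.x i (G (s.arr 5 (d.enum j u))) / h % 2 = 0) u := by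
  have hle := hB.le
  have h6 := d.six_le_N
  set S := fun u => s.arr 9 (d.enum j u) with hSd
  set z := fun u => d.x i (G (s.arr 5 (d.enum j u))) / h % 2 = 0 with hzd
  have hcl : ∀ (z : ℕ → Prop) [DecidablePred z] a u, Lines.cnt S z a u ≤ u :=
    fun z _ a u => Nat.count_le _
  refine (Runs.for_const hB.room (n := d.N) (c := 150)
    (fun n s' => (∀ u < n, s'.arr 8 (s.arr 5 (d.enum j u)) = Lines.tgt S
        (fun u => d.len j g (d.enum j u)) z u) ∧
      ∀ a < d.N, s'.arr 10 a = Lines.cnt S z a n ∧ s'.arr 11 a = Lines.cnt S (fun u => ¬ z u) a n)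
    (by decide) (by decide) (by omega) ?_ ?_ ?_ ?_).mono (by simp [Expr.cost])
    fun _ _ h => h
  · intro s' hf
    have := (hc.frame hf (by decide)).N
    simp [this]; omega
  · exact ⟨by simp, fun a ha => by simpa [Lines.cnt] using h10 a ha⟩
  · rintro n hn s' hf ⟨h1, h2⟩ hv
    have e5 := hf.arr 5 (by decide)
    have e9 := hf.arr 9 (by decide)
    refine (Prog.runs_of_wp hB.room (by decide) (targetBody_wp hB (hc.frame hf (by decide)) hG
      (hD.frame hf (by decide)) (hS.frame hf (by decide)) hj hi hg hg0 hh hn hv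
      (by rw [e5]; exact hO.1) (by rwa [e9])
      (fun a ha => (h2 a ha).1 ▸ hcl _ _ _) (fun a ha => (h2 a ha).2 ▸ hcl _ _ _) (Q := fun s'' =>
      (∀ u < n + 1, s''.arr 8 (s.arr 5 (d.enum j u)) = Lines.tgt S
        (fun u => d.len j g (d.enum j u)) z u) ∧
      ∀ a < d.N, s''.arr 10 a = Lines.cnt S z a (n + 1) ∧
        s''.arr 11 a = Lines.cnt S (fun u => ¬ z u) a (n + 1))
      fun s'' hs => ?_)).mono (by decide) fun _ _ h => h
    have hvn := Dims.enum_lt hj hn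
    obtain ⟨c1, c2⟩ := h2 _ (hR _ hvn)
    have hinj : ∀ u < n + 1, u ≠ n → s.arr 5 (d.enum j u) ≠ s.arr 5 (d.enum j n) :=
      fun u hu hne e => hne (Dims.enum_inj hj (hO.2 _ (Dims.enum_lt hj (by omega)) _ hvn e))
    rw [e5, e9] at hs
    simp only [Lines.cnt_succ]
    by_cases hz : z n
    · rw [if_pos hz] at hs
      obtain ⟨s1, s2, s3⟩ := hs
      refine ⟨fun u hu => ?_, fun a ha => ?_⟩
      · rw [s1, Function.update_apply]
        by_cases hne : u = n
        · subst hne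
          rw [if_pos rfl, c1, Lines.tgt, if_pos hz]
        · rw [if_neg (hinj u hu hne)]; exact h1 u (by omega)
      · rw [s2, s3, (h2 a ha).2, Function.update_apply]
        simp only [hz, not_true, and_false, if_false, add_zero, and_true]
        by_cases e : a = s.arr 9 (d.enum j n)
        · rw [if_pos e, if_pos (show S n = a from e.symm), c1, e]
        · rw [if_neg e, if_neg (fun h : S n = a => e h.symm), (h2 a ha).1, add_zero]
    · rw [if_neg hz] at hs
      obtain ⟨s1, s2, s3⟩ := hs
      refine ⟨fun u hu => ?_, fun a ha => ?_⟩
      · rw [s1, Function.update_apply]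
        by_cases hne : u = n
        · subst hne
          rw [if_pos rfl, c2, Lines.tgt, if_neg hz]
        · rw [if_neg (hinj u hu hne)]; exact h1 u (by omega)
      · rw [s2, s3, (h2 a ha).1, Function.update_apply]
        simp only [hz, not_false_eq_true, and_false, if_false, add_zero, and_true, true_and]
        by_cases e : a = s.arr 9 (d.enum j n)
        · rw [if_pos e, if_pos (show S n = a from e.symm), c2, e]
        · rw [if_neg e, if_neg (fun h : S n = a => e h.symm), (h2 a ha).2, add_zero]
  · exact fun s' _ h => h.1

end

/-! ### Cutting the boxes in one direction -/

/-- The width of the boxes in the direction in register `x`. -/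
def widExpr (x : ℕ) : Expr := .var 3 * (.const 2 - .ltE (.var x) (.var 4))

/-- Set the registers that describe the direction number `5` of the cut. -/
def dirProg : Prog :=
  .assign 6 ((.var 4 + .const 1 + .var 5) % .var 0) ;;
  .assign 7 (.get 4 (.var 6)) ;; .assign 8 (.get 0 (.var 6)) ;; .assign 9 (widExpr 6) ;;
  .assign 27 ((.var 6 + .const 1) % .var 0) ;;
  .assign 10 (.get 4 (.var 27)) ;; .assign 11 (.get 0 (.var 27)) ;;
  .assign 27 ((.var 6 + .const 2) % .var 0) ;;
  .assign 12 (.get 4 (.var 27)) ;; .assign 13 (.get 0 (.var 27))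

/-- Refine the slabs in the current direction. -/
def refineProg : Prog :=
  .for 17 (.var 1) (.put 9 (.var 17) (.get 9 (.var 17) + co0 % .var 9 * .var 7))

/-- Balance the labels in the current direction. -/
def stageProg : Prog :=
  dirProg ;; clearProg ;; targetProg ;; roundsProg ;; refineProg

/-- The first slabs of a cut are the boxes. -/
def repProg : Prog :=
  .for 17 (.var 1) (.put 9 (.var 17) (.var 17)) ;;
  .for 18 (.var 0) (.for 17 (.var 1) (.put 9 (.var 17) (.get 9 (.var 17) -
    .var 17 / .get 4 (.var 18) % .get 0 (.var 18) % widExpr 18 * .get 4 (.var 18))))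

/-- Cut the boxes in the direction in register `4`. -/
def cutProg : Prog :=
  .assign 19 (.get 4 (.var 4)) ;; .assign 20 (.get 0 (.var 4)) ;; repProg ;;
    .for 5 (.var 0) stageProg

section
variable {d : Dims} {G X : ℕ → ℕ} {w B : ℕ} {s : State} {i h j g : ℕ}

theorem wid_pos (hh : 0 < h) (l : ℕ) : 0 < wid h i l := by
  unfold wid; split_ifs <;> omega

theorem wid_le (l : ℕ) : wid h i l ≤ 2 * h := by
  unfold wid; split_ifs <;> omega

theorem wid_self : wid h i i = 2 * h := by
  unfold wid; rw [if_neg (lt_irrefl i)]; omega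

theorem dirProg_runs (hB : Big d w B) (hc : Ctx d G s) (hi : s.var 4 = i) (hw : s.var 3 = h)
    (hid : i < d.k) {t : ℕ} (ht : s.var 5 = t) (htk : t < d.k) (hh : h ≤ d.N) :
    Runs w dirProg s 70 (Dir d ((i + 1 + t) % d.k) (wid h i ((i + 1 + t) % d.k))) := by
  have hle := hB.le
  have h6 := d.six_le_N
  have hkN := d.k_lt_N
  have hk0 : 0 < d.k := by omega
  refine (Prog.runs_of_wp hB.room (by decide) ?_).mono (by decide) fun _ _ h => h
  have hj : (i + 1 + t) % d.k < d.k := Nat.mod_lt _ hk0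
  set j := (i + 1 + t) % d.k with hjd
  have h1 := Dims.nx_lt (d := d) 1 j
  have h2 := Dims.nx_lt (d := d) 2 j
  have e1 : (j + 1) % d.k = d.nx 1 j := rfl
  have e2 : (j + 2) % d.k = d.nx 2 j := rfl
  have a0 := Dims.P_le_N hj.le
  have a1 := Dims.P_le_N h1.le
  have a2 := Dims.P_le_N h2.le
  have a3 := Dims.m_le_N hj
  have a4 := Dims.m_le_N h1
  have a5 := Dims.m_le_N h2
  have ek := hc.k
  have m0 := hc.m _ hj
  have m1 := hc.m _ h1
  have m2 := hc.m _ h2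
  have p0 := hc.P _ hj
  have p1 := hc.P _ h1
  have p2 := hc.P _ h2
  generalize d.nx 1 j = j1 at *
  generalize d.nx 2 j = j2 at *
  simp only [dirProg, Prog.wp, widExpr, Expr.bdd_var, Expr.bdd_get, Expr.bdd_const,
    Expr.bdd_sub, Expr.bdd_mul, Expr.bdd_mod, Expr.bdd_add, Expr.bdd_lt,
    Expr.nval_var, Expr.nval_get, Expr.nval_const, Expr.nval_lt, Expr.nval_mul,
    Expr.nval_sub, Expr.nval_mod, Expr.nval_add, State.setVar_var,
    State.setVar_arr, reduceIte, Nat.reduceEqDiff, OfNat.zero_ne_ofNat,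
    hi, hw, ht, ek, ← hjd, m0, m1, m2, p0, p1, p2, e1, e2]
  have hb : i ≤ B ∧ h ≤ B ∧ t ≤ B ∧ d.k ≤ B ∧ j ≤ B ∧ j1 ≤ B ∧ j2 ≤ B ∧ 2 ≤ B ∧ 1 ≤ B ∧ d.P j ≤ B ∧
      d.P j1 ≤ B ∧ d.P j2 ≤ B ∧ d.m j ≤ B ∧ d.m j1 ≤ B ∧ d.m j2 ≤ B := by
    refine ⟨?_, ?_, ?_, ?_, ?_, ?_, ?_, ?_, ?_, ?_, ?_, ?_, ?_, ?_, ?_⟩ <;> omega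
  simp only [hb, true_and]
  constructor <;> simp [← e1, ← e2, wid, Dims.nx]

/-- Adding the offset in direction `j` turns the corner coordinate of the box back into the
coordinate of the vertex, which is what joining `j` to `J` means. -/
theorem refineProg_runs (hB : Big d w B) (hc : Ctx d G s) (hD : Dir d j (wid h i j) s)
    (hj : j < d.k) (hh : h ≤ d.N) {J : Finset ℕ} (hJ : j ∉ J)
    (hR : d.RepOK (wid h i) J (s.arr 9)) :
    Runs w refineProg s ((d.N + 1) * 30) fun s' => d.RepOK (wid h i) (insert j J) (s'.arr 9) := by
  have hle := hB.le
  have h6 := d.six_le_N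
  refine (Runs.for_const hB.room (n := d.N) (c := 20)
    (fun n s' => (∀ v < n, s'.arr 9 v = d.setc j (s.arr 9 v) (d.x j v)) ∧
      ∀ v, n ≤ v → s'.arr 9 v = s.arr 9 v) (by decide) (by decide) (by omega) ?_ ?_ ?_
    ?_).mono (by simp [Expr.cost]) fun _ _ h => h
  · intro s' hf
    have := (hc.frame hf (by decide)).N
    simp [this]; omega
  · exact ⟨by simp, fun _ _ => rfl⟩
  · intro n hn s' hf ⟨h1, h2⟩ hv
    have hD' := hD.frame hf (by decide)
    obtain ⟨b7, b8, b9, -⟩ := hD'.bounds hB hj ((wid_le j).trans (by omega))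
    obtain ⟨r1, r2⟩ := hR n hn
    have r3 := r2 j hj
    rw [if_neg hJ] at r3
    have e9 := h2 n le_rfl
    refine (Prog.runs_of_wp hB.room (by decide) ?_).mono (by decide) fun _ _ h => h
    simp only [Prog.wp, co0, Expr.bdd_var, Expr.bdd_get, Expr.bdd_add, Expr.bdd_mul, Expr.bdd_mod,
      Expr.bdd_div, Expr.nval_add, Expr.nval_mul, Expr.nval_mod, Expr.nval_div, Expr.nval_var,
      Expr.nval_get, hv, State.setVar_arr, State.setArr_arr, if_true, e9]
    refine ⟨by omega, ⟨by omega, by omega⟩, fun v hv => ?_, fun v hv => ?_⟩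
    · rw [Function.update_apply]
      split_ifs with h
      · subst h
        have hx : d.x j v = d.x j (s.arr 9 v) + d.x j v % wid h i j := by
          have := Nat.mod_le (d.x j v) (wid h i j)
          omega
        rw [hx, Dims.setc_add, hD'.P, hD'.m, hD'.g]
        rfl
      · exact h1 v (by omega)
    · rw [Function.update_apply, if_neg (by omega)]; exact h2 v (by omega)
  · rintro s' - ⟨h1, -⟩ v hv
    obtain ⟨r1, r2⟩ := hR v hv
    have hx := Dims.x_lt hj v
    rw [h1 v hv]
    refine ⟨Dims.setc_lt hj r1 hx, fun l hl => ?_⟩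
    rw [Dims.x_setc hj hx, r2 l hl]
    by_cases e : l = j
    · subst e; simp
    · simp [e]

theorem repProg_runs (hB : Big d w B) (hc : Ctx d G s) (hw : s.var 3 = h) (hi : s.var 4 = i)
    (hid : i < d.k) (hh : h ≤ d.N) :
    Runs w repProg s ((d.k + 1) * ((d.N + 1) * 60)) fun s' =>
      d.RepOK (wid h i) ∅ (s'.arr 9) := by
  have hle := hB.le
  have h6 := d.six_le_N
  have hkN := d.k_lt_N
  have hk2 := d.two_le_k
  have H1 : Runs w (.for 17 (.var 1) (.put 9 (.var 17) (.var 17))) s ((d.N + 1) * 12) fun s' =>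
      ∀ v < d.N, s'.arr 9 v = v := by
    refine (Runs.for_const hB.room (n := d.N) (c := 3)
      (fun n s' => ∀ v < n, s'.arr 9 v = v) (by decide) (by decide) (by omega) ?_ ?_ ?_
      ?_).mono (by simp [Expr.cost]) fun _ _ h => h
    · intro s' hf
      have := (hc.frame hf (by decide)).N
      simp [this]; omega
    · simp
    · intro n hn s' hf h1 hv
      refine (Prog.runs_of_wp hB.room (by decide) ?_).mono (by decide) fun _ _ h => h
      simp only [Prog.wp, Expr.bdd_var, Expr.nval_var, hv, State.setVar_arr, State.setArr_arr,
        if_true]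
      refine ⟨by omega, by omega, fun v hv => ?_⟩
      rw [Function.update_apply]
      split_ifs with h
      · exact h.symm
      · exact h1 v (by omega)
    · exact fun s' _ h => h
  refine (Runs.seq (t₂ := (d.k + 1) * ((d.N + 1) * 48)) H1 ?_).mono (by nlinarith)
    fun _ _ h => h
  intro s₁ hf₁ h1
  have hc₁ := hc.frame hf₁ (by decide)
  have e3 := (hf₁.var 3 (by decide)).trans hw
  have e4 := (hf₁.var 4 (by decide)).trans hi
  refine (Runs.for_const hB.room (n := d.k) (c := (d.N + 1) * 40)
    (fun n s' => ∀ v < d.N, s'.arr 9 v < d.N ∧ ∀ l < d.k, d.x l (s'.arr 9 v) =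
      if l < n then d.x l v - d.x l v % wid h i l else d.x l v) (by decide) (by decide)
      (by omega) ?_ ?_ ?_ ?_).mono (Nat.mul_le_mul_left _ (by simp [Expr.cost]; omega))
      fun _ _ h => h
  · intro s' hf
    have := (hc₁.frame hf (by decide)).k
    simp [this]; omega
  · intro v hv
    simp only [State.setVar_arr, h1 v hv]
    exact ⟨hv, by simp⟩
  · intro l hl s₂ hf₂ h2 hv
    have hc₂ := hc₁.frame hf₂ (by decide)
    have e3 := (hf₂.var 3 (by decide)).trans e3
    have e4 := (hf₂.var 4 (by decide)).trans e4
    have hPl := Dims.P_le_N hl.le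
    have hml := Dims.m_le_N hl
    refine (Runs.for_const hB.room (n := d.N) (c := 30)
      (fun n s' => (∀ v < n, s'.arr 9 v = d.setc l (s₂.arr 9 v)
          (d.x l v - d.x l v % wid h i l)) ∧
        ∀ v, n ≤ v → s'.arr 9 v = s₂.arr 9 v) (by decide) (by decide) (by omega) ?_ ?_ ?_
      ?_).mono (by simp [Expr.cost]) fun _ _ h => h
    · intro s' hf
      have := (hc₂.frame hf (by decide)).N
      simp [this]; omega
    · exact ⟨by simp, fun _ _ => rfl⟩
    · intro n hn s' hf ⟨h3, h4⟩ h17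
      have e0 := (hf.arr 0 (by decide))
      have em := hc₂.m l hl
      have eP := hc₂.P l hl
      have e4' := (hf.arr 4 (by decide))
      have e18 := (hf.var 18 (by decide)).trans hv
      have e3 := (hf.var 3 (by decide)).trans e3
      have e4 := (hf.var 4 (by decide)).trans e4
      obtain ⟨r1, r2⟩ := h2 n hn
      have r3 := r2 l hl
      rw [if_neg (lt_irrefl l)] at r3
      have e9 := h4 n le_rfl
      refine (Prog.runs_of_wp hB.room (by decide) ?_).mono (by decide) fun _ _ h => h
      simp only [Prog.wp, widExpr, Expr.bdd_var, Expr.bdd_get, Expr.bdd_sub, Expr.bdd_mul,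
        Expr.bdd_mod, Expr.bdd_const, Expr.bdd_lt, Expr.nval_lt, Expr.nval_const,
        Expr.bdd_div, Expr.nval_sub, Expr.nval_mul, Expr.nval_mod, Expr.nval_div, Expr.nval_var,
        Expr.nval_get, h17, State.setVar_arr, State.setArr_arr, if_true, e9, e0, e4', e18, em, eP,
        e3, e4]
      refine ⟨by omega, by omega, fun v hv => ?_, fun v hv => ?_⟩
      · rw [Function.update_apply]
        by_cases h : v = n
        · rw [if_pos h]
          subst h
          rw [← r3, Dims.setc_sub (Nat.mod_le _ _), r3]
          rfl
        · rw [if_neg h]; exact h3 v (by omega)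
      · rw [Function.update_apply, if_neg (by omega)]; exact h4 v (by omega)
    · rintro s' - ⟨h3, -⟩ v hv
      obtain ⟨r1, r2⟩ := h2 v hv
      have hx : d.x l v - d.x l v % wid h i l < d.m l :=
        (Nat.sub_le _ _).trans_lt (Dims.x_lt hl v)
      simp only [State.setVar_arr]
      rw [h3 v hv]
      refine ⟨Dims.setc_lt hl r1 hx, fun l' hl' => ?_⟩
      rw [Dims.x_setc hl hx, r2 l' hl']
      by_cases e : l' = l
      · subst e; simp
      · simp only [e, if_false]
        exact if_congr (by omega) rfl rfl
  · intro s' _ h v hv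
    refine ⟨(h v hv).1, fun l hl => ?_⟩
    rw [(h v hv).2 l hl, if_pos hl]; simp

end
-- The order of the stages and the effect of a cut
section
variable {d : Dims} {G X : ℕ → ℕ} {w B : ℕ} {s : State} {i h j g : ℕ}

/-- The directions in which the labels are balanced after `t` stages. -/
def done (d : Dims) (i t : ℕ) : Finset ℕ := (Finset.range t).image fun t => (i + 1 + t) % d.k

theorem rot_inj {k i t t' : ℕ} (ht : t < k) (ht' : t' < k)
    (h : (i + 1 + t) % k = (i + 1 + t') % k) : t = t' := by
  have := Nat.ModEq.add_left_cancel' (i + 1) (show (i + 1) + t ≡ (i + 1) + t' [MOD k] from h)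
  exact Nat.ModEq.eq_of_lt_of_lt this ht ht'

theorem rot_surj {k i l : ℕ} (hi : i < k) (hl : l < k) :
    ∃ t < k, (i + 1 + t) % k = l ∧ (l ≠ i → t + 1 < k) := by
  rcases Nat.lt_or_ge i l with h | h
  · exact ⟨l - (i + 1), by omega, by
      rw [show i + 1 + (l - (i + 1)) = l by omega, Nat.mod_eq_of_lt hl], by omega⟩
  · refine ⟨l + k - (i + 1), by omega, ?_, by omega⟩
    rw [show i + 1 + (l + k - (i + 1)) = l + k by omega, Nat.add_mod_right, Nat.mod_eq_of_lt hl]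

theorem done_succ (t : ℕ) : done d i (t + 1) = insert ((i + 1 + t) % d.k) (done d i t) := by
  unfold done; rw [Finset.range_add_one, Finset.image_insert]

theorem not_mem_done {t : ℕ} (ht : t < d.k) : (i + 1 + t) % d.k ∉ done d i t := by
  intro h
  obtain ⟨t', h1, h2⟩ := Finset.mem_image.1 h
  have h1 := Finset.mem_range.1 h1
  have := rot_inj (by omega) ht h2
  omega

theorem mem_done {l : ℕ} (hi : i < d.k) (hl : l < d.k) : l ∈ done d i d.k := by
  obtain ⟨t, h1, h2, -⟩ := rot_surj hi hl
  exact Finset.mem_image.2 ⟨t, Finset.mem_range.2 h1, h2⟩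

/-- Since `i + 1 + t` is congruent to `i` only for `t = k - 1`, direction `i` comes last. This
supplies the hypothesis `hlast` of `balanced_stage`. -/
theorem last_done {t : ℕ} (hi : i < d.k) (ht : t < d.k) (h : (i + 1 + t) % d.k = i) {l : ℕ}
    (hl : l < d.k) (hli : l ≠ i) : l ∈ done d i t := by
  obtain ⟨t', h1, h2, h3⟩ := rot_surj hi hl
  have h3 := h3 hli
  refine Finset.mem_image.2 ⟨t', Finset.mem_range.2 ?_, h2⟩
  have : t = d.k - 1 := rot_inj ht (by omega) (h.trans (by
    rw [show i + 1 + (d.k - 1) = i + d.k by omega, Nat.add_mod_right, Nat.mod_eq_of_lt hi]))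
  omega

/-- Every robot is in the box of its goal. -/
def Boxed (d : Dims) (g : ℕ → ℕ) (G O : ℕ → ℕ) : Prop :=
  ∀ v < d.N, ∀ l < d.k, d.x l v / g l = d.x l (G (O v)) / g l

theorem Boxed.sameLine {g : ℕ → ℕ} {O O' : ℕ → ℕ} (hb : Boxed d g G O)
    (h : ∀ v < d.N, ∃ u < d.N, O' v = O u ∧ d.SameLine j (g j) u v) : Boxed d g G O' := by
  intro v hv l hl
  obtain ⟨u, hu, e, h1, h2⟩ := h v hv
  rw [e, ← hb u hu l hl]
  by_cases hlj : l = j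
  · subst hlj; exact h2.symm
  · rw [h1 l hl hlj]

/-- The state of a cut after `t` stages. -/
structure Stage (d : Dims) (G X : ℕ → ℕ) (i h t T : ℕ) (s : State) : Prop where
  cfg : Cfg d X (s.arr 5) s
  rep : d.RepOK (wid h i) (done d i t) (s.arr 9)
  boxed : Boxed d (wid h i) G (s.arr 5)
  balanced : d.Balanced h i (s.arr 9) fun v => d.x i (G (s.arr 5 v)) / h % 2 = 0
  time : s.var 2 = T + t * (2500 * h)

theorem stageProg_runs (hB : Big d w B) (hc : Ctx d G s) (hG : BijLt d.N G) (hS : Cut d i h s)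
    (hi : i < d.k) (hh : h < d.m i) (hh0 : 0 < h) {t T : ℕ} (ht : s.var 5 = t) (htk : t < d.k)
    (hs : Stage d G X i h t T s) (hT : T + (t + 1) * (2500 * h) ≤ B) :
    Runs w stageProg s (h * ((d.N + 1) * 2600000)) (Stage d G X i h (t + 1) T) := by
  have hle := hB.le
  have h6 := d.six_le_N
  have hmi := Dims.m_le_N hi
  have hk2 := d.two_le_k
  have hj : (i + 1 + t) % d.k < d.k := Nat.mod_lt _ (by omega)
  have hJ := not_mem_done (d := d) (i := i) htk
  have hg := fun l (_ : l < d.k) => wid_pos (i := i) hh0 l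
  have htime : 70 + ((d.N + 1) * 20 + ((d.N + 1) * 200 + ((4 * h + 1) * ((d.N + 1) * 507100) +
      (d.N + 1) * 30))) ≤ h * ((d.N + 1) * 2600000) := by
    have hn : 7 ≤ d.N + 1 := by omega
    generalize d.N + 1 = n at *
    have : (4 * h + 1) * (n * 507100) = 4 * (h * (n * 507100)) + n * 507100 := by ring
    have h1 : 1 * n ≤ h * n := Nat.mul_le_mul_right _ hh0
    have h2 : h * (n * 507100) = 507100 * (h * n) := by ring
    have h3 : h * (n * 2600000) = 2600000 * (h * n) := by ring
    omega
  refine Runs.mono ?_ htime fun _ _ h => h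
  refine Runs.seq (dirProg_runs hB hc hS.dir hS.width hi ht htk (by omega)) fun s₁ hf₁ hD => ?_
  have hc₁ := hc.frame hf₁ (by decide)
  set j := (i + 1 + t) % d.k with hjd
  have hgj : wid h i j ≤ 2 * d.N := (wid_le j).trans (by omega)
  refine Runs.seq (clearProg_runs hB hc₁) fun s₂ hf₂ h10 => ?_
  have hc₂ := hc₁.frame hf₂ (by decide)
  have hD₂ := hD.frame hf₂ (by decide)
  have hS₂ := (hS.frame hf₁ (by decide)).frame hf₂ (by decide)
  have e5 : s₂.arr 5 = s.arr 5 := (hf₂.arr 5 (by decide)).trans (hf₁.arr 5 (by decide))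
  have e9 : s₂.arr 9 = s.arr 9 := (hf₂.arr 9 (by decide)).trans (hf₁.arr 9 (by decide))
  have e2 : s₂.var 2 = s.var 2 := (hf₂.var 2 (by decide)).trans (hf₁.var 2 (by decide))
  have hC₂ : Cfg d X (s₂.arr 5) s₂ := by
    rw [e5]; exact (hs.cfg.frame hf₁ (by decide)).frame hf₂ (by decide)
  refine Runs.seq (targetProg_runs hB hc₂ hG.1 hD₂ hS₂ hj hi hgj (hg j hj) (by omega) hC₂.bij
    (by rw [e9]; exact fun v hv => (hs.rep v hv).1) h10) fun s₃ hf₃ h8 => ?_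
  have hc₃ := hc₂.frame hf₃ (by decide)
  have hD₃ := hD₂.frame hf₃ (by decide)
  have hS₃ := hS₂.frame hf₃ (by decide)
  have e5 : s₃.arr 5 = s.arr 5 := (hf₃.arr 5 (by decide)).trans e5
  rw [← hf₃.arr 5 (by decide), e5, e9] at h8
  have e9 : s₃.arr 9 = s.arr 9 := (hf₃.arr 9 (by decide)).trans e9
  have e2 : s₃.var 2 = s.var 2 := (hf₃.var 2 (by decide)).trans e2
  have hC₃ : Cfg d X (s₃.arr 5) s₃ := by
    rw [hf₃.arr 5 (by decide)]; exact hC₂.frame hf₃ (by decide)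
  obtain ⟨hlt, hinj⟩ := Dims.tgt_spec (tgt := s₃.arr 8) (O := s.arr 5)
    (z := fun r => d.x i (G r) / h % 2 = 0) hg hs.rep hj hJ h8
  have htT := hs.time
  refine Runs.seq (roundsProg_runs hB hc₃ hD₃ hj hgj (hg j hj) hS₃.width (wid_le j) (by omega)
    (by rwa [e5]) (by rwa [e5]) hC₃ (by rw [e2, htT]; rw [add_mul] at hT; omega))
    fun s₄ hf₄ ⟨h1, h2, h3⟩ => ?_
  have e9 : s₄.arr 9 = s.arr 9 := (hf₄.arr 9 (by decide)).trans e9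
  refine (refineProg_runs hB (hc₃.frame hf₄ (by decide)) (hD₃.frame hf₄ (by decide)) hj
    (by omega) hJ (by rw [e9]; exact hs.rep)).mono le_rfl fun s₅ hf₅ h4 => ?_
  have e5' : s₅.arr 5 = s₄.arr 5 := hf₅.arr 5 (by decide)
  rw [← e5', e5] at h1
  refine ⟨by rw [e5']; exact h2.frame hf₅ (by decide), by rwa [done_succ],
    hs.boxed.sameLine (j := j) fun v hv => (h1 v hv).2, ?_, ?_⟩
  · exact Dims.balanced_stage (z := fun r => d.x i (G r) / h % 2 = 0) hg hs.rep h4 hj hJ hi wid_self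
      (fun e l hl hli => last_done hi htk e hl hli) h8 hs.cfg.bij (by rw [e5']; exact h2.bij) h1
      hs.balanced
  · rw [hf₅.var 2 (by decide), h3, e2, htT, add_mul]; omega

/-- After a cut, every robot is in the smaller box of its goal. -/
theorem cutProg_runs (hB : Big d w B) (hc : Ctx d G s) (hG : BijLt d.N G)
    (h3 : s.var 3 = h) (h4 : s.var 4 = i)
    (hi : i < d.k) (hh : h < d.m i) (hh0 : 0 < h) (hC : Cfg d X (s.arr 5) s)
    (hb : Boxed d (wid h i) G (s.arr 5))
    (hT : s.var 2 + d.k * (2500 * h) ≤ B) :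
    Runs w cutProg s (d.k * (h * (d.N * 6000000))) fun s' =>
      Cfg d X (s'.arr 5) s' ∧ Boxed d (wid h (i + 1)) G (s'.arr 5) ∧
        s'.var 2 = s.var 2 + d.k * (2500 * h) := by
  have hle := hB.le
  have h6 := d.six_le_N
  have hmi := Dims.m_le_N hi
  have hPi := Dims.P_le_N hi.le
  have hk2 := d.two_le_k
  have hkN := d.k_lt_N
  have hg := fun l (_ : l < d.k) => wid_pos (i := i) hh0 l
  have htime : 3 + (3 + ((d.k + 1) * ((d.N + 1) * 60) + ((d.k + 1) *
      (h * ((d.N + 1) * 2600000) + 1 + 7)))) ≤ d.k * (h * (d.N * 6000000)) := by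
    have h2 : 1 * (d.N + 1) ≤ h * (d.N + 1) := Nat.mul_le_mul_right _ hh0
    have h3 : (d.k + 1) * ((d.N + 1) * 60) + (d.k + 1) * (h * ((d.N + 1) * 2600000) + 1 + 7) + 6 ≤
      2 * (d.k + 1) * (h * (d.N + 1)) * 1300100 := by nlinarith
    -- `k ≥ 2` gives `2 (k + 1) ≤ 3 k`, and `N ≥ 6` gives `N + 1 ≤ 7 N / 6`.
    have h4 : 2 * (d.k + 1) * (h * (d.N + 1)) * 1300100 ≤ 3 * d.k * (h * (7 * d.N / 6)) * 1300100 :=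
      Nat.mul_le_mul_right _ (Nat.mul_le_mul (by omega) (Nat.mul_le_mul_left _ (by omega)))
    have h7 : d.k * (h * (6 * (7 * d.N / 6))) ≤ d.k * (h * (7 * d.N)) :=
      Nat.mul_le_mul_left _ (Nat.mul_le_mul_left _ (by omega))
    nlinarith
  refine Runs.mono ?_ htime fun _ _ h => h
  have eP := hc.P i hi
  have em := hc.m i hi
  have H1 : Runs w (.assign 19 (.get 4 (.var 4))) s 3 fun s' => s'.var 19 = d.P i := by
    refine (Prog.runs_of_wp hB.room (by decide) ?_).mono (by decide) fun _ _ h => h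
    simp [Prog.wp, h4, eP]; omega
  refine Runs.seq H1 fun s₁ hf₁ e19 => ?_
  have hc₁ := hc.frame hf₁ (by decide)
  have H2 : Runs w (.assign 20 (.get 0 (.var 4))) s₁ 3 fun s' => s'.var 20 = d.m i := by
    refine (Prog.runs_of_wp hB.room (by decide) ?_).mono (by decide) fun _ _ h => h
    have := hf₁.var 4 (by decide)
    simp [Prog.wp, this, h4, hc₁.m i hi]; omega
  refine Runs.seq H2 fun s₂ hf₂ e20 => ?_
  have hc₂ := hc₁.frame hf₂ (by decide)
  have hS : Cut d i h s₂ := ⟨((hf₂.var 3 (by decide)).trans (hf₁.var 3 (by decide))).trans h3,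
    ((hf₂.var 4 (by decide)).trans (hf₁.var 4 (by decide))).trans h4,
    (hf₂.var 19 (by decide)).trans e19, e20⟩
  refine Runs.seq (repProg_runs hB hc₂ hS.width hS.dir hi (by omega)) fun s₃ hf₃ hR => ?_
  have hc₃ := hc₂.frame hf₃ (by decide)
  have hS₃ := hS.frame hf₃ (by decide)
  have hC₃ := ((hC.frame hf₁ (by decide)).frame hf₂ (by decide)).frame hf₃ (by decide)
  have e5 : s₃.arr 5 = s.arr 5 := ((hf₃.arr 5 (by decide)).trans (hf₂.arr 5 (by decide))).trans
    (hf₁.arr 5 (by decide))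
  have e2 : s₃.var 2 = s.var 2 := ((hf₃.var 2 (by decide)).trans (hf₂.var 2 (by decide))).trans
    (hf₁.var 2 (by decide))
  rw [← e5] at hb hC₃
  -- Before the first stage slabs are boxes. The map from a vertex to the goal of its occupant is a
  -- bijection that preserves every box, hence balance.
  have hbal := Dims.balanced_zero (d := d) (i := i) (h := h) (G := fun v => G (s₃.arr 5 v))
    (hG.comp hC₃.bij) hg hR hb
  refine (Runs.for_const hB.room (n := d.k) (c := h * ((d.N + 1) * 2600000))
    (fun t s' => Stage d G X i h t (s.var 2) s') (by decide) (by decide)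
    (by omega) ?_ ?_ ?_ ?_).mono (by simp [Expr.cost]) fun _ _ h => h
  · intro s' hf
    have := (hc₃.frame hf (by decide)).k
    simp [this]; omega
  · exact ⟨hC₃.setVar (by decide), hR, hb, hbal, by simp [e2]⟩
  · rintro t ht s₄ hf₄ hst h5
    have hk : (t + 1) * (2500 * h) ≤ d.k * (2500 * h) := Nat.mul_le_mul_right _ ht
    refine (stageProg_runs hB (hc₃.frame hf₄ (by decide)) hG (hS₃.frame hf₄ (by decide)) hi hh hh0
      h5 ht hst (by omega)).mono le_rfl fun s₅ _ hst' => ?_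
    exact ⟨hst'.cfg.setVar (by decide), hst'.rep, hst'.boxed, hst'.balanced, by simp [hst'.time]⟩
  · rintro s' - ⟨hC', hR', hb', hbal', hT'⟩
    refine ⟨hC', fun v hv l hl => ?_, hT'⟩
    have h1 := hb' v hv l hl
    by_cases e : l = i
    · subst e
      have h2 := Dims.balanced_last hg hR' (fun l' hl' => mem_done hi hl') hbal' hv
      have e1 : wid h (l + 1) l = h := by simp [wid]
      -- The quotients by `2 h` agree by the old invariant and the parities of the quotients by `h`
      -- by balance, so the quotients by `h` agree.
      rw [wid_self, mul_comm, ← Nat.div_div_eq_div_mul, ← Nat.div_div_eq_div_mul] at h1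
      rw [e1]
      omega
    · have e1 : wid h (i + 1) l = wid h i l := by
        unfold wid; congr 2; exact if_congr (by omega) rfl rfl
      rw [e1]; exact h1

end

/-! ### Halving the boxes down to single vertices -/

theorem Runs.loop_true {w B : ℕ} (hw : Room w B) {b : Expr} {p : Prog} {s : State} {t₁ t₂ : ℕ}
    {Q R : State → Prop} (hs : b.size ≤ 64) (hb : b.Bdd B s) (h : b.nval s ≠ 0)
    (hp : Runs w p s t₁ R) (hq : ∀ s', Frame p s s' → R s' → Runs w (.loop b p) s' t₂ Q) :
    Runs w (.loop b p) s (b.cost + 1 + t₁ + t₂) Q := by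
  obtain ⟨s', u, he, hu, hr⟩ := hp
  obtain ⟨s'', u', he', hu', hq⟩ := hq s' he.frame hr
  exact ⟨s'', _, .loop_true ((Expr.eval_eq_nval hw hb hs).trans_ne h) he he', by omega, hq⟩

theorem Runs.loop_false {w B : ℕ} (hw : Room w B) {b : Expr} {p : Prog} {s : State}
    {Q : State → Prop} (hs : b.size ≤ 64) (hb : b.Bdd B s) (h : b.nval s = 0) (hQ : Q s) :
    Runs w (.loop b p) s (b.cost + 1) Q :=
  ⟨s, _, .loop_false ((Expr.eval_eq_nval hw hb hs).trans h), le_rfl, hQ⟩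

/-- Cut the boxes in all directions. -/
def levelProg : Prog := .for 4 (.var 0) (.ite (.ltE (.var 3) (.get 0 (.var 4))) cutProg .skip)

/-- Cut the boxes until they are single vertices. -/
def levelsProg : Prog := .loop (.var 3) (levelProg ;; .assign 3 (.var 3 / .const 2))

/-- Find a power of two which is at least the number of vertices. -/
def doubleProg : Prog := .loop (.ltE (.var 3) (.var 1)) (.assign 3 (.var 3 + .var 3))

/-- The total width of the cuts to boxes of width `h`. -/
def cutWidth (d : Dims) (h : ℕ) : ℕ := ∑ l ∈ Finset.range d.k, if h < d.m l then h else 0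

/-- The total width of the cuts to boxes of width less than `2 ^ E`. -/
def cutSum (d : Dims) (E : ℕ) : ℕ := ∑ e ∈ Finset.range E, cutWidth d (2 ^ e)

/-- The second bound drives the induction: when `2 ^ E < m` is added, the previous sum is at most `2
^ E`, so the new one is below `2 m`. -/
theorem sum_two_pow_lt_le (m E : ℕ) :
    (∑ e ∈ Finset.range E, if 2 ^ e < m then 2 ^ e else 0) ≤ 2 * m ∧
      (∑ e ∈ Finset.range E, if 2 ^ e < m then 2 ^ e else 0) ≤ 2 ^ E := by
  induction E with
  | zero => simp
  | succ E ih =>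
    rw [Finset.sum_range_succ, pow_succ]
    split_ifs <;> omega

/-- Summing direction by direction leaves a geometric sum for each side. Therefore the number of
levels contributes no logarithmic factor to the makespan. -/
theorem cutSum_le (d : Dims) (E : ℕ) : cutSum d E ≤ 2 * ∑ l ∈ Finset.range d.k, d.m l := by
  unfold cutSum cutWidth
  rw [Finset.sum_comm, Finset.mul_sum]
  exact Finset.sum_le_sum fun l _ => (sum_two_pow_lt_le _ _).1

section
variable {d : Dims} {G X : ℕ → ℕ} {w B : ℕ} {s : State} {i h j g : ℕ}

theorem Boxed.congr {g g' : ℕ → ℕ} {O : ℕ → ℕ} (hb : Boxed d g G O) (h : ∀ l < d.k, g' l = g l) :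
    Boxed d g' G O := fun v hv l hl => by rw [h l hl]; exact hb v hv l hl

theorem levelProg_runs (hB : Big d w B) (hc : Ctx d G s) (hG : BijLt d.N G)
    (h3 : s.var 3 = h) (hh0 : 0 < h) (hhN : h ≤ 2 * d.N) (hC : Cfg d X (s.arr 5) s)
    (hb : Boxed d (fun _ => 2 * h) G (s.arr 5))
    (hT : s.var 2 + 2500 * d.k * cutWidth d h ≤ B) :
    Runs w levelProg s (d.k * (d.N * 6000000) * cutWidth d h + 18 * d.k) fun s' =>
      Cfg d X (s'.arr 5) s' ∧ Boxed d (fun _ => h) G (s'.arr 5) ∧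
        s'.var 2 = s.var 2 + 2500 * d.k * cutWidth d h := by
  have hle := hB.le
  have h6 := d.six_le_N
  have hk2 := d.two_le_k
  have hkN := d.k_lt_N
  refine (Runs.for hB.room (n := d.k)
    (fun n s' => Cfg d X (s'.arr 5) s' ∧ Boxed d (wid h n) G (s'.arr 5) ∧
      s'.var 2 = s.var 2 + 2500 * d.k * ∑ l ∈ Finset.range n, if h < d.m l then h else 0)
    (fun i => d.k * (d.N * 6000000) * (if h < d.m i then h else 0) + 6) (by decide) (by decide)
    (by omega) ?_ ?_ ?_ ?_).mono (t := _) ?_ fun _ _ h => h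
  · intro s' hf
    have := (hc.frame hf (by decide)).k
    simp [this]; omega
  · exact ⟨hC.setVar (by decide), hb.congr fun l _ => by simp [wid, mul_comm], by simp⟩
  · rintro i hi s₁ hf₁ ⟨hC₁, hb₁, h2⟩ h4
    have hc₁ := hc.frame hf₁ (by decide)
    have e3 := (hf₁.var 3 (by decide)).trans h3
    have em := hc₁.m i hi
    have hmi := Dims.m_le_N hi
    have hmono : ∑ l ∈ Finset.range (i + 1), (if h < d.m l then h else 0) ≤ cutWidth d h :=
      Finset.sum_le_sum_of_subset (Finset.range_subset_range.2 hi)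
    rw [Finset.sum_range_succ] at hmono
    have hT₁ := Nat.mul_le_mul_left (2500 * d.k) hmono
    rw [mul_add] at hT₁
    refine (Runs.ite hB.room (t := d.k * (d.N * 6000000) * (if h < d.m i then h else 0) + 1)
      (by decide) (by simp [e3, h4, em]; omega)
      (fun hcond => ?_) fun hcond => ?_).mono (by simp [Expr.ltE, Expr.cost]; omega) fun _ _ h => h
    · simp only [Expr.nval_lt_ne_zero, Expr.nval_var, Expr.nval_get, e3, h4, em] at hcond
      rw [if_pos hcond] at hT₁ ⊢
      have hTe : d.k * (2500 * h) = 2500 * d.k * h := by ring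
      refine (cutProg_runs hB hc₁ hG e3 h4 hi hcond hh0 hC₁ hb₁ (by omega)).mono
        (by rw [show d.k * (h * (d.N * 6000000)) = d.k * (d.N * 6000000) * h by ring]; omega) ?_
      rintro s₂ - ⟨hC₂, hb₂, e2⟩
      refine ⟨hC₂.setVar (by decide), hb₂, ?_⟩
      rw [Finset.sum_range_succ, if_pos hcond, mul_add]
      simp [e2, h2, hTe]; ring
    -- For `h ≥ m i` a box of width `h` already spans the whole direction, so the cut is void and
    -- costs no moves.
    · simp only [Expr.nval_lt_eq_zero, Expr.nval_var, Expr.nval_get, e3, h4, em] at hcond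
      refine ⟨s₁, 1, .skip s₁, by omega, hC₁.setVar (by decide), fun v hv l hl => ?_, ?_⟩
      · by_cases e : l = i
        · subst e
          have e1 : wid h (l + 1) l = h := by simp [wid]
          have hx := Dims.x_lt hl v
          have hx' := Dims.x_lt hl (G (s₁.arr 5 v))
          rw [e1]
          simp only [State.setVar_arr]
          rw [Nat.div_eq_of_lt (by omega), Nat.div_eq_of_lt (by omega)]
        · have e1 : wid h (i + 1) l = wid h i l := by
            unfold wid; congr 2; exact if_congr (by omega) rfl rfl
          rw [e1]; exact hb₁ v hv l hl
      · rw [Finset.sum_range_succ, if_neg hcond]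
        simpa using h2
  · rintro s' - ⟨h1, h2, h3⟩
    exact ⟨h1, h2.congr fun l hl => by simp [wid, hl], h3⟩
  · rw [Finset.sum_add_distrib, ← Finset.mul_sum]
    simp only [cutWidth, Finset.sum_const, Finset.card_range, smul_eq_mul, Expr.cost]
    omega

/-- Boxes have width `2 ^ E`, and register `3` holds the next width. For `E = 0` this is `1 / 2 =
0`, which stops the loop when boxes are single vertices, that is, when all robots are at their
goals. -/
theorem levelsProg_runs (hB : Big d w B) (hG : BijLt d.N G) (E : ℕ) : ∀ s : State, Ctx d G s →
    s.var 3 = 2 ^ E / 2 → 2 ^ E ≤ 4 * d.N → Cfg d X (s.arr 5) s →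
    Boxed d (fun _ => 2 ^ E) G (s.arr 5) → s.var 2 + 2500 * d.k * cutSum d E ≤ B →
    Runs w levelsProg s (d.k * (d.N * 6000000) * cutSum d E + 24 * d.k * E + 2) fun s' =>
      Cfg d X (s'.arr 5) s' ∧ (∀ v < d.N, G (s'.arr 5 v) = v) ∧
        s'.var 2 = s.var 2 + 2500 * d.k * cutSum d E := by
  have hle := hB.le
  have h6 := d.six_le_N
  have hk2 := d.two_le_k
  induction E with
  | zero =>
    intro s hc h3 _ hC hb hT
    refine (Runs.loop_false hB.room (by decide) (by simp [h3]) (by simpa using h3)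
      ⟨hC, fun v hv => ?_, by simp [cutSum]⟩).mono (by simp [Expr.cost]) fun _ _ h => h
    refine Dims.ext (hG.1 _ (hC.bij.1 v hv)) hv fun l hl => ?_
    have := hb v hv l hl
    simpa using this.symm
  | succ E ih =>
    intro s hc h3 hE hC hb hT
    unfold levelsProg at ih ⊢
    have h2 : 0 < 2 ^ E := by positivity
    have hsum : cutSum d (E + 1) = cutSum d E + cutWidth d (2 ^ E) := Finset.sum_range_succ _ _
    rw [pow_succ] at h3 hE
    rw [Nat.mul_div_cancel _ (by norm_num)] at h3
    rw [hsum, mul_add] at hT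
    have hlev : Runs w (levelProg ;; .assign 3 (.var 3 / .const 2)) s
        (d.k * (d.N * 6000000) * cutWidth d (2 ^ E) + 18 * d.k + 4) fun s' =>
        Cfg d X (s'.arr 5) s' ∧ Boxed d (fun _ => 2 ^ E) G (s'.arr 5) ∧
        s'.var 2 = s.var 2 + 2500 * d.k * cutWidth d (2 ^ E) ∧ s'.var 3 = 2 ^ E / 2 := by
      refine Runs.seq (levelProg_runs hB hc hG h3 h2 (by omega) hC
        (hb.congr fun l _ => by rw [pow_succ, mul_comm]) (by omega)) fun s₁ hf₁ ⟨h4, h5, h7⟩ => ?_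
      refine (Prog.runs_of_wp hB.room (by decide) ?_).mono (by decide) fun _ _ h => h
      have e3 := (hf₁.var 3 (by decide)).trans h3
      simp only [Prog.wp, Expr.bdd_div, Expr.bdd_var, Expr.bdd_const, Expr.nval_div, Expr.nval_var,
        Expr.nval_const, e3]
      exact ⟨⟨by omega, by omega⟩, h4.setVar (by decide), h5, by simpa using h7, by simp⟩
    refine (Runs.loop_true (t₂ := d.k * (d.N * 6000000) * cutSum d E + 24 * d.k * E + 2) hB.room
      (by decide) (by simp [h3]; omega) (by simp [h3]) hlev ?_).mono ?_ fun _ _ h => h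
    · rintro s₁ hf₁ ⟨h4, h5, h7, h8⟩
      refine (ih s₁ (hc.frame hf₁ (by decide)) h8 (by omega) h4 h5 (by omega)).mono le_rfl ?_
      rintro s' - ⟨h9, h10, h11⟩
      refine ⟨h9, h10, ?_⟩
      rw [h11, h7, hsum, mul_add]; omega
    · rw [hsum, mul_add]
      simp only [Expr.cost, mul_add]
      omega

/-- The induction is on the fuel `n = N - e`. Since `N < 2 ^ N`, at most `N` doublings occur; this
crude count is good enough for a linear time bound. -/
theorem doubleProg_runs (hB : Big d w B) (n : ℕ) : ∀ (s : State) (e : ℕ), s.var 1 = d.N →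
    s.var 3 = 2 ^ e → e + n = d.N → 2 ^ e ≤ 2 * d.N →
    Runs w doubleProg s (n * 8 + 4) fun s' =>
      ∃ E, s'.var 3 = 2 ^ E ∧ d.N ≤ 2 ^ E ∧ 2 ^ E ≤ 2 * d.N ∧ E ≤ d.N := by
  have hle := hB.le
  have h6 := d.six_le_N
  induction n with
  | zero =>
    intro s e h1 h3 he h2
    have := Nat.lt_two_pow_self (n := e)
    exact (Runs.loop_false hB.room (by decide) (by simp [h1, h3]; omega) (by simp [h1, h3]; omega)
      ⟨e, h3, by omega, h2, by omega⟩).mono (by simp [Expr.ltE, Expr.cost]) fun _ _ h => h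
  | succ n ih =>
    intro s e h1 h3 he h2
    unfold doubleProg at ih ⊢
    by_cases hlt : 2 ^ e < d.N
    · have H : Runs w (.assign 3 (.var 3 + .var 3)) s 4 fun s' =>
          s'.var 3 = 2 ^ (e + 1) ∧ s'.var 1 = d.N := by
        refine (Prog.runs_of_wp hB.room (by decide) ?_).mono (by decide) fun _ _ h => h
        simp [Prog.wp, h1, h3, pow_succ]; omega
      refine (Runs.loop_true hB.room (by decide) (by simp [h1, h3]; omega) (by simpa [h1, h3])
        H fun s' _ h => ih s' (e + 1) h.2 h.1 (by omega) (by rw [pow_succ]; omega)).mono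
          (by simp [Expr.ltE, Expr.cost]; omega) fun _ _ h => h
    · exact (Runs.loop_false hB.room (by decide) (by simp [h1, h3]; omega)
        (by simp [h1, h3]; omega)
        ⟨e, h3, by omega, h2, by omega⟩).mono (by simp [Expr.ltE, Expr.cost]) fun _ _ h => h

end

/-! ### Initialisation and the complete program -/

/-- Compute the partial products of the side lengths. -/
def dimsProg : Prog :=
  .assign 1 (.const 1) ;;
  .for 18 (.var 0) (.put 4 (.var 18) (.var 1) ;; .assign 1 (.var 1 * .get 0 (.var 18)))

/-- Store a list in array `13`, from entry `i` on. -/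
def tabProg : List ℕ → ℕ → Prog
  | [], _ => .skip
  | a :: l, i => .put 13 (.const i) (.const a) ;; tabProg l (i + 1)

/-- List the robots by their initial locations. -/
def occProg : Prog := .for 17 (.var 1) (.put 5 (.get 1 (.var 17)) (.var 17))

/-- The routing algorithm. -/
def mainProg : Prog :=
  dimsProg ;; tabProg wordTab 0 ;; occProg ;; emit ;; .assign 3 (.const 1) ;; doubleProg ;;
    levelsProg ;; .assign 0 (.var 2)

section
variable {d : Dims} {G X : ℕ → ℕ} {w B : ℕ} {s : State} {i h j g : ℕ}

theorem dimsProg_runs (hB : Big d w B) (hk : s.var 0 = d.k) (hm : ∀ l < d.k, s.arr 0 l = d.m l) :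
    Runs w dimsProg s ((d.k + 1) * 16 + 2) fun s' =>
      s'.var 1 = d.N ∧ ∀ l < d.k, s'.arr 4 l = d.P l := by
  have hle := hB.le
  have h6 := d.six_le_N
  have hkN := d.k_lt_N
  have H : Runs w (.assign 1 (.const 1)) s 2 fun s' => s'.var 1 = 1 := by
    refine (Prog.runs_of_wp hB.room (by decide) ?_).mono (by decide) fun _ _ h => h
    simp [Prog.wp]; omega
  refine Runs.mono (t := 2 + (d.k + 1) * 16) ?_ (by omega) fun _ _ h => h
  refine Runs.seq H fun s₁ hf₁ h1 => ?_
  have ek := (hf₁.var 0 (by decide)).trans hk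
  have em := hf₁.arr 0 (by decide)
  refine (Runs.for_const hB.room (n := d.k) (c := 8)
    (fun n s' => s'.var 1 = d.P n ∧ ∀ l < n, s'.arr 4 l = d.P l) (by decide) (by decide)
    (by omega) ?_ ?_ ?_ ?_).mono (by simp [Expr.cost]) fun _ _ h => h
  · intro s' hf
    have := (hf.var 0 (by decide)).trans ek
    simp [this]; omega
  · exact ⟨by simpa [Dims.P_zero] using h1, by simp⟩
  · rintro n hn s₂ hf₂ ⟨h2, h3⟩ hv
    have e0 := (hf₂.arr 0 (by decide)).trans em
    have hPn := Dims.P_le_N hn.le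
    have hmn := Dims.m_le_N hn
    have emn := hm n hn
    refine (Prog.runs_of_wp hB.room (by decide) ?_).mono (by decide) fun _ _ h => h
    simp only [Prog.wp, Expr.bdd_var, Expr.bdd_mul, Expr.bdd_get, Expr.nval_var, Expr.nval_get,
      Expr.nval_mul, State.setVar_var, State.setVar_arr, State.setArr_var, State.setArr_arr, hv,
      h2, e0, emn, reduceIte, Nat.reduceEqDiff, OfNat.zero_ne_ofNat]
    refine ⟨by omega, by omega, ⟨by omega, by omega, by omega⟩, ?_, fun l hl => ?_⟩
    · simp [Dims.P_succ]
    · rw [Function.update_apply]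
      split_ifs with h
      · rw [h]
      · exact h3 l (by omega)
  · exact fun s' _ h => h

theorem tabProg_runs (hB : Room w B) (l : List ℕ) : ∀ (s : State) (i : ℕ), (∀ a ∈ l, a ≤ B) →
    i + l.length ≤ B → Runs w (tabProg l i) s (3 * l.length + 1) fun s' =>
      s'.var = s.var ∧ (∀ a, a ≠ 13 → s'.arr a = s.arr a) ∧
      (∀ q < i, s'.arr 13 q = s.arr 13 q) ∧ ∀ q < l.length, s'.arr 13 (i + q) = l.getD q 0 := by
  induction l with
  | nil => exact fun s i _ _ => ⟨s, 1, .skip s, by simp, rfl, fun _ _ => rfl, fun _ _ => rfl, by simp⟩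
  | cons a l ih =>
    intro s i ha hi
    simp only [List.length_cons] at hi ⊢
    have H : Runs w (.put 13 (.const i) (.const a)) s 3 fun s' => s' = s.setArr 13 i a := by
      refine (Prog.runs_of_wp hB (by simp [Prog.small, Expr.size]) ?_).mono
        (by simp [Prog.cost, Expr.cost]) fun _ _ h => h
      have := ha a (by simp)
      simp [Prog.wp, this]; omega
    refine Runs.mono (t := 3 + (3 * l.length + 1)) ?_ (by omega) fun _ _ h => h
    refine Runs.seq H fun s₁ _ e => (ih s₁ (i + 1) (fun b hb => ha b (by simp [hb]))
      (by omega)).mono le_rfl ?_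
    subst e
    rintro s' - ⟨h1, h2, h3, h4⟩
    refine ⟨h1, fun b hb => by rw [h2 b hb]; simp [hb], fun q hq => ?_, fun q hq => ?_⟩
    · rw [h3 q (by omega)]; simp [show q ≠ i by omega]
    · rcases q with _ | q
      · rw [h3 _ (by omega)]; simp
      · have := h4 q (by omega)
        rw [show i + (q + 1) = i + 1 + q by omega, this]; simp

theorem occProg_runs (hB : Big d w B) (hN : s.var 1 = d.N) (hX : BijLt d.N X)
    (h1 : ∀ r < d.N, s.arr 1 r = X r) : Runs w occProg s ((d.N + 1) * 12) fun s' =>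
      ∀ r < d.N, s'.arr 5 (X r) = r := by
  have hle := hB.le
  have h6 := d.six_le_N
  refine (Runs.for_const hB.room (n := d.N) (c := 4)
    (fun n s' => ∀ r < n, s'.arr 5 (X r) = r) (by decide) (by decide)
    (by omega) ?_ ?_ ?_ ?_).mono (by simp [Expr.cost]) fun _ _ h => h
  · intro s' hf
    have := (hf.var 1 (by decide)).trans hN
    simp [this]; omega
  · simp
  · rintro n hn s₂ hf₂ h2 hv
    have e1 := (congrFun (hf₂.arr 1 (by decide)) n).trans (h1 n hn)
    have hXn := hX.1 n hn
    refine (Prog.runs_of_wp hB.room (by decide) ?_).mono (by decide) fun _ _ h => h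
    simp only [Prog.wp, Expr.bdd_var, Expr.bdd_get, Expr.nval_var, Expr.nval_get,
      State.setVar_arr, State.setArr_arr, hv, e1, if_true]
    refine ⟨⟨by omega, by omega⟩, by omega, fun r hr => ?_⟩
    rw [Function.update_apply]
    split_ifs with h
    · exact (hX.2 r (by omega) n hn h).symm
    · refine h2 r (Nat.lt_of_le_of_ne (by omega) ?_)
      rintro rfl; exact h rfl
  · exact fun s' _ h => h

theorem wordTab_le : ∀ a ∈ wordTab, a ≤ 5 := by decide

theorem mainProg_runs (hB : Big d w B)
    (hBT : 5000 * d.k * ∑ l ∈ Finset.range d.k, d.m l ≤ B) (hG : BijLt d.N G) (hX : BijLt d.N X)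
    (hk : s.var 0 = d.k) (h2 : s.var 2 = 0) (hm : ∀ l < d.k, s.arr 0 l = d.m l)
    (hXI : ∀ r < d.N, s.arr 1 r = X r) (hXG : ∀ r < d.N, s.arr 2 r = G r) :
    Runs w mainProg s (13000000 * (d.k * (d.N * ∑ l ∈ Finset.range d.k, d.m l))) fun s' =>
      ∃ O, Cfg d X O s' ∧ (∀ v < d.N, G (O v) = v) ∧ s'.var 0 = s'.var 2 ∧
        s'.var 2 ≤ 5000 * (d.k * ∑ l ∈ Finset.range d.k, d.m l) := by
  have hle := hB.le
  have h6 := d.six_le_N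
  have hk2 := d.two_le_k
  set M := ∑ l ∈ Finset.range d.k, d.m l with hM
  have hM4 : 4 ≤ M := by
    have : ∑ l ∈ Finset.range d.k, 2 ≤ M :=
      Finset.sum_le_sum fun l hl => d.two_le l (Finset.mem_range.1 hl)
    simp at this; omega
  have hcut := fun E => hM ▸ cutSum_le d E
  have htime : (d.k + 1) * 16 + 2 + (3 * 108 + 1 + ((d.N + 1) * 12 + ((d.N + 1) * 20 + (2 +
      (d.N * 8 + 4 + (12000000 * (d.k * (d.N * M)) + 24 * d.k * (d.N + 1) + 2 + 2)))))) ≤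
      13000000 * (d.k * (d.N * M)) := by
    have a1 : d.k * (d.N * 4) ≤ d.k * (d.N * M) :=
      Nat.mul_le_mul_left _ (Nat.mul_le_mul_left _ hM4)
    have a2 : 2 * d.N ≤ d.k * d.N := Nat.mul_le_mul_right _ hk2
    have a3 : d.k * 6 ≤ d.k * d.N := Nat.mul_le_mul_left _ h6
    have a4 : d.k * (d.N * 4) = 4 * (d.k * d.N) := by ring
    have a5 : 24 * d.k * (d.N + 1) = 24 * (d.k * d.N) + 24 * d.k := by ring
    omega
  refine Runs.mono ?_ htime fun _ _ h => h
  refine Runs.seq (dimsProg_runs hB hk hm) fun s₁ hf₁ ⟨hN₁, hP₁⟩ => ?_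
  have k₁ := (hf₁.var 0 (by decide)).trans hk
  have v2₁ := (hf₁.var 2 (by decide)).trans h2
  have m₁ := hf₁.arr 0 (by decide)
  have i₁ := hf₁.arr 1 (by decide)
  have g₁ := hf₁.arr 2 (by decide)
  refine Runs.seq (tabProg_runs hB.room wordTab s₁ 0 (fun a ha => (wordTab_le a ha).trans (by omega))
    (by simp [wordTab]; omega)) fun s₂ _ ⟨ev, ea, _, ht⟩ => ?_
  have hc : Ctx d G s₂ := by
    refine ⟨by rw [ev, k₁], by rw [ev, hN₁], ?_, ?_, ?_, fun q hq => by simpa using ht q hq⟩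
    · rw [ea 0 (by decide), m₁]; exact hm
    · rw [ea 2 (by decide), g₁]; exact hXG
    · rw [ea 4 (by decide)]; exact hP₁
  refine Runs.seq (occProg_runs hB hc.N hX (by rw [ea 1 (by decide), i₁]; exact hXI))
    fun s₃ hf₃ ho => ?_
  have hc₃ := hc.frame hf₃ (by decide)
  have v2₃ := hf₃.var 2 (by decide)
  rw [ev, v2₁] at v2₃
  have hO : BijLt d.N (s₃.arr 5) := by
    constructor
    · intro v hv
      obtain ⟨r, hr, rfl⟩ := hX.surj hv
      rwa [ho r hr]
    · intro u hu v hv e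
      obtain ⟨r, hr, rfl⟩ := hX.surj hu
      obtain ⟨r', hr', rfl⟩ := hX.surj hv
      rw [ho r hr, ho r' hr'] at e
      rw [e]
  refine Runs.seq (emit_runs hB hc₃ hO (by omega)) fun s₄ hf₄ ⟨he, _⟩ => ?_
  have hc₄ := hc₃.frame hf₄ (by decide)
  have v2₄ := (hf₄.var 2 (by decide)).trans v2₃
  have e5₄ := hf₄.arr 5 (by decide)
  rw [v2₃] at he
  simp only [Nat.zero_mul, Nat.zero_add] at he
  have hrow : ∀ r < d.N, s₄.arr 3 r = X r := fun r hr => by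
    have := he (X r) (hX.1 r hr)
    rwa [ho r hr] at this
  have hC : Cfg d X (s₄.arr 5) s₄ := by
    refine ⟨by rwa [e5₄], hrow, fun t ht => ?_, fun t ht => by omega, fun v hv => ?_⟩
    · obtain rfl : t = 0 := by omega
      exact hX.congr fun r hr => by simpa using hrow r hr
    · rw [v2₄, e5₄]; simpa using he v hv
  have H : Runs w (.assign 3 (.const 1)) s₄ 2 fun s' => s'.var 3 = 2 ^ 0 := by
    refine (Prog.runs_of_wp hB.room (by decide) ?_).mono (by decide) fun _ _ h => h
    simp [Prog.wp]; omega
  refine Runs.seq H fun s₅ hf₅ h3₅ => ?_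
  have hc₅ := hc₄.frame hf₅ (by decide)
  have hC₅ := hC.frame hf₅ (by decide)
  rw [← hf₅.arr 5 (by decide)] at hC₅
  have v2₅ := (hf₅.var 2 (by decide)).trans v2₄
  refine Runs.seq (doubleProg_runs hB d.N s₅ 0 hc₅.N h3₅ (by omega) (by omega))
    fun s₆ hf₆ ⟨E, h3₆, hE1, hE2, hE3⟩ => ?_
  have hc₆ := hc₅.frame hf₆ (by decide)
  have hC₆ := hC₅.frame hf₆ (by decide)
  rw [← hf₆.arr 5 (by decide)] at hC₆
  have v2₆ := (hf₆.var 2 (by decide)).trans v2₅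
  have hpow : 2 ^ (E + 1) = 2 * 2 ^ E := by rw [pow_succ, mul_comm]
  -- A cut takes `2500 k` moves per unit of width, and the total width of the cuts is at most twice
  -- the sum of the sides.
  have hT : 2500 * d.k * cutSum d (E + 1) ≤ 5000 * d.k * M := by
    have := Nat.mul_le_mul_left (2500 * d.k) (hcut (E + 1))
    rwa [show 2500 * d.k * (2 * M) = 5000 * d.k * M by ring] at this
  have ht : d.k * (d.N * 6000000) * cutSum d (E + 1) + 24 * d.k * (E + 1) + 2 ≤
      12000000 * (d.k * (d.N * M)) + 24 * d.k * (d.N + 1) + 2 := by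
    have h1 := Nat.mul_le_mul_left (d.k * (d.N * 6000000)) (hcut (E + 1))
    have h2 : 24 * d.k * (E + 1) ≤ 24 * d.k * (d.N + 1) := Nat.mul_le_mul_left _ (by omega)
    rw [show d.k * (d.N * 6000000) * (2 * M) = 12000000 * (d.k * (d.N * M)) by ring] at h1
    omega
  -- The exponent is `E + 1` because register `3` holds half of the current width. As `2 ^ E` is at
  -- least `N`, hence at least every side, the initial box is the whole grid and the invariant holds
  -- trivially.
  refine Runs.seq ((levelsProg_runs hB hG (E + 1) s₆ hc₆ (by rw [h3₆, hpow]; omega) (by omega) hC₆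
    (fun v hv l hl => ?_) (by omega)).mono ht fun _ _ h => h) fun s₇ hf₇ ⟨hC₇, hg, v2₇⟩ => ?_
  · have hml := Dims.m_le_N hl
    have hx := Dims.x_lt hl v
    have hx' := Dims.x_lt hl (G (s₆.arr 5 v))
    beta_reduce
    rw [Nat.div_eq_of_lt (by omega), Nat.div_eq_of_lt (by omega)]
  · refine (Prog.runs_of_wp hB.room (by decide) ?_).mono (by decide) fun _ _ h => h
    simp only [Prog.wp, Expr.bdd_var, Expr.nval_var]
    refine ⟨by omega, s₇.arr 5, hC₇.setVar (by decide), hg, by simp, ?_⟩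
    have : 5000 * d.k * M = 5000 * (d.k * M) := by ring
    simp [v2₇, v2₆]; omega

end

/-! ### Grid vertices and their numbers -/

theorem toArray_fin {n : ℕ} (f : Fin n → ℕ) (i : Fin n) : toArray f i = f i := by
  simp [toArray]

theorem toArray_of_lt {n : ℕ} (f : Fin n → ℕ) {i : ℕ} (h : i < n) : toArray f i = f ⟨i, h⟩ := by
  simp [toArray, h]

theorem Dims.digits {d : Dims} {y : ℕ → ℕ} (hy : ∀ l < d.k, y l < d.m l) {n : ℕ} (hn : n ≤ d.k) :
    ∑ l ∈ Finset.range n, y l * d.P l < d.P n ∧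
      ∀ j < n, d.x j (∑ l ∈ Finset.range n, y l * d.P l) = y j := by
  induction n with
  | zero => simp [P_zero]
  | succ n ih =>
    obtain ⟨h1, h2⟩ := ih (by omega)
    have hyn := hy n hn
    obtain ⟨h3, h4, -⟩ := digits_of_form (hi := 0) hn h1 hyn
    rw [zero_mul, add_zero] at h3 h4
    rw [Finset.sum_range_succ]
    refine ⟨?_, fun j hj => ?_⟩
    · rw [P_succ]
      have : (y n + 1) * d.P n ≤ d.m n * d.P n := Nat.mul_le_mul_right _ hyn
      rw [add_mul, one_mul, mul_comm (d.m n)] at this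
      omega
    · rcases Nat.lt_or_ge j n with h | h
      · rw [← h2 j h]
        exact x_eq_of_mod h (by rw [h3, Nat.mod_eq_of_lt h1])
      · obtain rfl : j = n := by omega
        exact h4

section
variable {k : ℕ} {m : Fin k → ℕ}

/-- The dimensions of a grid. -/
def gridDims (hk : 2 ≤ k) (hm : ∀ i, 2 ≤ m i) (h6 : 6 ≤ ∏ i, m i) : Dims where
  k := k
  m := toArray m
  two_le_k := hk
  two_le j hj := by rw [toArray_of_lt m hj]; exact hm _
  six_le := by rw [Finset.prod_range]; simpa [toArray_fin] using h6

variable {hk : 2 ≤ k} {hm : ∀ i, 2 ≤ m i} {h6 : 6 ≤ ∏ i, m i}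

theorem gridDims_N : (gridDims hk hm h6).N = ∏ i, m i := by
  show ∏ l ∈ Finset.range k, toArray m l = _
  rw [Finset.prod_range]; simp [toArray_fin]

theorem vertexCode_eq (v : GridVertex m) : vertexCode v =
    ∑ l ∈ Finset.range k, toArray (fun i => (v i : ℕ)) l * (gridDims hk hm h6).P l := by
  rw [Finset.sum_range, vertexCode, finPiFinEquiv_apply]
  refine Finset.sum_congr rfl fun i _ => ?_
  rw [toArray_fin]
  congr 1
  show _ = ∏ l ∈ Finset.range i, toArray m l
  rw [Finset.prod_range]
  refine Finset.prod_congr rfl fun j _ => ?_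
  rw [toArray_of_lt m (j.2.trans i.2)]
  rfl

theorem vertexCode_lt (v : GridVertex m) : vertexCode v < ∏ i, m i := (finPiFinEquiv v).2

theorem vertexCode_inj {u v : GridVertex m} (h : vertexCode u = vertexCode v) : u = v :=
  finPiFinEquiv.injective (Fin.ext h)

theorem x_vertexCode (v : GridVertex m) (i : Fin k) :
    (gridDims hk hm h6).x i (vertexCode v) = v i := by
  rw [vertexCode_eq (hk := hk) (hm := hm) (h6 := h6)]
  refine ((Dims.digits (d := gridDims hk hm h6) (fun l hl => ?_) le_rfl).2 i i.2).trans
    (toArray_fin _ i)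
  have hl : l < k := hl
  show toArray _ l < toArray m l
  rw [toArray_of_lt _ hl, toArray_of_lt _ hl]
  exact (v _).2

theorem gridGraph_adj {u v : GridVertex m}
    (h : (gridDims hk hm h6).Adj (vertexCode u) (vertexCode v)) : (gridGraph m).Adj u v := by
  obtain ⟨j, hj, h1, h2⟩ := h
  refine ⟨⟨j, hj⟩, ?_, fun l hl => Fin.ext ?_⟩
  · have e1 := x_vertexCode (hk := hk) (hm := hm) (h6 := h6) u ⟨j, hj⟩
    have e2 := x_vertexCode (hk := hk) (hm := hm) (h6 := h6) v ⟨j, hj⟩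
    rw [← e1, ← e2]; exact h1
  · rw [← x_vertexCode (hk := hk) (hm := hm) (h6 := h6) u l,
      ← x_vertexCode (hk := hk) (hm := hm) (h6 := h6) v l]
    exact h2 l l.2 fun e => hl (Fin.ext e)

theorem bijLt_config (Y : Config (∏ i, m i) (GridVertex m)) :
    BijLt (∏ i, m i) (toArray fun r => vertexCode (Y r)) := by
  constructor
  · intro r hr
    rw [toArray_of_lt _ hr]; exact vertexCode_lt _
  · intro r hr r' hr' h
    rw [toArray_of_lt _ hr, toArray_of_lt _ hr'] at h
    exact Fin.mk.inj_iff.1 (Y.injective (vertexCode_inj h))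

theorem exists_config {L : ℕ → ℕ} (hL : BijLt (∏ i, m i) L) :
    ∃ Y : Config (∏ i, m i) (GridVertex m), ∀ r, vertexCode (Y r) = L r :=
  ⟨⟨fun r => finPiFinEquiv.symm ⟨L r, hL.1 r r.2⟩, fun _ _ h =>
    Fin.ext (hL.2 _ (Fin.is_lt _) _ (Fin.is_lt _) (Fin.mk.inj_iff.1 (finPiFinEquiv.symm.injective h)))⟩,
    fun _ => congrArg Fin.val (finPiFinEquiv.apply_symm_apply _)⟩

theorem config_ext {n : ℕ} {Y Y' : Config n (GridVertex m)}
    (h : ∀ r, vertexCode (Y r) = vertexCode (Y' r)) : Y = Y' :=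
  DFunLike.ext _ _ fun r => vertexCode_inj (h r)

/-- With `B = N ^ 8`, `B ^ 64 = N ^ 512` is at most 2 to the power `512` times the logarithm; the
factor `513` makes the inequality strict. The other bound uses `1000 ≤ 6 ^ 7 ≤ N ^ 7`. -/
theorem big_gridDims {w : ℕ} (hw : 513 * Nat.clog 2 (∏ i, m i) ≤ w) :
    Big (gridDims hk hm h6) w ((∏ i, m i) ^ 8) := by
  set n := ∏ i, m i with hn
  have h2 : n ≤ n ^ 8 := Nat.le_self_pow (by norm_num) n
  refine ⟨⟨by omega, ?_⟩, ?_⟩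
  · have h1 : n ≤ 2 ^ Nat.clog 2 n := Nat.le_pow_clog (by norm_num) n
    have h3 : 0 < Nat.clog 2 n := Nat.clog_pos (by norm_num) (by omega)
    calc (n ^ 8) ^ 64 ≤ ((2 ^ Nat.clog 2 n) ^ 8) ^ 64 :=
          Nat.pow_le_pow_left (Nat.pow_le_pow_left h1 _) _
      _ = 2 ^ (Nat.clog 2 n * 8 * 64) := by rw [← pow_mul, ← pow_mul, mul_assoc]
      _ < 2 ^ w := Nat.pow_lt_pow_right (by norm_num) (by omega)
  · rw [gridDims_N, ← hn]
    calc 1000 * n ≤ 6 ^ 7 * n := Nat.mul_le_mul_right _ (by norm_num)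
      _ ≤ n ^ 7 * n := Nat.mul_le_mul_right _ (Nat.pow_le_pow_left h6 _)
      _ = n ^ 8 := by ring

end
end MPP

/-! ### The theorem -/

theorem mainTheorem4 :
    ∃ (A : MPP.Prog) (C c : ℕ), 1 ≤ c ∧
      ∀ (k : ℕ) (m : Fin k → ℕ), 2 ≤ k → (∀ i, 2 ≤ m i) → 6 ≤ ∏ i, m i →
      ∀ XI XG : MPP.Config (∏ i, m i) (MPP.GridVertex m),
      ∀ w : ℕ, c * Nat.clog 2 (∏ i, m i) ≤ w →
      ∃ (s : MPP.State) (t T : ℕ) (X : ℕ → MPP.Config (∏ i, m i) (MPP.GridVertex m)),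
        MPP.Exec w A (MPP.inputState XI XG) s t ∧
        MPP.Outputs s T X ∧
        MPP.IsSolution (MPP.gridGraph m) XI XG T X ∧
        T ≤ C * (k * ∑ i, m i) ∧
        t ≤ C * (k * ((∏ i, m i) * ∑ i, m i)) := by
  refine ⟨MPP.mainProg, 13000000, 513, by norm_num, fun k m hk hm h6 XI XG w hw => ?_⟩
  let d := MPP.gridDims hk hm h6
  have hN : d.N = ∏ i, m i := MPP.gridDims_N
  have hM : ∑ l ∈ Finset.range d.k, d.m l = ∑ i, m i := by
    show ∑ l ∈ Finset.range k, MPP.toArray m l = _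
    rw [Finset.sum_range]; simp [MPP.toArray_fin]
  have hbig : MPP.Big d w ((∏ i, m i) ^ 8) := MPP.big_gridDims hw
  have hX : MPP.BijLt d.N (MPP.toArray fun r => MPP.vertexCode (XI r)) := by
    rw [hN]; exact MPP.bijLt_config XI
  have hG : MPP.BijLt d.N (MPP.toArray fun r => MPP.vertexCode (XG r)) := by
    rw [hN]; exact MPP.bijLt_config XG
  -- The move counter has to stay within `B`. Since `k < N` and every side is at most `N`, its bound
  -- is at most `5000 N ^ 3`, and `5000 ≤ 6 ^ 5 ≤ N ^ 5`.
  have hBT : 5000 * d.k * ∑ l ∈ Finset.range d.k, d.m l ≤ (∏ i, m i) ^ 8 := by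
    have h1 : ∑ l ∈ Finset.range d.k, d.m l ≤ d.k * d.N := by
      have := Finset.sum_le_card_nsmul (Finset.range d.k) d.m d.N
        fun l hl => MPP.Dims.m_le_N (Finset.mem_range.1 hl)
      simpa using this
    have h2 := d.k_lt_N.le
    have h3 := d.six_le_N
    rw [← hN]
    calc 5000 * d.k * ∑ l ∈ Finset.range d.k, d.m l ≤ 5000 * d.N * (d.N * d.N) :=
          Nat.mul_le_mul (Nat.mul_le_mul_left _ h2) (h1.trans (Nat.mul_le_mul_right _ h2))
      _ = 5000 * d.N ^ 3 := by ring
      _ ≤ 6 ^ 5 * d.N ^ 3 := Nat.mul_le_mul_right _ (by norm_num)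
      _ ≤ d.N ^ 5 * d.N ^ 3 := Nat.mul_le_mul_right _ (Nat.pow_le_pow_left h3 _)
      _ = d.N ^ 8 := by ring
  obtain ⟨s, t, hs, ht, O, hC, hO, h02, hT⟩ := MPP.mainProg_runs (s := MPP.inputState XI XG) hbig
    hBT hG hX (by rfl) (by rfl) (fun _ _ => rfl) (fun _ _ => rfl) (fun _ _ => rfl)
  rw [hM] at hT ht
  have hrow : ∀ τ, ∃ Y : MPP.Config (∏ i, m i) (MPP.GridVertex m), τ ≤ s.var 2 →
      ∀ r, MPP.vertexCode (Y r) = s.arr 3 (τ * (∏ i, m i) + r) := by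
    intro τ
    by_cases h : τ ≤ s.var 2
    · obtain ⟨Y, hY⟩ := MPP.exists_config (hN ▸ hC.hist τ h)
      exact ⟨Y, fun _ => hY⟩
    -- Configurations beyond the makespan are irrelevant.
    · exact ⟨XI, fun h' => absurd h' h⟩
  choose X hX' using hrow
  refine ⟨s, t, s.var 2, X, hs, ⟨h02, fun τ hτ r => (hX' τ hτ r).symm⟩, ⟨?_, ?_, ?_⟩, ?_, ?_⟩
  · refine MPP.config_ext fun r => ?_
    rw [hX' 0 (Nat.zero_le _), zero_mul, zero_add, hC.start r (r.2.trans_eq hN.symm),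
      MPP.toArray_fin]
  · refine MPP.config_ext fun r => ?_
    obtain ⟨v, hv, e⟩ := hC.bij.surj (r := r) (r.2.trans_eq hN.symm)
    have h1 := hO v hv
    have h2 := hC.cur v hv
    rw [e, MPP.toArray_fin] at h1
    rw [e, hN] at h2
    rw [hX' _ le_rfl, h2, h1]
  · intro τ hτ
    obtain ⟨h1, h2⟩ := hC.move τ hτ
    rw [hN] at h1 h2
    refine ⟨fun r => ?_, fun r r' hne e e' => ?_⟩
    · rcases h1 r r.2 with h | h
      · left
        refine MPP.vertexCode_inj ?_
        rw [hX' _ (by omega), hX' _ (by omega)]; exact h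
      · right
        refine MPP.gridGraph_adj (hk := hk) (hm := hm) (h6 := h6) ?_
        rw [hX' _ (by omega), hX' _ (by omega)]; exact h
    · refine h2 r r.2 r' r'.2 (fun h => hne (Fin.ext h)) ?_ ?_
      · beta_reduce
        rw [← hX' _ (by omega), ← hX' _ (by omega), e]
      · beta_reduce
        rw [← hX' _ (by omega), ← hX' _ (by omega), e']
  · refine hT.trans ?_
    exact Nat.mul_le_mul_right _ (by norm_num)
  · rw [hN] at ht
    exact ht
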